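/- **Setting.** Let $d\ge 0$. A *functional* is a map $F:C^\infty(\mathbb R^d,\mathbb R)\to\mathbb C$. It is an *observable*, $F\in\mathcal F$, if it is infinitely differentiable, all its functional derivatives $\frac{\delta^nF}{\delta\varphi^n}$ are compactly supported distributions on $(\mathbb R^d)^n$, and it is polynomial in the field (its derivatives of sufficiently high order vanish). It is *local* if moreover $\frac{\delta^nF}{\delta\varphi^n}$ is supported on the total diagonal $\{x_1=\dots=x_n\}$ for all $n$. For $p\in\mathcal S(\mathbb R^d)$ put $$F\star_pG=\sum_{n\ge0}\frac{\hbar^n}{n!}\int dx_1\cdots dx_n\,dy_1\cdots dy_n\;\frac{\delta^nF}{\delta\varphi(x_1)\cdots\delta\varphi(x_n)}\prod_{i=1}^n p(x_i-y_i)\,\frac{\delta^nG}{\delta\varphi(y_1)\cdots\delta\varphi(y_n)},$$ extended bilinearly to formal power series in $\hbar$ and in a coupling constant $g$ that counts the order in the interaction. Let $(p_\Lambda)_{\Lambda>0}$ be a family in $\mathcal S(\mathbb R^d)$ with $p_\Lambda(-z)=p_\Lambda(z)$, differentiable in $\Lambda$ in the topology of $\mathcal S(\mathbb R^d)$. The regularized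 $S$-matrix is $$\mathbf S_\Lambda(W)=\sum_{n\ge 0}\frac1{n!}\,\underbrace{W\star_{p_\Lambda}\cdots\star_{p_\Lambda}W}_{n}\qquad (W\in g\,\mathcal F[[\hbar,g]]).$$ Let $\mathcal F_{\rm loc}$ be any linear space of formal power series in $\hbar$ whose coefficients are local observables, and let $\mathbf S$ be given by time-ordered products, $\mathbf S(gV)=\sum_{n\ge0}\frac{g^n}{n!}T_n(V^{\otimes n})$, where $T_n:\mathcal F_{\rm loc}^{\otimes n}\to\mathcal F[[\hbar]]$ are linear and totally symmetric with $T_0=1$ and $T_1=\mathrm{id}$. (Every $S$-matrix of causal perturbation theory has these properties; none of its further axioms is needed.) **Theorem (flow equation).** For every $\Lambda>0$ the map $\mathbf S_\Lambda$ is a bijection from $g\,\mathcal F[[\hbar,g]]$ onto $1+g\,\mathcal F[[\hbar,g]]$. Hence, for $V\in\mathcal F_{\rm loc}$, the effective potential $V_\Lambda:=\mathbf S_\Lambda^{-1}\circ\mathbf S(gV)\in g\,\mathcal F[[\hbar,g]]$ is well defined, so that $\mathbf S_\Lambda(V_\Lambda)=\mathbf S(gV)$. Every coefficient of $V_\Lambda$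 is, at every field configuration $\varphi$, differentiable in $\Lambda>0$, and $$\frac{d}{d\Lambda}V_\Lambda=-\frac\hbar2\int dx\,dy\;\frac{d\,p_\Lambda(x-y)}{d\Lambda}\;\frac{\delta V_\Lambda}{\delta\varphi(x)}\star_{p_\Lambda}\frac{\delta V_\Lambda}{\delta\varphi(y)} .$$ Moreover $\lambda\mapsto V_\Lambda\star_{p_\lambda}V_\Lambda$ is (in the same sense) differentiable at $\lambda=\Lambda$, and $$\frac{d}{d\Lambda}V_\Lambda=-\frac12\,\frac{d}{d\lambda}\Big|_{\lambda=\Lambda}\bigl(V_\Lambda\star_{p_\lambda}V_\Lambda\bigr).$$ -/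

import Mathlib

open scoped ContDiff SchwartzMap Topology

noncomputable section

namespace FlowEquation

/-- Space-time `ℝ^d` (no use is made of the metric). -/
abbrev Spc (d : ℕ) : Type := EuclideanSpace ℝ (Fin d)

/-- The off-shell configuration space `C^∞(ℝ^d, ℝ)` of a real scalar field. -/
def Config (d : ℕ) : Submodule ℝ (Spc d → ℝ) where
  carrier := {φ | ContDiff ℝ ∞ φ}
  add_mem' {f g} hf hg := by
    have hf' : ContDiff ℝ ∞ f := hf
    have hg' : ContDiff ℝ ∞ g := hg
    exact hf'.add hg'
  zero_mem' := by
    have h : ContDiff ℝ ∞ (fun _ => 0 : Spc d → ℝ) := contDiff_const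
    exact h
  smul_mem' c f hf := by
    have hf' : ContDiff ℝ ∞ f := hf
    exact hf'.const_smul c

/-- The space `C^∞((ℝ^d)^n, ℂ)`. -/
def SmoothFn (d n : ℕ) : Submodule ℂ ((Fin n → Spc d) → ℂ) where
  carrier := {f | ContDiff ℝ ∞ f}
  add_mem' {f g} hf hg := by
    have hf' : ContDiff ℝ ∞ f := hf
    have hg' : ContDiff ℝ ∞ g := hg
    exact hf'.add hg'
  zero_mem' := by
    have h : ContDiff ℝ ∞ (fun _ => 0 : (Fin n → Spc d) → ℂ) := contDiff_const
    exact h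
  smul_mem' c f hf := by
    have hf' : ContDiff ℝ ∞ f := hf
    exact hf'.const_smul c

/-- Compactly supported distributions on `(ℝ^d)^n`: the continuous linear functionals on
`C^∞((ℝ^d)^n, ℂ)`, continuity being expressed by the usual bound by finitely many derivatives
on a compact set. -/
structure CDist (d n : ℕ) where
  toLin : SmoothFn d n →ₗ[ℂ] ℂ
  bound : ∃ (K : Set (Fin n → Spc d)) (m : ℕ) (C : ℝ), IsCompact K ∧
    ∀ (f : SmoothFn d n) (M : ℝ),
      (∀ i ≤ m, ∀ x ∈ K, ‖iteratedFDeriv ℝ i (f : (Fin n → Spc d) → ℂ) x‖ ≤ M) →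
        ‖toLin f‖ ≤ C * M

instance (d n : ℕ) : Zero (CDist d n) :=
  ⟨⟨0, ∅, 0, 0, isCompact_empty, fun _ _ _ => by simp⟩⟩

open Classical in
/-- The pairing `∫ dx u(x) f(x)` of a compactly supported distribution with a smooth function
(and `0` if `f` is not smooth; all functions it is used for below are smooth). -/
def CDist.pair {d n : ℕ} (u : CDist d n) (f : (Fin n → Spc d) → ℂ) : ℂ :=
  if hf : f ∈ SmoothFn d n then u.toLin ⟨f, hf⟩ else 0

/-- The function `h₁ ⊗ ⋯ ⊗ hₙ` on `(ℝ^d)^n`. -/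
def tensor {d n : ℕ} (h : Fin n → Config d) : (Fin n → Spc d) → ℂ :=
  fun x => ∏ i, (((h i : Spc d → ℝ) (x i) : ℝ) : ℂ)

/-- Functionals `F : C^∞(ℝ^d, ℝ) → ℂ`. -/
abbrev Functional (d : ℕ) : Type := Config d → ℂ

/-- The derivative of `F` at `φ` in the direction `h`. -/
def dirDeriv {d : ℕ} (h : Config d) (F : Functional d) : Functional d :=
  fun φ => deriv (fun s : ℝ => F (φ + s • h)) 0

/-- The iterated directional derivative `∂_{h₁} ⋯ ∂_{hₙ} F`. -/
def iterDirDeriv {d : ℕ} : (n : ℕ) → (Fin n → Config d) → Functional d → Functional d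
  | 0, _, F => F
  | n + 1, h, F => dirDeriv (h 0) (iterDirDeriv n (Fin.tail h) F)

/-- `u` is the `n`-th functional derivative of `F` at `φ`:
`∂_{h₁} ⋯ ∂_{hₙ} F (φ) = ∫ dx₁ ⋯ dxₙ u(x₁, …, xₙ) h₁(x₁) ⋯ hₙ(xₙ)`. -/
def IsFuncDeriv {d : ℕ} (n : ℕ) (F : Functional d) (φ : Config d) (u : CDist d n) : Prop :=
  ∀ h : Fin n → Config d, iterDirDeriv n h F φ = u.pair (tensor h)

open Classical in
/-- The `n`-th functional derivative `δⁿF/δφⁿ` at `φ` (unique if it exists, since the linear span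
of the tensor products is dense in `C^∞`). -/
def funcDeriv {d : ℕ} (n : ℕ) (F : Functional d) (φ : Config d) : CDist d n :=
  if h : ∃ u, IsFuncDeriv n F φ u then h.choose else 0

/-- Observables: infinitely differentiable functionals all of whose functional derivatives are
compactly supported distributions, and which are polynomial in the field. -/
structure IsObservable {d : ℕ} (F : Functional d) : Prop where
  smooth : ∀ (n : ℕ) (φ : Config d) (h : Fin n → Config d),
    ContDiff ℝ ∞ (fun s : Fin n → ℝ => F (φ + ∑ i, s i • h i))
  distributional : ∀ (n : ℕ) (φ : Config d), ∃ u, IsFuncDeriv n F φ u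
  polynomial : ∃ N : ℕ, ∀ n > N, ∀ (φ : Config d) (h : Fin n → Config d),
    iterDirDeriv n h F φ = 0

/-- Local functionals: all functional derivatives are supported on the total diagonal. -/
structure IsLocal {d : ℕ} (F : Functional d) : Prop extends IsObservable F where
  diagonal : ∀ (n : ℕ) (φ : Config d) (f : (Fin n → Spc d) → ℂ), ContDiff ℝ ∞ f →
    Disjoint (tsupport f) {x | ∀ i j, x i = x j} → (funcDeriv n F φ).pair f = 0

/-- The `n`-fold contraction with propagators `q₁, …, qₙ`, i.e.
`∫ dx₁ ⋯ dxₙ dy₁ ⋯ dyₙ δⁿF/δφ(x₁)⋯δφ(xₙ) ∏ᵢ qᵢ(xᵢ - yᵢ) δⁿG/δφ(y₁)⋯δφ(yₙ)`. -/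
def contract {d n : ℕ} (q : Fin n → 𝓢(Spc d, ℂ)) (F G : Functional d) : Functional d :=
  fun φ => (funcDeriv n F φ).pair fun x => (funcDeriv n G φ).pair fun y =>
    ∏ i, q i (x i - y i)

/-- Formal power series in `ħ` with functionals as coefficients. -/
abbrev HSeries (d : ℕ) : Type := PowerSeries (Functional d)

/-- Formal power series in the order of the interaction (the coupling constant `g`), whose
coefficients are formal power series in `ħ`. -/
abbrev GSeries (d : ℕ) : Type := PowerSeries (HSeries d)

/-- The coefficient of `g^n ħ^k`. -/
def gcoeff {d : ℕ} (n k : ℕ) (W : GSeries d) : Functional d :=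
  PowerSeries.coeff k (PowerSeries.coeff n W)

/-- All coefficients are observables. -/
def IsObservableSeries {d : ℕ} (W : GSeries d) : Prop :=
  ∀ n k, IsObservable (gcoeff n k W)

/-- The formal parameter `ħ`. -/
def hbar {d : ℕ} : GSeries d := PowerSeries.C PowerSeries.X

/-- `∑_j ħ^j / j! · c_j(A, B)`, with `c_j` extended bilinearly to formal power series. -/
def hbarSum {d : ℕ} (c : ℕ → Functional d → Functional d → Functional d)
    (A B : GSeries d) : GSeries d :=
  PowerSeries.mk fun n => PowerSeries.mk fun k =>
    ∑ a ∈ Finset.HasAntidiagonal.antidiagonal n, ∑ b ∈ Finset.HasAntidiagonal.antidiagonal k,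
      ∑ e ∈ Finset.HasAntidiagonal.antidiagonal b.2,
        ((b.1.factorial : ℂ)⁻¹) • c b.1 (gcoeff a.1 e.1 A) (gcoeff a.2 e.2 B)

/-- The product `⋆_p` with propagator `p`. -/
def star {d : ℕ} (p : 𝓢(Spc d, ℂ)) : GSeries d → GSeries d → GSeries d :=
  hbarSum fun j => contract (fun _ : Fin j => p)

/-- `∫ dx dy q(x - y) δA/δφ(x) ⋆_p δB/δφ(y)`. -/
def starDeriv {d : ℕ} (q p : 𝓢(Spc d, ℂ)) : GSeries d → GSeries d → GSeries d :=
  hbarSum fun j => contract (Fin.cons q (fun _ : Fin j => p) : Fin (j + 1) → 𝓢(Spc d, ℂ))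

/-- The regularized time-ordered product `T_Λ(W^{⊗n}) = W ⋆_p ⋯ ⋆_p W`. -/
def starPow {d : ℕ} (p : 𝓢(Spc d, ℂ)) (W : GSeries d) : ℕ → GSeries d
  | 0 => 1
  | n + 1 => star p W (starPow p W n)

/-- The regularized S-matrix `∑_n W^{⋆n} / n!`, for `W` of order at least one in `g`
(then `W^{⋆n}` is of order at least `n`, so that only `n ≤ N` contributes to the order `N`). -/
def regS {d : ℕ} (p : 𝓢(Spc d, ℂ)) (W : GSeries d) : GSeries d :=
  PowerSeries.mk fun N => ∑ n ∈ Finset.range (N + 1),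
    ((n.factorial : ℂ)⁻¹) • PowerSeries.coeff N (starPow p W n)

/-- The domain of the regularized S-matrix: series of observables of order at least one in `g`. -/
def interactions (d : ℕ) : Set (GSeries d) :=
  {W | IsObservableSeries W ∧ PowerSeries.coeff 0 W = 0}

/-- Series of observables of the form `1 + O(g)`. -/
def unitSeries (d : ℕ) : Set (GSeries d) :=
  {W | IsObservableSeries W ∧ PowerSeries.coeff 0 W = 1}

/-- An S-matrix on the space `D` of interactions, given by its time-ordered products
`T_n : D^{⊗n} → F[[ħ]]`: linear, totally symmetric, with `S(0) = 1` and `S'(0) = id`.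
The further axioms of causal perturbation theory restrict this class and are not imposed. -/
structure SMatrix {d : ℕ} (D : Submodule ℂ (HSeries d)) where
  T : (n : ℕ) → MultilinearMap ℂ (fun _ : Fin n => D) (HSeries d)
  observable : ∀ (n : ℕ) (v : Fin n → D) (k : ℕ), IsObservable (PowerSeries.coeff k (T n v))
  symm : ∀ (n : ℕ) (v : Fin n → D) (σ : Equiv.Perm (Fin n)), T n (fun i => v (σ i)) = T n v
  start_zero : ∀ v : Fin 0 → D, T 0 v = 1
  start_one : ∀ V : D, T 1 (fun _ => V) = V

/-- `S(gV) = ∑_n g^n T_n(V^{⊗n}) / n!`. -/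
def SMatrix.eval {d : ℕ} {D : Submodule ℂ (HSeries d)} (S : SMatrix D) (V : D) : GSeries d :=
  PowerSeries.mk fun n => ((n.factorial : ℂ)⁻¹) • S.T n (fun _ => V)

/-- The effective potential `S_Λ⁻¹ ∘ S (V)` for the regularized propagator `p = p_Λ`. -/
def effPot {d : ℕ} {D : Submodule ℂ (HSeries d)} (S : SMatrix D) (p : 𝓢(Spc d, ℂ)) (V : D) :
    GSeries d :=
  Function.invFunOn (regS p) (interactions d) (S.eval V)

/-- The family `W` of series is differentiable at `t` with derivative `W'`, coefficient by
coefficient and at each field configuration. -/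
def HasSeriesDerivAt {d : ℕ} (W : ℝ → GSeries d) (W' : GSeries d) (t : ℝ) : Prop :=
  ∀ (n k : ℕ) (φ : Config d), HasDerivAt (fun s => gcoeff n k (W s) φ) (gcoeff n k W' φ) t

end FlowEquation

end

/-! For an even Schwartz function p let D be the operator ½ ∫ dx dy p(x - y) δ²/δφ(x)δφ(y). Applied
to an n-fold contraction of F and G, it acts on F, or acts on G, or takes one derivative from each;
the two mixed terms agree because p is even, cancel the factor ½ and add one more propagator
(`lap_contract`). Summing over n gives exp(ħD)(A · B) = exp(ħD)A ⋆ exp(ħD)B (`hbarBil_expOp`): the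
star product is the pointwise product transported by an invertible operator. Hence the regularized
S-matrix is exp(ħD) ∘ exp ∘ exp(-ħD). Its bijectivity is that of exp on power series in g over a
commutative algebra, and V_Λ = exp(ħD) log(exp(-ħD) S(gV)).

For the flow let D' be the operator D with p replaced by its Λ-derivative. It commutes with D, so W
= exp(-ħD) S(gV) satisfies W' = -ħ D'W. Put Γ(a, b) = D'(ab) - D'(a) b - a D'(b). Since D' is of
second order without constant term, D' e^Y = e^Y (D'Y + ½ Γ(Y, Y)), so Y = log W satisfies Y' = -ħ
(D'Y + ½ Γ(Y, Y)). In the derivative of exp(ħD) Y the term D'Y cancels, and -(ħ/2) exp(ħD) Γ(Y, Y)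
remains. This is the right-hand side of the flow equation, because exp(ħD) turns Γ into the star
contraction with one additional line dp/dΛ (`starDeriv_wickExp`). The same computation identifies
the derivative of V ⋆ V with respect to the propagator (`IsDerivClass.mul_flow`).

The analysis rests on two facts. First, functional derivatives are prescribed only on products of
real functions of one point, and such products determine a compactly supported distribution
(`IsDist.ext_tensor`, proved by Fourier inversion). Secondly, observables are polynomial, so along
every line their derivatives are finite sums of powers with distributions as coefficients
(`IsPoly.exists_line`). Leibniz rules then follow from finite sums, without a topology on the
configuration space. Differentiability in Λ is carried by the class `HasObsDeriv`, which is stable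
under products and under the operators D. -/

namespace FlowEquation

/-! ### Compactly supported distributions: slices and tensor products. -/

section Distributions

variable {E F E' : Type*} [NormedAddCommGroup E] [NormedSpace ℝ E]
  [NormedAddCommGroup F] [NormedSpace ℝ F] [NormedAddCommGroup E'] [NormedSpace ℝ E']

/-- A compactly supported distribution on `E`, as a functional on all functions of which only the
values on smooth functions matter. -/
structure IsDist (u : (E → ℂ) → ℂ) : Prop where
  map_add : ∀ f g, ContDiff ℝ ∞ f → ContDiff ℝ ∞ g → u (fun x => f x + g x) = u f + u g
  map_smul : ∀ (c : ℂ) f, ContDiff ℝ ∞ f → u (fun x => c * f x) = c * u f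
  bound : ∃ (K : Set E) (m : ℕ) (C : ℝ), IsCompact K ∧ 0 ≤ C ∧
    ∀ (f : E → ℂ) (M : ℝ), ContDiff ℝ ∞ f → 0 ≤ M →
      (∀ i ≤ m, ∀ x ∈ K, ‖iteratedFDeriv ℝ i f x‖ ≤ M) → ‖u f‖ ≤ C * M

theorem norm_iteratedFDeriv_comp_clm_le {f : F → ℂ} (hf : ContDiff ℝ ∞ f) (A : E →L[ℝ] F)
    (i : ℕ) (x : E) :
    ‖iteratedFDeriv ℝ i (fun x => f (A x)) x‖ ≤ ‖iteratedFDeriv ℝ i f (A x)‖ * ‖A‖ ^ i := by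
  have h := A.iteratedFDeriv_comp_right hf x (i := i) (by exact_mod_cast le_top)
  have h2 := ContinuousMultilinearMap.norm_compContinuousLinearMap_le
    (iteratedFDeriv ℝ i f (A x)) (fun _ : Fin i => A)
  rw [← h] at h2
  simpa [Function.comp_def] using h2

theorem norm_iteratedFDeriv_slice_le {V : Type*} [NormedAddCommGroup V] [NormedSpace ℝ V]
    {G : E × F → V} (hG : ContDiff ℝ ∞ G) (i : ℕ) (x : E) (y : F) :
    ‖iteratedFDeriv ℝ i (fun y => G (x, y)) y‖ ≤ ‖iteratedFDeriv ℝ i G (x, y)‖ := by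
  have hH : ContDiff ℝ ∞ (fun z : E × F => G (z + (x, 0))) := by fun_prop
  have h := (ContinuousLinearMap.inr ℝ E F).iteratedFDeriv_comp_right hH y (i := i)
    (by exact_mod_cast le_top)
  have h2 := ContinuousMultilinearMap.norm_compContinuousLinearMap_le
    (iteratedFDeriv ℝ i (fun z : E × F => G (z + (x, 0))) (ContinuousLinearMap.inr ℝ E F y))
      (fun _ : Fin i => ContinuousLinearMap.inr ℝ E F)
  rw [← h, iteratedFDeriv_comp_add_right] at h2
  simp only [Function.comp_def, ContinuousLinearMap.inr_apply, Prod.mk_add_mk, zero_add,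
    add_zero] at h2
  refine h2.trans ?_
  have h3 : ∏ _i : Fin i, ‖ContinuousLinearMap.inr ℝ E F‖ ≤ 1 :=
    Finset.prod_le_one (fun _ _ => norm_nonneg _)
      fun _ _ => ContinuousLinearMap.norm_inr_le_one ℝ E F
  exact mul_le_of_le_one_right (norm_nonneg _) h3

theorem contDiff_iteratedFDeriv {V : Type*} [NormedAddCommGroup V] [NormedSpace ℝ V]
    {G : E → V} (hG : ContDiff ℝ ∞ G) (i : ℕ) : ContDiff ℝ ∞ (iteratedFDeriv ℝ i G) :=
  hG.iteratedFDeriv_right (m := ∞) (by exact_mod_cast le_top)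

theorem fderiv_continuousMultilinearMap_apply {V : Type*} [NormedAddCommGroup V]
    [NormedSpace ℝ V] {j : ℕ} {A : E → ContinuousMultilinearMap ℝ (fun _ : Fin j => E) V} {x : E}
    (hA : DifferentiableAt ℝ A x) (k : E) (w : Fin j → E) :
    fderiv ℝ A x k w = fderiv ℝ (fun x => A x w) x k := by
  have h2 : HasFDerivAt (fun x => A x w) _ x :=
    (ContinuousMultilinearMap.apply ℝ (fun _ : Fin j => E) V w).hasFDerivAt.comp x hA.hasFDerivAt
  rw [h2.fderiv]
  rfl

theorem norm_iteratedFDeriv_iteratedFDeriv {V : Type*} [NormedAddCommGroup V] [NormedSpace ℝ V]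
    (G : E → V) (i j : ℕ) (x : E) :
    ‖iteratedFDeriv ℝ i (iteratedFDeriv ℝ j G) x‖ = ‖iteratedFDeriv ℝ (i + j) G x‖ := by
  induction j generalizing i with
  | zero =>
    rw [iteratedFDeriv_zero_eq_comp, LinearIsometryEquiv.norm_iteratedFDeriv_comp_left, add_zero]
  | succ j ih =>
    have h : iteratedFDeriv ℝ (j + 1) G =
        (continuousMultilinearCurryLeftEquiv ℝ (fun _ : Fin (j + 1) => E) V).symm ∘
          fderiv ℝ (iteratedFDeriv ℝ j G) := iteratedFDeriv_succ_eq_comp_left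
    have h2 := LinearIsometryEquiv.norm_iteratedFDeriv_comp_left (𝕜 := ℝ) (E := E)
      (continuousMultilinearCurryLeftEquiv ℝ (fun _ : Fin (j + 1) => E) V).symm
      (fderiv ℝ (iteratedFDeriv ℝ j G)) x i
    rw [h]
    refine h2.trans ?_
    rw [norm_iteratedFDeriv_fderiv, ih, add_right_comm, add_assoc]

/-- The symmetry of second derivatives moves the fixed direction past one derivative at a time. -/
theorem fderiv_iteratedFDeriv_apply {V : Type*} [NormedAddCommGroup V] [NormedSpace ℝ V]
    {G : E → V} (hG : ContDiff ℝ ∞ G) (i : ℕ) (x v : E) :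
    fderiv ℝ (iteratedFDeriv ℝ i G) x v = iteratedFDeriv ℝ i (fun y => fderiv ℝ G y v) x := by
  induction i generalizing x v with
  | zero =>
    ext m
    rw [iteratedFDeriv_zero_eq_comp, iteratedFDeriv_zero_apply]
    rw [LinearIsometryEquiv.comp_fderiv]
    rfl
  | succ i ih =>
    have hA : ContDiff ℝ ∞ (iteratedFDeriv ℝ i G) :=
      contDiff_iteratedFDeriv hG _
    have hA1 : ContDiff ℝ ∞ (iteratedFDeriv ℝ (i + 1) G) := contDiff_iteratedFDeriv hG _
    ext m
    rw [fderiv_continuousMultilinearMap_apply (hA1.differentiable (by simp) x),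
      iteratedFDeriv_succ_apply_left, ← funext fun y => ih y v]
    simp only [iteratedFDeriv_succ_apply_left]
    have hs : IsSymmSndFDerivAt ℝ (iteratedFDeriv ℝ i G) x :=
      hA.contDiffAt.isSymmSndFDerivAt (by
        rw [minSmoothness_of_isRCLikeNormedField]
        exact (WithTop.coe_le_coe.2 le_top : ((2 : ℕ∞) : WithTop ℕ∞) ≤ ∞))
    have hd : DifferentiableAt ℝ (fderiv ℝ (iteratedFDeriv ℝ i G)) x :=
      (hA.fderiv_right (m := ∞) (by simp)).differentiable (by simp) x
    have h1 : fderiv ℝ (fun y => fderiv ℝ (iteratedFDeriv ℝ i G) y v) x (m 0)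
        = fderiv ℝ (fderiv ℝ (iteratedFDeriv ℝ i G)) x (m 0) v := by
      rw [fderiv_clm_apply hd (by fun_prop)]
      simp
    have h2 : ContDiff ℝ ∞ fun y => fderiv ℝ (iteratedFDeriv ℝ i G) y (m 0) :=
      (hA.fderiv_right (m := ∞) (by simp)).clm_apply contDiff_const
    rw [h1, ← hs.eq, ← fderiv_continuousMultilinearMap_apply (h2.differentiable (by simp) x),
      fderiv_clm_apply hd (by fun_prop)]
    simp

theorem exists_bound_iteratedFDeriv {V : Type*} [NormedAddCommGroup V] [NormedSpace ℝ V]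
    {G : E → V} (hG : ContDiff ℝ ∞ G) {K : Set E} (hK : IsCompact K) (m : ℕ) :
    ∃ B : ℝ, 0 ≤ B ∧ ∀ i ≤ m, ∀ x ∈ K, ‖iteratedFDeriv ℝ i G x‖ ≤ B := by
  have h : ∀ i : ℕ, ∃ B : ℝ, ∀ x ∈ K, ‖iteratedFDeriv ℝ i G x‖ ≤ B := fun i =>
    hK.exists_bound_of_continuousOn
      (hG.continuous_iteratedFDeriv (by exact_mod_cast le_top)).continuousOn
  choose B hB using h
  refine ⟨∑ i ∈ Finset.range (m + 1), |B i|, Finset.sum_nonneg fun _ _ => abs_nonneg _,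
    fun i hi x hx => (hB i x hx).trans ((le_abs_self _).trans ?_)⟩
  exact Finset.single_le_sum (f := fun i => |B i|) (fun _ _ => abs_nonneg _)
    (Finset.mem_range.2 (by omega))

theorem exists_uniform_dist_le {X W : Type*} [PseudoMetricSpace X] [PseudoMetricSpace W]
    {g : X → W} (hg : Continuous g) {K : Set X} (hK : IsCompact K) {ε : ℝ} (hε : 0 < ε) :
    ∃ δ > 0, ∀ x ∈ K, ∀ y ∈ K, dist x y ≤ δ → dist (g x) (g y) ≤ ε :=
  Metric.uniformContinuousOn_iff_le.1 (hK.uniformContinuousOn_of_continuous hg.continuousOn) ε hε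

/-- The remainder of the first order Taylor expansion of the derivatives of `G` is small,
uniformly on compact sets. -/
theorem exists_taylor_remainder_le [FiniteDimensional ℝ E]
    {V : Type*} [NormedAddCommGroup V] [NormedSpace ℝ V]
    {G : E → V} (hG : ContDiff ℝ ∞ G) {K : Set E} (hK : IsCompact K) (m : ℕ) {ε : ℝ}
    (hε : 0 < ε) :
    ∃ δ > 0, ∀ v : E, ‖v‖ < δ → ∀ i ≤ m, ∀ x ∈ K,
      ‖iteratedFDeriv ℝ i (fun y => G (y + v) - G y - fderiv ℝ G y v) x‖ ≤ ε * ‖v‖ := by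
  have key : ∀ i : ℕ, ∃ δ > 0, ∀ v : E, ‖v‖ < δ → ∀ x ∈ K,
      ‖iteratedFDeriv ℝ i (fun y => G (y + v) - G y - fderiv ℝ G y v) x‖ ≤ ε * ‖v‖ := by
    intro i
    have hA : ContDiff ℝ ∞ (iteratedFDeriv ℝ i G) := contDiff_iteratedFDeriv hG _
    have hdA : Continuous (fderiv ℝ (iteratedFDeriv ℝ i G)) := hA.continuous_fderiv (by simp)
    -- The segment from x to x + v may leave K, so uniform continuity is used on the closed
    -- 1-neighbourhood of K, which is compact in finite dimension.
    obtain ⟨δ, hδ, h⟩ := exists_uniform_dist_le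
      (W := E →L[ℝ] ContinuousMultilinearMap ℝ (fun _ : Fin i => E) V) hdA (hK.cthickening (r := 1)) hε
    refine ⟨min δ 1, by positivity, fun v hv x hx => ?_⟩
    have hGi : ContDiff ℝ i G := hG.of_le (by exact_mod_cast le_top)
    -- Differentiation commutes with translations and with directional derivatives, so the i-th
    -- derivative of the remainder is itself a first order remainder.
    have e1 : iteratedFDeriv ℝ i (fun y => G (y + v) - G y - fderiv ℝ G y v) x =
        iteratedFDeriv ℝ i G (x + v) - iteratedFDeriv ℝ i G x
          - fderiv ℝ (iteratedFDeriv ℝ i G) x v := by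
      have c1 : ContDiff ℝ i (fun y => G (y + v)) := by fun_prop
      have c2 : ContDiff ℝ i (fun y => fderiv ℝ G y v) :=
        ((hG.fderiv_right (m := ∞) (by simp)).clm_apply contDiff_const).of_le
          (by exact_mod_cast le_top)
      have := iteratedFDeriv_sub_apply (i := i) (x := x)
        (c1.sub hGi).contDiffAt c2.contDiffAt
      rw [show (fun y => G (y + v) - G y - fderiv ℝ G y v)
        = (fun y => G (y + v) - G y) - fun y => fderiv ℝ G y v from rfl, this,
        fderiv_iteratedFDeriv_apply hG]
      rw [show (fun y => G (y + v) - G y) = (fun y => G (y + v)) - G from rfl,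
        iteratedFDeriv_sub_apply c1.contDiffAt hGi.contDiffAt, iteratedFDeriv_comp_add_right]
    rw [e1]
    have hx1 : x ∈ Metric.cthickening 1 K := Metric.self_subset_cthickening _ hx
    have hball : ∀ y ∈ Metric.closedBall x ‖v‖, y ∈ Metric.cthickening 1 K ∧ dist y x ≤ δ := by
      intro y hy
      have h2 : dist y x ≤ ‖v‖ := hy
      exact ⟨Metric.mem_cthickening_of_dist_le y x 1 K hx
        (h2.trans (hv.le.trans (min_le_right _ _))), h2.trans (hv.le.trans (min_le_left _ _))⟩
    -- Mean value inequality relative to the derivative at x, which differs by at most ε from the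
    -- derivative at any point of the ball.
    have := (convex_closedBall x ‖v‖).norm_image_sub_le_of_norm_fderiv_le' (𝕜 := ℝ)
      (f := iteratedFDeriv ℝ i G) (φ := fderiv ℝ (iteratedFDeriv ℝ i G) x) (C := ε)
      (x := x) (y := x + v)
      (fun y _ => (hA.differentiable (by simp)) y)
      (fun y hy => by
        rw [← dist_eq_norm]
        exact h y (hball y hy).1 x hx1 (hball y hy).2)
      (by simp) (by simp)
    simpa using this
  choose δ hδ h using key
  obtain ⟨n, hn, hmin⟩ := Finset.exists_min_image (Finset.range (m + 1)) δ ⟨0, by simp⟩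
  exact ⟨δ n, hδ n, fun v hv i hi x hx =>
    h i v (hv.trans_le (hmin i (Finset.mem_range.2 (by omega)))) x hx⟩

namespace IsDist

variable {u : (E → ℂ) → ℂ} {v : (F → ℂ) → ℂ}

theorem map_zero (hu : IsDist u) : u (fun _ => 0) = 0 := by
  simpa using hu.map_smul 0 (fun _ => 0) contDiff_const

theorem map_sub (hu : IsDist u) {f g : E → ℂ} (hf : ContDiff ℝ ∞ f) (hg : ContDiff ℝ ∞ g) :
    u (fun x => f x - g x) = u f - u g := by
  have h := hu.map_add f (fun x => (-1) * g x) hf (contDiff_const.mul hg)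
  rw [hu.map_smul (-1) g hg] at h
  simpa [sub_eq_add_neg] using h

theorem map_sum (hu : IsDist u) {ι : Type*} (s : Finset ι) (f : ι → E → ℂ)
    (hf : ∀ i ∈ s, ContDiff ℝ ∞ (f i)) : u (fun x => ∑ i ∈ s, f i x) = ∑ i ∈ s, u (f i) := by
  classical
  induction s using Finset.induction_on with
  | empty => simpa using hu.map_zero
  | insert a s ha ih =>
    simp only [Finset.sum_insert ha]
    rw [hu.map_add (f a) _ (hf a (by simp)) (ContDiff.sum fun i hi => hf i (by simp [hi])),
      ih fun i hi => hf i (by simp [hi])]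

protected theorem zero : IsDist (fun _ : E → ℂ => (0 : ℂ)) :=
  ⟨by simp, by simp, ∅, 0, 0, isCompact_empty, le_rfl, by simp⟩

protected theorem add {u' : (E → ℂ) → ℂ} (hu : IsDist u) (hu' : IsDist u') :
    IsDist (fun f => u f + u' f) := by
  obtain ⟨K, m, C, hK, hC, h⟩ := hu.bound
  obtain ⟨K', m', C', hK', hC', h'⟩ := hu'.bound
  refine ⟨fun f g hf hg => ?_, fun c f hf => ?_, K ∪ K', max m m', C + C', hK.union hK',
    by positivity, fun f M hf hM hb => ?_⟩
  · rw [hu.map_add f g hf hg, hu'.map_add f g hf hg]; ring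
  · rw [hu.map_smul c f hf, hu'.map_smul c f hf]; ring
  · have h1 := h f M hf hM fun i hi x hx => hb i (by omega) x (Or.inl hx)
    have h2 := h' f M hf hM fun i hi x hx => hb i (by omega) x (Or.inr hx)
    calc ‖u f + u' f‖ ≤ ‖u f‖ + ‖u' f‖ := norm_add_le _ _
      _ ≤ (C + C') * M := by linarith

protected theorem const_mul (hu : IsDist u) (c : ℂ) : IsDist (fun f => c * u f) := by
  obtain ⟨K, m, C, hK, hC, h⟩ := hu.bound
  refine ⟨fun f g hf hg => ?_, fun c f hf => ?_, K, m, ‖c‖ * C, hK, by positivity,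
    fun f M hf hM hb => ?_⟩
  · rw [hu.map_add f g hf hg]; ring
  · rw [hu.map_smul c f hf]; ring
  · rw [norm_mul, mul_assoc]
    exact mul_le_mul_of_nonneg_left (h f M hf hM hb) (norm_nonneg _)

protected theorem sum {ι : Type*} (s : Finset ι) {u : ι → (E → ℂ) → ℂ}
    (hu : ∀ i ∈ s, IsDist (u i)) : IsDist (fun f => ∑ i ∈ s, u i f) := by
  classical
  induction s using Finset.induction_on with
  | empty => simpa using IsDist.zero
  | insert a s ha ih =>
    simp only [Finset.sum_insert ha]
    exact (hu a (by simp)).add (ih fun i hi => hu i (by simp [hi]))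

/-- The push-forward of a distribution by a linear map, with a smooth weight. -/
theorem comp_weight (hu : IsDist u) {k : E → ℂ} (hk : ContDiff ℝ ∞ k) (A : E →L[ℝ] F) :
    IsDist (fun f : F → ℂ => u fun x => k x * f (A x)) := by
  obtain ⟨K, m, C, hK, hC, h⟩ := hu.bound
  obtain ⟨B, hB, hkB⟩ := exists_bound_iteratedFDeriv hk hK m
  have hs : ∀ f : F → ℂ, ContDiff ℝ ∞ f → ContDiff ℝ ∞ fun x => k x * f (A x) :=
    fun f hf => by fun_prop
  refine ⟨fun f g hf hg => ?_, fun c f hf => ?_, A '' K, m,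
    C * (2 ^ m * (B * (1 + ‖A‖) ^ m)), hK.image A.continuous, by positivity,
    fun f M hf hM hb => ?_⟩
  · rw [← hu.map_add _ _ (hs f hf) (hs g hg)]
    simp only [mul_add]
  · rw [← hu.map_smul _ _ (hs f hf)]
    congr 1; ext x; ring
  · rw [mul_assoc]
    refine h _ _ (hs f hf) (by positivity) fun i hi x hx => ?_
    refine (norm_iteratedFDeriv_mul_le (N := ∞) hk
      (by fun_prop : ContDiff ℝ ∞ fun x => f (A x)) x (n := i)
      (by exact_mod_cast le_top)).trans ?_
    have h1 : ∀ j ∈ Finset.range (i + 1), (i.choose j : ℝ) * ‖iteratedFDeriv ℝ j k x‖ *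
        ‖iteratedFDeriv ℝ (i - j) (fun x => f (A x)) x‖
          ≤ (i.choose j : ℝ) * (B * (1 + ‖A‖) ^ m * M) := by
      intro j hj
      have hj' : j ≤ i := by simpa [Nat.lt_succ_iff] using hj
      rw [mul_assoc]
      refine mul_le_mul_of_nonneg_left ?_ (by positivity)
      rw [mul_assoc]
      refine mul_le_mul (hkB j (by omega) x hx) ?_ (norm_nonneg _) hB
      refine (norm_iteratedFDeriv_comp_clm_le hf A _ x).trans ?_
      rw [mul_comm]
      refine mul_le_mul ?_ (hb _ (by omega) _ ⟨x, hx, rfl⟩) (norm_nonneg _) (by positivity)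
      calc ‖A‖ ^ (i - j) ≤ (1 + ‖A‖) ^ (i - j) := by gcongr; linarith
        _ ≤ (1 + ‖A‖) ^ m := pow_le_pow_right₀ (by linarith [norm_nonneg A]) (by omega)
    refine (Finset.sum_le_sum h1).trans ?_
    rw [← Finset.sum_mul]
    have h2 : (∑ j ∈ Finset.range (i + 1), (i.choose j : ℝ)) = 2 ^ i := by
      exact_mod_cast Nat.sum_range_choose i
    rw [h2]
    have h3 : (2 : ℝ) ^ i ≤ 2 ^ m := pow_le_pow_right₀ (by norm_num) hi
    calc (2 : ℝ) ^ i * (B * (1 + ‖A‖) ^ m * M) ≤ 2 ^ m * (B * (1 + ‖A‖) ^ m * M) := by gcongr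
      _ = _ := by ring

variable [FiniteDimensional ℝ E] [FiniteDimensional ℝ F]

/-- Differentiation under the pairing: the seminorm bound of v turns the uniform Taylor remainder of
G near {x} × K into an error o(‖h‖). -/
theorem hasFDerivAt_slice (hv : IsDist v) {G : E × F → ℂ} (hG : ContDiff ℝ ∞ G) (x : E) :
    ∃ L : E →L[ℝ] ℂ, HasFDerivAt (fun x => v fun y => G (x, y)) L x ∧
      ∀ h, L h = v fun y => fderiv ℝ G (x, y) (h, 0) := by
  have hG' : ContDiff ℝ ∞ (fderiv ℝ G) := hG.fderiv_right (by simp)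
  have hs : ∀ h : E, ContDiff ℝ ∞ fun y => fderiv ℝ G (x, y) (h, 0) := fun h => by fun_prop
  let L : E →ₗ[ℝ] ℂ :=
    { toFun := fun h => v fun y => fderiv ℝ G (x, y) (h, 0)
      map_add' := fun h k => by
        rw [← hv.map_add _ _ (hs h) (hs k)]
        congr 1; ext y
        rw [← (fderiv ℝ G (x, y)).map_add]; simp
      map_smul' := fun c h => by
        have := hv.map_smul (c : ℂ) _ (hs h)
        simp only [RingHom.id_apply, Complex.real_smul]
        rw [← this]
        congr 1; ext y
        rw [← Complex.real_smul, ← (fderiv ℝ G (x, y)).map_smul]; simp }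
  refine ⟨LinearMap.toContinuousLinearMap L, ?_, fun h => rfl⟩
  obtain ⟨K, m, C, hK, hC, hb⟩ := hv.bound
  rw [hasFDerivAt_iff_isLittleO_nhds_zero, Asymptotics.isLittleO_iff]
  intro ε hε
  -- Division by C + 1 instead of C, since C may be zero.
  obtain ⟨δ, hδ, hr⟩ := exists_taylor_remainder_le hG ((isCompact_singleton (x := x)).prod hK) m
    (ε := ε / (C + 1)) (by positivity)
  filter_upwards [Metric.ball_mem_nhds (0 : E) hδ] with h hh
  have hh' : ‖((h, 0) : E × F)‖ < δ := by simpa using hh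
  have e : (v fun y => G (x + h, y)) - (v fun y => G (x, y)) - L h =
      v fun y => G ((x, y) + (h, 0)) - G (x, y) - fderiv ℝ G (x, y) (h, 0) := by
    have c1 : ContDiff ℝ ∞ fun y => G (x + h, y) := by fun_prop
    have c2 : ContDiff ℝ ∞ fun y => G (x, y) := by fun_prop
    rw [show L h = v fun y => fderiv ℝ G (x, y) (h, 0) from rfl, ← hv.map_sub c1 c2,
      ← hv.map_sub (c1.sub c2) (hs h)]
    simp
  rw [LinearMap.coe_toContinuousLinearMap', e]
  have c : ContDiff ℝ ∞ fun z : E × F => G (z + (h, 0)) - G z - fderiv ℝ G z (h, 0) := by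
    fun_prop
  have := hb (fun y => G ((x, y) + (h, 0)) - G (x, y) - fderiv ℝ G (x, y) (h, 0))
    (ε / (C + 1) * ‖((h, 0) : E × F)‖) (by fun_prop) (by positivity) fun i hi y hy =>
      (norm_iteratedFDeriv_slice_le c i x y).trans (hr _ hh' i hi _ ⟨rfl, hy⟩)
  refine this.trans ?_
  have hn : ‖((h, 0) : E × F)‖ = ‖h‖ := by simp
  rw [hn]
  calc C * (ε / (C + 1) * ‖h‖) = (C / (C + 1)) * (ε * ‖h‖) := by ring
    _ ≤ 1 * (ε * ‖h‖) := by
        gcongr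
        rw [div_le_one (by positivity)]; linarith
    _ = _ := one_mul _

/-- Each directional derivative of a slice is the slice of another smooth function, so the induction
on the order is over all G. -/
theorem contDiff_slice (hv : IsDist v) {G : E × F → ℂ} (hG : ContDiff ℝ ∞ G) :
    ContDiff ℝ ∞ fun x => v fun y => G (x, y) := by
  rw [contDiff_infty]
  intro n
  induction n generalizing G with
  | zero =>
    refine contDiff_zero.2 (continuous_iff_continuousAt.2 fun x => ?_)
    obtain ⟨L, hL, -⟩ := hv.hasFDerivAt_slice hG x
    exact hL.continuousAt
  | succ n ih =>
    push_cast
    rw [contDiff_succ_iff_fderiv_apply]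
    refine ⟨fun x => ?_, by simp, fun h => ?_⟩
    · obtain ⟨L, hL, -⟩ := hv.hasFDerivAt_slice hG x
      exact hL.differentiableAt
    · have : (fun x => fderiv ℝ (fun x => v fun y => G (x, y)) x h)
          = fun x => v fun y => fderiv ℝ G (x, y) (h, 0) := by
        ext x
        obtain ⟨L, hL, hL'⟩ := hv.hasFDerivAt_slice hG x
        rw [hL.fderiv, hL']
      rw [this]
      have hG' : ContDiff ℝ ∞ (fderiv ℝ G) := hG.fderiv_right (by simp)
      exact ih (G := fun z => fderiv ℝ G z (h, 0)) (by fun_prop)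

theorem iteratedFDeriv_slice_apply (hv : IsDist v) {G : E × F → ℂ} (hG : ContDiff ℝ ∞ G)
    (j : ℕ) (x : E) (h : Fin j → E) :
    iteratedFDeriv ℝ j (fun x => v fun y => G (x, y)) x h =
      v fun y => iteratedFDeriv ℝ j G (x, y) fun i => (h i, 0) := by
  induction j generalizing x with
  | zero => simp
  | succ j ih =>
    have hA : ContDiff ℝ ∞ (iteratedFDeriv ℝ j G) := contDiff_iteratedFDeriv hG _
    have hS : ContDiff ℝ ∞ (fun x => v fun y => G (x, y)) := hv.contDiff_slice hG
    have hAS : ContDiff ℝ ∞ (iteratedFDeriv ℝ j fun x => v fun y => G (x, y)) :=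
      contDiff_iteratedFDeriv hS _
    let w : Fin j → E × F := fun i => (Fin.tail h i, 0)
    rw [iteratedFDeriv_succ_apply_left,
      fderiv_continuousMultilinearMap_apply (hAS.differentiable (by simp) x)]
    simp only [ih]
    have hAw : ContDiff ℝ ∞ fun z => iteratedFDeriv ℝ j G z w :=
      (ContinuousMultilinearMap.apply ℝ (fun _ : Fin j => E × F) ℂ w).contDiff.comp hA
    obtain ⟨L, hL, hL'⟩ := hv.hasFDerivAt_slice hAw x
    change fderiv ℝ (fun x => v fun y => iteratedFDeriv ℝ j G (x, y) w) x (h 0) = _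
    rw [hL.fderiv, hL']
    congr 1; ext y
    rw [iteratedFDeriv_succ_apply_left,
      ← fderiv_continuousMultilinearMap_apply (hA.differentiable (by simp) _)]
    rfl

/-- The tensor product of two compactly supported distributions. -/
theorem prod (hu : IsDist u) (hv : IsDist v) :
    IsDist (fun f : E × F → ℂ => u fun x => v fun y => f (x, y)) := by
  obtain ⟨K, m, C, hK, hC, hb⟩ := hu.bound
  obtain ⟨K', m', C', hK', hC', hb'⟩ := hv.bound
  -- The outer distribution needs up to m derivatives in x of the inner pairing, and bounding each
  -- of them costs up to m' further derivatives in y; the orders add.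
  refine ⟨fun f g hf hg => ?_, fun c f hf => ?_, K ×ˢ K', m' + m, C * C', hK.prod hK',
    by positivity, fun f M hf hM hbd => ?_⟩
  · rw [← hu.map_add _ _ (hv.contDiff_slice hf) (hv.contDiff_slice hg)]
    congr 1; ext x
    exact hv.map_add (fun y => f (x, y)) (fun y => g (x, y)) (by fun_prop) (by fun_prop)
  · rw [← hu.map_smul _ _ (hv.contDiff_slice hf)]
    congr 1; ext x
    exact hv.map_smul c (fun y => f (x, y)) (by fun_prop)
  · rw [mul_assoc]
    refine hb _ _ (hv.contDiff_slice hf) (by positivity) fun j hj x hx => ?_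
    refine ContinuousMultilinearMap.opNorm_le_bound (by positivity) fun h => ?_
    rw [hv.iteratedFDeriv_slice_apply hf, mul_assoc]
    have hA : ContDiff ℝ ∞ (iteratedFDeriv ℝ j f) := contDiff_iteratedFDeriv hf _
    let w : Fin j → E × F := fun i => (h i, 0)
    let ap := ContinuousMultilinearMap.apply ℝ (fun _ : Fin j => E × F) ℂ w
    have hAw : ContDiff ℝ ∞ (ap ∘ iteratedFDeriv ℝ j f) := ap.contDiff.comp hA
    have hap : ‖ap‖ ≤ ∏ i, ‖h i‖ := by
      refine ContinuousLinearMap.opNorm_le_bound _ (by positivity) fun T => ?_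
      rw [mul_comm]
      refine (T.le_opNorm w).trans (le_of_eq ?_)
      simp [w]
    refine hb' (fun y => (ap ∘ iteratedFDeriv ℝ j f) (x, y)) _ (by fun_prop) (by positivity)
      fun i hi y hy => ?_
    refine (norm_iteratedFDeriv_slice_le hAw i x y).trans ?_
    refine (ap.norm_iteratedFDeriv_comp_left (N := ∞) hA.contDiffAt
      (by exact_mod_cast le_top)).trans ?_
    rw [norm_iteratedFDeriv_iteratedFDeriv, mul_comm]
    exact mul_le_mul (hbd _ (by omega) _ ⟨hx, hy⟩) hap (norm_nonneg _) hM

end IsDist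

end Distributions

end FlowEquation
namespace FlowEquation

/-! ### Plane waves determine a compactly supported distribution. -/

section Density

open MeasureTheory Complex FourierTransform VectorFourier

/-- The quotient map by the closure is continuous and linear and kills the integrand, hence the
integral. -/
theorem integral_mem_topologicalClosure {X B : Type*} [MeasurableSpace X] {μ : Measure X}
    [NormedAddCommGroup B] [NormedSpace ℝ B] [CompleteSpace B] (S : Submodule ℝ B) {Φ : X → B}
    (hΦ : Integrable Φ μ) (hS : ∀ x, Φ x ∈ S) : ∫ x, Φ x ∂μ ∈ S.topologicalClosure := by
  have : IsClosed (S.topologicalClosure : Set B) := S.isClosed_topologicalClosure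
  have h : S.topologicalClosure.mkQL (∫ x, Φ x ∂μ) = 0 := by
    rw [← ContinuousLinearMap.integral_comp_comm _ hΦ]
    have : ∀ x, S.topologicalClosure.mkQL (Φ x) = 0 := fun x => by
      rw [Submodule.mkQL_apply, Submodule.mkQ_apply, Submodule.Quotient.mk_eq_zero]
      exact S.le_topologicalClosure (hS x)
    simp [this]
  rwa [Submodule.mkQL_apply, Submodule.mkQ_apply, Submodule.Quotient.mk_eq_zero] at h

variable {V : Type*} [NormedAddCommGroup V] [InnerProductSpace ℝ V] 

/-- A single plane wave is the Fourier integral with respect to the Dirac measure at ξ, so the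
general formula for derivatives of Fourier integrals applies. -/
theorem iteratedFDeriv_fourierChar_smul [FiniteDimensional ℝ V]
    [MeasurableSpace V] [BorelSpace V] (g : 𝓢(V, ℂ)) (ξ : V) (i : ℕ) (x : V) :
    iteratedFDeriv ℝ i (fun x => Real.fourierChar (-inner ℝ ξ x) • g ξ) x =
      Real.fourierChar (-inner ℝ ξ x) • fourierPowSMulRight (innerSL ℝ) g ξ i := by
  have h := iteratedFDeriv_fourierIntegral (innerSL ℝ (E := V)) (μ := Measure.dirac ξ) (f := g)
    (N := ⊤) (n := i) (fun n _ => integrable_dirac enorm_lt_top) g.continuous.aestronglyMeasurable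
    le_top
  have h2 := congrFun h x
  have e1 : (fourierIntegral Real.fourierChar (Measure.dirac ξ) (innerSL ℝ (E := V)).toLinearMap₁₂ g)
      = fun x => Real.fourierChar (-inner ℝ ξ x) • g ξ := by
    ext y
    simp [fourierIntegral]
  rw [e1] at h2
  rw [h2]
  simp [fourierIntegral]
  rfl

theorem contDiff_fourierChar_smul (c : ℂ) (ξ : V) :
    ContDiff ℝ ∞ fun x : V => Real.fourierChar (-inner ℝ ξ x) • c := by
  simp only [Circle.smul_def, Real.fourierChar_apply, smul_eq_mul]
  have h : ContDiff ℝ ∞ fun x : V => ((2 * Real.pi * -inner ℝ ξ x : ℝ) : ℂ) :=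
    ofRealCLM.contDiff.comp (contDiff_const.mul (contDiff_const.inner ℝ contDiff_id).neg)
  exact (h.mul contDiff_const).cexp.mul contDiff_const

/-- The space of jets of order `m` at a point. -/
def JetFiber (V : Type*) [NormedAddCommGroup V] [NormedSpace ℝ V] (m : ℕ) :=
  (i : Fin (m + 1)) → ContinuousMultilinearMap ℝ (fun _ : Fin i => V) ℂ

noncomputable instance (V : Type*) [NormedAddCommGroup V] [NormedSpace ℝ V] (m : ℕ) :
    NormedAddCommGroup (JetFiber V m) :=
  inferInstanceAs (NormedAddCommGroup
    ((i : Fin (m + 1)) → ContinuousMultilinearMap ℝ (fun _ : Fin i => V) ℂ))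

noncomputable instance (V : Type*) [NormedAddCommGroup V] [NormedSpace ℝ V] (m : ℕ) :
    NormedSpace ℝ (JetFiber V m) :=
  inferInstanceAs (NormedSpace ℝ
    ((i : Fin (m + 1)) → ContinuousMultilinearMap ℝ (fun _ : Fin i => V) ℂ))

noncomputable instance (V : Type*) [NormedAddCommGroup V] [NormedSpace ℝ V] (m : ℕ) :
    CompleteSpace (JetFiber V m) :=
  inferInstanceAs (CompleteSpace
    ((i : Fin (m + 1)) → ContinuousMultilinearMap ℝ (fun _ : Fin i => V) ℂ))

/-- A compactly supported distribution that vanishes on all plane waves vanishes. -/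
theorem IsDist.eq_zero_of_planeWave [FiniteDimensional ℝ V] {u : (V → ℂ) → ℂ} (hu : IsDist u)
    (h : ∀ ξ, u (fun x : V => cexp ((-2 * Real.pi * inner ℝ ξ x : ℝ) * I)) = 0)
    {f : V → ℂ} (hf : ContDiff ℝ ∞ f) : u f = 0 := by
  borelize V
  obtain ⟨K, m, C, hK, hC, hb⟩ := hu.bound
  have : CompactSpace K := isCompact_iff_compactSpace.1 hK
  -- cut-off
  obtain ⟨R, hR⟩ := hK.isBounded.subset_closedBall (0 : V)
  let χ : ContDiffBump (0 : V) := ⟨|R| + 1, |R| + 2, by positivity, by linarith⟩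
  have hχ1 : ∀ x ∈ K, (fun y => ((χ y : ℝ) : ℂ) * f y) =ᶠ[𝓝 x] f := fun x hx => by
    have hx' : x ∈ Metric.ball (0 : V) (|R| + 1) := by
      have h1 := hR hx
      rw [Metric.mem_closedBall] at h1
      rw [Metric.mem_ball]
      have := le_abs_self R
      linarith
    filter_upwards [Metric.isOpen_ball.mem_nhds hx'] with y hy
    rw [χ.one_of_mem_closedBall (Metric.ball_subset_closedBall hy)]
    simp
  have hcs : HasCompactSupport fun y => ((χ y : ℝ) : ℂ) * f y :=
    (χ.hasCompactSupport.comp_left (g := fun r : ℝ => (r : ℂ)) (by simp)).mul_right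
  have hsm : ContDiff ℝ ∞ fun y => ((χ y : ℝ) : ℂ) * f y := by
    have := χ.contDiff (n := ⊤)
    have h2 : ContDiff ℝ ∞ fun y => ((χ y : ℝ) : ℂ) := ofRealCLM.contDiff.comp this
    exact h2.mul hf
  -- The cut-off equals 1 near K, so all derivatives of the difference vanish on K and the bound of
  -- u annihilates it.
  have huf : u f = u fun y => ((χ y : ℝ) : ℂ) * f y := by
    rw [← sub_eq_zero, ← hu.map_sub hf hsm, ← norm_le_zero_iff]
    refine (hb _ 0 (hf.sub hsm) le_rfl fun i _ x hx => ?_).trans (by simp)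
    have : (fun y => f y - ((χ y : ℝ) : ℂ) * f y) =ᶠ[𝓝 x] fun _ => 0 := by
      filter_upwards [hχ1 x hx] with y hy
      rw [hy, sub_self]
    rw [(this.iteratedFDeriv ℝ i).self_of_nhds]
    simp
  rw [huf]
  -- With compact support the function is the Fourier transform of a Schwartz function g, that is, a
  -- superposition of plane waves with weights g(ξ).
  let g0 : 𝓢(V, ℂ) := hcs.toSchwartzMap hsm
  let g : 𝓢(V, ℂ) := 𝓕⁻ g0
  have hg0 : (g0 : V → ℂ) = fun y => ((χ y : ℝ) : ℂ) * f y := rfl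
  have hfg : (𝓕 (g : V → ℂ)) = g0 := by
    rw [← SchwartzMap.fourier_coe]
    congr 1
    exact FourierTransform.fourier_fourierInv_eq g0
  rw [← hg0]
  -- the Banach space of jets on `K`
  let jet : (h : V → ℂ) → ContDiff ℝ ∞ h → C(K, JetFiber V m) := fun h hh =>
    ⟨fun x i => iteratedFDeriv ℝ i h x, continuous_pi fun i =>
      (contDiff_iteratedFDeriv hh i).continuous.comp continuous_subtype_val⟩
  -- Jets on K of functions annihilated by u. By the bound of u, a smooth function whose jet lies in
  -- the closure of this space is annihilated as well.
  let S : Submodule ℝ (C(K, JetFiber V m)) :=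
    { carrier := {b | ∃ h, ∃ hh : ContDiff ℝ ∞ h, u h = 0 ∧ b = jet h hh}
      add_mem' := by
        rintro _ _ ⟨h, hh, h0, rfl⟩ ⟨k, hk, k0, rfl⟩
        refine ⟨fun x => h x + k x, hh.add hk, by rw [hu.map_add _ _ hh hk, h0, k0, add_zero], ?_⟩
        ext1 x; funext i
        exact (iteratedFDeriv_add_apply (hh.of_le (by exact_mod_cast le_top)).contDiffAt
          (hk.of_le (by exact_mod_cast le_top)).contDiffAt).symm
      zero_mem' := by
        refine ⟨fun _ => 0, contDiff_const, hu.map_zero, ?_⟩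
        ext1 x; funext i
        change 0 = iteratedFDeriv ℝ i (fun _ : V => (0 : ℂ)) x
        simp
      smul_mem' := by
        rintro c _ ⟨h, hh, h0, rfl⟩
        refine ⟨fun x => (c : ℂ) * h x, contDiff_const.mul hh,
          by rw [hu.map_smul _ _ hh, h0, mul_zero], ?_⟩
        ext1 x; funext i
        have := iteratedFDeriv_const_smul_apply (𝕜 := ℝ) (a := c) (i := i) (x := (x : V))
          (hh.of_le (by exact_mod_cast le_top)).contDiffAt
        exact this.symm }
  let Φ : V → C(K, JetFiber V m) := fun ξ => jet _ (contDiff_fourierChar_smul (g ξ) ξ)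
  have hΦS : ∀ ξ, Φ ξ ∈ S := fun ξ => by
    refine ⟨_, contDiff_fourierChar_smul (g ξ) ξ, ?_, rfl⟩
    have e : (fun x : V => Real.fourierChar (-inner ℝ ξ x) • g ξ) =
        fun x => g ξ * cexp ((-2 * Real.pi * inner ℝ ξ x : ℝ) * I) := by
      ext x
      rw [Circle.smul_def, Real.fourierChar_apply, smul_eq_mul, mul_comm]
      push_cast
      ring_nf
    have hs : ContDiff ℝ ∞ fun x : V => ((-2 * Real.pi * inner ℝ ξ x : ℝ) : ℂ) :=
      ofRealCLM.contDiff.comp (contDiff_const.mul (contDiff_const.inner ℝ contDiff_id))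
    rw [e, hu.map_smul _ _ (hs.mul contDiff_const).cexp, h, mul_zero]
  have hΦapp : ∀ ξ (x : K) (i : Fin (m + 1)), Φ ξ x i =
      Real.fourierChar (-inner ℝ ξ (x : V)) • fourierPowSMulRight (innerSL ℝ) g ξ i :=
    fun ξ x i => iteratedFDeriv_fourierChar_smul g ξ i x
  have hP : ∀ i : ℕ, Continuous fun ξ => fourierPowSMulRight (innerSL ℝ (E := V)) g ξ i :=
    fun i => g.continuous.fourierPowSMulRight _ i
  have hΦc : Continuous Φ := by
    refine ContinuousMap.continuous_of_continuous_uncurry _ (continuous_pi fun i => ?_)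
    change Continuous fun p : V × K => Φ p.1 p.2 i
    simp only [hΦapp, Circle.smul_def, Real.fourierChar_apply]
    have := (hP i).comp (continuous_fst (X := V) (Y := K))
    have h2 : Continuous fun p : V × K => cexp ((2 * Real.pi * -inner ℝ p.1 (p.2 : V) : ℝ) * I) := by
      fun_prop
    exact h2.smul this
  have hΦi : Integrable Φ := by
    -- Each derivative of a plane wave costs a factor of order ‖ξ‖, which the decay of g absorbs;
    -- this makes the superposition a Bochner integral in the space of jets.
    have hint : Integrable (fun ξ : V => ∑ j ∈ Finset.range (m + 1),
        (2 * Real.pi * ‖innerSL ℝ (E := V)‖) ^ j * (‖ξ‖ ^ j * ‖g ξ‖)) :=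
      integrable_finsetSum _ fun j _ => (g.integrable_pow_mul volume j).const_mul _
    refine hint.mono' hΦc.aestronglyMeasurable (Filter.Eventually.of_forall fun ξ => ?_)
    have h0 : ∀ j ∈ Finset.range (m + 1),
        0 ≤ (2 * Real.pi * ‖innerSL ℝ (E := V)‖) ^ j * (‖ξ‖ ^ j * ‖g ξ‖) :=
      fun j _ => by positivity
    rw [ContinuousMap.norm_le _ (Finset.sum_nonneg h0)]
    intro x
    refine (pi_norm_le_iff_of_nonneg (Finset.sum_nonneg h0)).2 ?_
    intro i
    have e : ‖Real.fourierChar (-inner ℝ ξ (x : V)) • fourierPowSMulRight (innerSL ℝ) g ξ i‖ =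
      ‖fourierPowSMulRight (innerSL ℝ (E := V)) g ξ i‖ := by
        rw [Circle.smul_def, norm_smul, Circle.norm_coe, one_mul]
    refine ((congrArg (fun T : ContinuousMultilinearMap ℝ (fun _ : Fin i => V) ℂ => ‖T‖)
      (hΦapp ξ x i)).trans e).le.trans ?_
    refine (norm_fourierPowSMulRight_le _ _ _ _).trans ?_
    rw [mul_assoc]
    exact Finset.single_le_sum (f := fun j => (2 * Real.pi * ‖innerSL ℝ (E := V)‖) ^ j *
      (‖ξ‖ ^ j * ‖g ξ‖)) h0 (Finset.mem_range.2 i.2)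
  have hg0s : ContDiff ℝ ∞ g0 := g0.smooth ⊤
  have hjet : jet g0 hg0s = ∫ ξ, Φ ξ := by
    ext1 x; funext i
    let ev : C(K, JetFiber V m) →L[ℝ] ContinuousMultilinearMap ℝ (fun _ : Fin i => V) ℂ := 
      (ContinuousLinearMap.proj (R := ℝ) (φ := fun i : Fin (m + 1) =>
        ContinuousMultilinearMap ℝ (fun _ : Fin i => V) ℂ) i).comp
        (ContinuousMap.evalCLM (M := JetFiber V m) ℝ x)
    change _ = ev (∫ ξ, Φ ξ)
    rw [← ContinuousLinearMap.integral_comp_comm _ hΦi]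
    change iteratedFDeriv ℝ i g0 x = ∫ ξ, Φ ξ x i
    rw [← hfg, Real.iteratedFDeriv_fourier (N := ⊤) (fun n _ => g.integrable_pow_mul volume n)
      g.continuous.aestronglyMeasurable le_top, Real.fourier_eq]
    simp only [hΦapp]
  have hmem : jet g0 hg0s ∈ S.topologicalClosure := by
    rw [hjet]
    exact integral_mem_topologicalClosure S hΦi hΦS
  rw [← norm_le_zero_iff]
  refine le_of_forall_pos_le_add fun ε hε => ?_
  -- A function k with u k = 0 whose jet is close to that of `g0`: then u g0 = u (g0 - k) is small.
  obtain ⟨_, ⟨k, hk, k0, rfl⟩, hd⟩ := Metric.mem_closure_iff.1 hmem (ε / (C + 1)) (by positivity)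
  have h1 : u g0 = u fun x => g0 x - k x := by rw [hu.map_sub hg0s hk, k0, sub_zero]
  rw [h1, zero_add]
  have hle := hb (fun x => g0 x - k x) (ε / (C + 1)) (hg0s.sub hk) (by positivity) fun i hi x hx => by
    have e : iteratedFDeriv ℝ i (fun x => g0 x - k x) x =
        iteratedFDeriv ℝ i g0 x - iteratedFDeriv ℝ i k x :=
      iteratedFDeriv_sub_apply (hg0s.of_le (by exact_mod_cast le_top)).contDiffAt
        (hk.of_le (by exact_mod_cast le_top)).contDiffAt
    rw [e]
    rw [dist_eq_norm] at hd
    have h3 := ((ContinuousMap.norm_coe_le_norm (jet g0 hg0s - jet k hk) ⟨x, hx⟩).trans hd.le)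
    exact (norm_le_pi_norm _ (⟨i, by omega⟩ : Fin (m + 1))).trans h3
  refine hle.trans ?_
  calc C * (ε / (C + 1)) = (C / (C + 1)) * ε := by ring
    _ ≤ 1 * ε := by
        gcongr
        rw [div_le_one (by positivity)]; linarith
    _ = ε := one_mul _

end Density

/-! ### Products of real functions of one point determine a distribution. -/

section Tensor

variable {d n : ℕ}

theorem contDiff_config (h : Config d) : ContDiff ℝ ∞ (h : Spc d → ℝ) := h.2

theorem contDiff_config_complex (h : Config d) :
    ContDiff ℝ ∞ fun x => (((h : Spc d → ℝ) x : ℝ) : ℂ) :=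
  Complex.ofRealCLM.contDiff.comp (contDiff_config h)

theorem contDiff_tensor (h : Fin n → Config d) : ContDiff ℝ ∞ (tensor h) := by
  unfold tensor
  refine contDiff_prod fun i _ => ?_
  exact (contDiff_config_complex (h i)).comp (contDiff_apply ℝ (Spc d) i)

open Complex in
/-- A compactly supported distribution on `(ℝ^d)^n` is determined by its values on products of
real functions of one variable. -/
theorem IsDist.eq_zero_of_tensor {u : ((Fin n → Spc d) → ℂ) → ℂ} (hu : IsDist u)
    (h : ∀ h : Fin n → Config d, u (tensor h) = 0) {f : (Fin n → Spc d) → ℂ}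
    (hf : ContDiff ℝ ∞ f) : u f = 0 := by
  -- The norm of `Fin n → Spc d` is not Euclidean, while plane waves need an inner product; the
  -- distribution is pushed forward to a Euclidean space.
  let e := toEuclidean (E := Fin n → Spc d)
  have hv : IsDist (fun g => u fun x => 1 * g (e x)) :=
    hu.comp_weight (contDiff_const (c := (1 : ℂ))) e.toContinuousLinearMap
  have key := hv.eq_zero_of_planeWave (f := fun y => f (e.symm y)) (fun ξ => ?_) (by fun_prop)
  · simpa using key
  let ℓ : Fin n → Spc d →L[ℝ] ℝ := fun j => (-2 * Real.pi) • ((innerSL ℝ ξ).comp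
    ((e : (Fin n → Spc d) →L[ℝ] _).comp (ContinuousLinearMap.single ℝ (fun _ => Spc d) j)))
  have hℓ : ∀ x : Fin n → Spc d, -2 * Real.pi * inner ℝ ξ (e x) = ∑ j, ℓ j (x j) := fun x => by
    have hx : x = ∑ j, Pi.single j (x j) := (Finset.univ_sum_single x).symm
    conv_lhs => rw [hx, _root_.map_sum, inner_sum, Finset.mul_sum]
    rfl
  let cs : Fin n → Config d := fun j => ⟨fun x => Real.cos (ℓ j x), by
    have : ContDiff ℝ ∞ fun x => Real.cos (ℓ j x) := by fun_prop
    exact this⟩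
  let sn : Fin n → Config d := fun j => ⟨fun x => Real.sin (ℓ j x), by
    have : ContDiff ℝ ∞ fun x => Real.sin (ℓ j x) := by fun_prop
    exact this⟩
  -- The phase is a sum of functions of one point. The wave is a product of factors cos + i sin and
  -- expands into tensor products of real configurations.
  have hw : (fun x : Fin n → Spc d => 1 * cexp ((-2 * Real.pi * inner ℝ ξ (e x) : ℝ) * I)) =
      fun x => ∑ s ∈ (Finset.univ : Finset (Fin n)).powerset,
        I ^ (Finset.univ \ s).card * tensor (fun j => if j ∈ s then cs j else sn j) x := by
    ext x
    rw [one_mul, hℓ]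
    push_cast
    rw [Finset.sum_mul, Complex.exp_sum]
    simp only [Complex.exp_mul_I]
    rw [Finset.prod_add]
    refine Finset.sum_congr rfl fun s _ => ?_
    have ht : tensor (fun j => if j ∈ s then cs j else sn j) x =
        (∏ j ∈ s, Complex.cos (ℓ j (x j))) * ∏ j ∈ Finset.univ \ s, Complex.sin (ℓ j (x j)) := by
      unfold tensor
      rw [← Finset.prod_sdiff (Finset.subset_univ s), mul_comm]
      congr 1
      · refine Finset.prod_congr rfl fun j hj => ?_
        simp [hj, cs]
      · refine Finset.prod_congr rfl fun j hj => ?_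
        have : j ∉ s := (Finset.mem_sdiff.1 hj).2
        simp [this, sn]
    rw [ht, Finset.prod_mul_distrib, Finset.prod_const]
    ring
  change u (fun x : Fin n → Spc d => 1 * cexp ((-2 * Real.pi * inner ℝ ξ (e x) : ℝ) * I)) = 0
  rw [hw]
  refine (hu.map_sum _ _ fun s _ => contDiff_const.mul (contDiff_tensor _)).trans ?_
  refine Finset.sum_eq_zero fun s _ => ?_
  rw [hu.map_smul _ _ (contDiff_tensor _), h, mul_zero]

/-- Reduces identities between functional derivatives to identities between iterated directional
derivatives. -/
theorem IsDist.ext_tensor {u v : ((Fin n → Spc d) → ℂ) → ℂ} (hu : IsDist u) (hv : IsDist v)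
    (h : ∀ h : Fin n → Config d, u (tensor h) = v (tensor h)) {f : (Fin n → Spc d) → ℂ}
    (hf : ContDiff ℝ ∞ f) : u f = v f := by
  have := (hu.add (hv.const_mul (-1))).eq_zero_of_tensor (fun k => by rw [h]; ring) hf
  linear_combination this

theorem CDist.isDist_pair (u : CDist d n) : IsDist u.pair := by
  have hp : ∀ f (hf : ContDiff ℝ ∞ f), u.pair f = u.toLin ⟨f, hf⟩ := fun f hf => by
    have : f ∈ SmoothFn d n := hf
    simp [CDist.pair, this]
  obtain ⟨K, m, C, hK, hb⟩ := u.bound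
  refine ⟨fun f g hf hg => ?_, fun c f hf => ?_, K, m, |C|, hK, abs_nonneg _,
    fun f M hf hM h => ?_⟩
  · rw [hp f hf, hp g hg, hp _ (hf.add hg), ← map_add]
    rfl
  · rw [hp f hf, hp _ (contDiff_const.mul hf), ← smul_eq_mul, ← map_smul]
    rfl
  · rw [hp f hf]
    exact (hb ⟨f, hf⟩ M h).trans (mul_le_mul_of_nonneg_right (le_abs_self C) hM)

theorem IsDist.exists_cDist {u : ((Fin n → Spc d) → ℂ) → ℂ} (hu : IsDist u) :
    ∃ w : CDist d n, ∀ f, ContDiff ℝ ∞ f → w.pair f = u f := by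
  obtain ⟨K, m, C, hK, hC, hb⟩ := hu.bound
  let w : CDist d n :=
    { toLin :=
        { toFun := fun f => u f
          map_add' := fun f g => hu.map_add _ _ f.2 g.2
          map_smul' := fun c f => hu.map_smul c _ f.2 }
      bound := by
        -- The bound in `CDist` does not assume M ≥ 0. A point added to the compact set forces it,
        -- even if K is empty.
        refine ⟨insert 0 K, m, C, hK.insert 0, fun f M h => hb _ M f.2 ?_ fun i hi x hx =>
          h i hi x (Set.mem_insert_of_mem _ hx)⟩
        exact (norm_nonneg _).trans (h 0 (Nat.zero_le _) 0 (Set.mem_insert _ _)) }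
  refine ⟨w, fun f hf => ?_⟩
  have : f ∈ SmoothFn d n := hf
  simp [CDist.pair, this, w]

end Tensor

end FlowEquation
namespace FlowEquation

/-! ### Families of distributions depending polynomially on the field. -/

section Families

variable {d : ℕ}

/-- The function `(z, x) ↦ h(z) f(x)`. -/
def headTensor {E : Type*} (h : Config d) (f : E → ℂ) : Spc d × E → ℂ :=
  fun z => (((h : Spc d → ℝ) z.1 : ℝ) : ℂ) * f z.2

theorem contDiff_headTensor {E : Type*} [NormedAddCommGroup E] [NormedSpace ℝ E] (h : Config d)
    {f : E → ℂ} (hf : ContDiff ℝ ∞ f) : ContDiff ℝ ∞ (headTensor h f) :=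
  ((contDiff_config_complex h).comp contDiff_fst).mul (hf.comp contDiff_snd)

/-- `Ψ` is the functional derivative of the family `Φ` of distributions with respect to the field
configuration. -/
def IsDeriv {E : Type} [NormedAddCommGroup E] [NormedSpace ℝ E] (Φ : Config d → (E → ℂ) → ℂ)
    (Ψ : Config d → (Spc d × E → ℂ) → ℂ) : Prop :=
  ∀ (φ h : Config d) (f : E → ℂ), ContDiff ℝ ∞ f →
    HasDerivAt (fun s : ℝ => Φ (φ + s • h) f) (Ψ φ (headTensor h f)) 0

/-- Families of distributions that are polynomial of degree less than `N` in the field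
configuration. -/
def IsPoly : ℕ → ∀ {E : Type} [NormedAddCommGroup E] [NormedSpace ℝ E],
    (Config d → (E → ℂ) → ℂ) → Prop
  | 0, _, _, _, Φ => ∀ φ f, ContDiff ℝ ∞ f → Φ φ f = 0
  | N + 1, _, _, _, Φ => (∀ φ, IsDist (Φ φ)) ∧ ∃ Ψ, IsPoly N Ψ ∧ IsDeriv Φ Ψ

variable {E F : Type} [NormedAddCommGroup E] [NormedSpace ℝ E]
  [NormedAddCommGroup F] [NormedSpace ℝ F]

theorem IsPoly.isDist {N : ℕ} {Φ : Config d → (E → ℂ) → ℂ} (h : IsPoly N Φ) (φ : Config d) :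
    IsDist (Φ φ) := by
  cases N with
  | zero =>
    have h' : ∀ φ f, ContDiff ℝ ∞ f → Φ φ f = 0 := h
    refine ⟨fun f g hf hg => ?_, fun c f hf => ?_, ∅, 0, 0, isCompact_empty, le_rfl,
      fun f M hf _ _ => ?_⟩
    · rw [h' φ _ (hf.add hg), h' φ f hf, h' φ g hg, add_zero]
    · rw [h' φ _ (contDiff_const.mul hf), h' φ f hf, mul_zero]
    · simp [h' φ f hf]
  | succ N => exact h.1 φ

theorem isPoly_zero (N : ℕ) {Φ : Config d → (E → ℂ) → ℂ}
    (h : ∀ φ f, ContDiff ℝ ∞ f → Φ φ f = 0) : IsPoly N Φ := by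
  induction N generalizing E with
  | zero => exact h
  | succ N ih =>
    refine ⟨fun φ => IsPoly.isDist (N := 0) h φ, fun _ _ => 0, ih fun _ _ _ => rfl,
      fun φ k f hf => ?_⟩
    simp only [h _ f hf]
    exact hasDerivAt_const 0 0

theorem IsPoly.succ {N : ℕ} {Φ : Config d → (E → ℂ) → ℂ} (h : IsPoly N Φ) :
    IsPoly (N + 1) Φ := by
  induction N generalizing E with
  | zero => exact isPoly_zero 1 h
  | succ N ih =>
    obtain ⟨h1, Ψ, h2, h3⟩ := h
    exact ⟨h1, Ψ, ih h2, h3⟩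

theorem IsPoly.mono {N M : ℕ} (hNM : N ≤ M) {Φ : Config d → (E → ℂ) → ℂ} (h : IsPoly N Φ) :
    IsPoly M Φ := by
  induction hNM with
  | refl => exact h
  | step _ ih => exact ih.succ

theorem IsDeriv.add {Φ Φ' : Config d → (E → ℂ) → ℂ} {Ψ Ψ' : Config d → (Spc d × E → ℂ) → ℂ}
    (h : IsDeriv Φ Ψ) (h' : IsDeriv Φ' Ψ') :
    IsDeriv (fun φ f => Φ φ f + Φ' φ f) (fun φ f => Ψ φ f + Ψ' φ f) :=
  fun φ k f hf => (h φ k f hf).add (h' φ k f hf)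

theorem IsDeriv.const_mul {Φ : Config d → (E → ℂ) → ℂ} {Ψ : Config d → (Spc d × E → ℂ) → ℂ}
    (h : IsDeriv Φ Ψ) (c : ℂ) : IsDeriv (fun φ f => c * Φ φ f) (fun φ f => c * Ψ φ f) :=
  fun φ k f hf => (h φ k f hf).const_mul c

theorem IsDeriv.comp_weight {Φ : Config d → (E → ℂ) → ℂ} {Ψ : Config d → (Spc d × E → ℂ) → ℂ}
    (h : IsDeriv Φ Ψ) {k : E → ℂ} (hk : ContDiff ℝ ∞ k) (A : E →L[ℝ] F) :
    IsDeriv (fun φ f => Φ φ fun x => k x * f (A x))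
      (fun φ f => Ψ φ fun z => k z.2 * f (z.1, A z.2)) := by
  intro φ v f hf
  have h1 := h φ v (fun x => k x * f (A x)) (by fun_prop)
  convert! h1 using 2
  ext z
  simp only [headTensor]
  ring

theorem IsPoly.comp_weight {N : ℕ} {Φ : Config d → (E → ℂ) → ℂ} (h : IsPoly N Φ) {k : E → ℂ}
    (hk : ContDiff ℝ ∞ k) (A : E →L[ℝ] F) :
    IsPoly N (fun φ (f : F → ℂ) => Φ φ fun x => k x * f (A x)) := by
  induction N generalizing E F with
  | zero => exact fun φ f hf => h φ _ (by fun_prop)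
  | succ N ih =>
    obtain ⟨h1, Ψ, h2, h3⟩ := h
    exact ⟨fun φ => (h1 φ).comp_weight hk A, _,
      ih h2 (hk.comp contDiff_snd) ((ContinuousLinearMap.id ℝ (Spc d)).prodMap A),
      h3.comp_weight hk A⟩

theorem IsPoly.comp {N : ℕ} {Φ : Config d → (E → ℂ) → ℂ} (h : IsPoly N Φ) (A : E →L[ℝ] F) :
    IsPoly N (fun φ (f : F → ℂ) => Φ φ fun x => f (A x)) := by
  simpa using h.comp_weight (contDiff_const (c := (1 : ℂ))) A

theorem IsPoly.add {N : ℕ} {Φ Φ' : Config d → (E → ℂ) → ℂ} (h : IsPoly N Φ)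
    (h' : IsPoly N Φ') : IsPoly N (fun φ f => Φ φ f + Φ' φ f) := by
  induction N generalizing E with
  | zero =>
    intro φ f hf
    change Φ φ f + Φ' φ f = 0
    rw [h φ f hf, h' φ f hf, add_zero]
  | succ N ih =>
    obtain ⟨h1, Ψ, h2, h3⟩ := h
    obtain ⟨h1', Ψ', h2', h3'⟩ := h'
    exact ⟨fun φ => (h1 φ).add (h1' φ), _, ih h2 h2', h3.add h3'⟩

theorem IsPoly.const_mul {N : ℕ} {Φ : Config d → (E → ℂ) → ℂ} (h : IsPoly N Φ) (c : ℂ) :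
    IsPoly N (fun φ f => c * Φ φ f) := by
  induction N generalizing E with
  | zero =>
    intro φ f hf
    change c * Φ φ f = 0
    rw [h φ f hf, mul_zero]
  | succ N ih =>
    obtain ⟨h1, Ψ, h2, h3⟩ := h
    exact ⟨fun φ => (h1 φ).const_mul c, _, ih h2, h3.const_mul c⟩

theorem hasDerivAt_sum_pow_succ (M : ℕ) (c : ℕ → ℂ) (a : ℂ) (s : ℝ) :
    HasDerivAt (fun s : ℝ => a + ∑ j ∈ Finset.range M, (s : ℂ) ^ (j + 1) * (((j : ℂ) + 1)⁻¹ * c j))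
      (∑ j ∈ Finset.range M, (s : ℂ) ^ j * c j) s := by
  refine HasDerivAt.const_add a ?_
  refine HasDerivAt.fun_sum fun j _ => ?_
  have h := ((hasDerivAt_id s).ofReal_comp.fun_pow (j + 1)).mul_const (((j : ℂ) + 1)⁻¹ * c j)
  convert! h using 1
  have : ((j : ℂ) + 1) ≠ 0 := by exact_mod_cast Nat.succ_ne_zero j
  simp only [id]
  push_cast
  field_simp

theorem eq_of_hasDerivAt_sum_pow {M : ℕ} {c : ℕ → ℂ} {G : ℝ → ℂ}
    (h : ∀ s : ℝ, HasDerivAt G (∑ j ∈ Finset.range M, (s : ℂ) ^ j * c j) s) (s : ℝ) :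
    G s = G 0 + ∑ j ∈ Finset.range M, (s : ℂ) ^ (j + 1) * (((j : ℂ) + 1)⁻¹ * c j) := by
  have h2 : ∀ s : ℝ, HasDerivAt (fun s : ℝ => G s - (G 0 + ∑ j ∈ Finset.range M,
      (s : ℂ) ^ (j + 1) * (((j : ℂ) + 1)⁻¹ * c j))) 0 s := fun s => by
    simpa using (h s).fun_sub (hasDerivAt_sum_pow_succ M c (G 0) s)
  have h3 := is_const_of_deriv_eq_zero (fun s => (h2 s).differentiableAt)
    (fun s => (h2 s).deriv) s 0
  simp only [Complex.ofReal_zero, ne_eq, Nat.add_eq_zero_iff, one_ne_zero, and_false,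
    not_false_eq_true, zero_pow, zero_mul, Finset.sum_const_zero, add_zero, sub_self] at h3
  exact sub_eq_zero.1 h3

theorem HasDerivAt.translate_line {G : Config d → ℂ} {h : Config d} {G' : Config d → ℂ}
    (hG : ∀ φ, HasDerivAt (fun s : ℝ => G (φ + s • h)) (G' φ) 0) (φ : Config d) (s : ℝ) :
    HasDerivAt (fun s : ℝ => G (φ + s • h)) (G' (φ + s • h)) s := by
  have h1 := hG (φ + s • h)
  have h2 : HasDerivAt (fun t : ℝ => t - s) 1 s := (hasDerivAt_id s).sub_const s
  have h3 := h1.scomp_of_eq s h2 (sub_self s).symm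
  simp only [one_smul] at h3
  convert! h3 using 1
  ext t
  simp only [Function.comp_apply]
  congr 1
  rw [add_assoc, ← add_smul]
  congr 2
  ring

/-- On lines, a polynomial family of distributions is a polynomial. -/
theorem IsPoly.exists_line {N : ℕ} {Φ : Config d → (E → ℂ) → ℂ} (hΦ : IsPoly N Φ)
    (h : Config d) :
    ∃ Θ : ℕ → Config d → (E → ℂ) → ℂ, (∀ j, ∃ M, IsPoly M (Θ j)) ∧
      ∀ (φ : Config d) (s : ℝ) (f : E → ℂ), ContDiff ℝ ∞ f →
        Φ (φ + s • h) f = ∑ j ∈ Finset.range N, (s : ℂ) ^ j * Θ j φ f := by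
  induction N generalizing E with
  | zero => exact ⟨fun _ _ _ => 0, fun _ => ⟨0, fun _ _ _ => rfl⟩, fun φ s f hf => by
      simpa using hΦ _ f hf⟩
  | succ N ih =>
    obtain ⟨h1, Ψ, h2, h3⟩ := id hΦ
    obtain ⟨Θ, hΘ, hline⟩ := ih h2
    -- The coefficients of a primitive: Φ itself in degree zero, and the j-th coefficient of the
    -- derivative divided by j + 1 in degree j + 1.
    refine ⟨fun j => Nat.casesOn j Φ fun j φ f => ((j : ℂ) + 1)⁻¹ * Θ j φ (headTensor h f),
      fun j => ?_, fun φ s f hf => ?_⟩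
    · cases j with
      | zero => exact ⟨_, hΦ⟩
      | succ j =>
        obtain ⟨M, hM⟩ := hΘ j
        exact ⟨M, (hM.comp_weight ((contDiff_config_complex h).comp contDiff_fst)
          (ContinuousLinearMap.snd ℝ (Spc d) E)).const_mul _⟩
    · have hd : ∀ s : ℝ, HasDerivAt (fun s : ℝ => Φ (φ + s • h) f)
          (∑ j ∈ Finset.range N, (s : ℂ) ^ j * Θ j φ (headTensor h f)) s := fun s => by
        rw [← hline φ s _ (contDiff_headTensor h hf)]
        exact HasDerivAt.translate_line (G := fun φ => Φ φ f)
          (G' := fun φ => Ψ φ (headTensor h f)) (fun φ => h3 φ h f hf) φ s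
      have := eq_of_hasDerivAt_sum_pow hd s
      rw [this, Finset.sum_range_succ', add_comm]
      simp

/-- Induction on the number of parameters: in the first one the family is a polynomial, whose
coefficients are again polynomial families evaluated at the remaining parameters. -/
theorem IsPoly.contDiff {N : ℕ} {Φ : Config d → (E → ℂ) → ℂ} (hΦ : IsPoly N Φ) {f : E → ℂ}
    (hf : ContDiff ℝ ∞ f) {r : ℕ} (φ : Config d) (h : Fin r → Config d) :
    ContDiff ℝ ∞ fun s : Fin r → ℝ => Φ (φ + ∑ i, s i • h i) f := by
  induction r generalizing N Φ with
  | zero => simpa using contDiff_const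
  | succ r ih =>
    obtain ⟨Θ, hΘ, hline⟩ := hΦ.exists_line (h 0)
    have e : (fun s : Fin (r + 1) → ℝ => Φ (φ + ∑ i, s i • h i) f) = fun s =>
        ∑ j ∈ Finset.range N, ((s 0 : ℝ) : ℂ) ^ j *
          Θ j (φ + ∑ i : Fin r, s i.succ • h i.succ) f := by
      ext s
      rw [← hline _ _ _ hf, Fin.sum_univ_succ, add_assoc, add_comm (s 0 • h 0)]
    rw [e]
    refine ContDiff.sum fun j _ => ContDiff.mul ?_ ?_
    · exact (Complex.ofRealCLM.contDiff.comp (contDiff_apply ℝ ℝ 0)).pow j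
    · obtain ⟨M, hM⟩ := hΘ j
      exact (ih hM fun i => h i.succ).comp (g := fun s : Fin r → ℝ => Θ j (φ + ∑ i, s i • h i.succ) f)
        (f := fun (s : Fin (r + 1) → ℝ) i => s i.succ) (by fun_prop)

section Prod

variable [FiniteDimensional ℝ E] [FiniteDimensional ℝ F]

/-- Leibniz rule for a pairing in which both the distributions and the inner function depend on s.
Along the line both families are finite sums of powers of s, so the pairing is a polynomial in s
with fixed coefficients and no continuity in the field is needed. -/
theorem IsDeriv.prod {N M : ℕ} {Φ : Config d → (E → ℂ) → ℂ} {Φ' : Config d → (Spc d × E → ℂ) → ℂ}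
    {Ψ : Config d → (F → ℂ) → ℂ} {Ψ' : Config d → (Spc d × F → ℂ) → ℂ}
    (hΦ : IsPoly N Φ) (hΦ' : IsDeriv Φ Φ') (hΨ : IsPoly M Ψ) (hΨ' : IsDeriv Ψ Ψ') :
    IsDeriv (fun φ (f : E × F → ℂ) => Φ φ fun x => Ψ φ fun y => f (x, y))
      (fun φ f => (Φ' φ fun z => Ψ φ fun y => f (z.1, z.2, y)) +
        Φ φ fun x => Ψ' φ fun z => f (z.1, x, z.2)) := by
  intro φ h f hf
  obtain ⟨Θ, hΘ, hΘl⟩ := hΦ.exists_line h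
  obtain ⟨Ξ, hΞ, hΞl⟩ := hΨ.exists_line h
  have dΘ : ∀ j, IsDist (Θ j φ) := fun j => (hΘ j).choose_spec.isDist φ
  have dΞ : ∀ j, IsDist (Ξ j φ) := fun j => (hΞ j).choose_spec.isDist φ
  have hs : ∀ s : ℝ, (Φ (φ + s • h) fun x => Ψ (φ + s • h) fun y => f (x, y)) =
      ∑ j ∈ Finset.range N, ∑ k ∈ Finset.range M,
        (s : ℂ) ^ j * ((s : ℂ) ^ k * Θ j φ fun x => Ξ k φ fun y => f (x, y)) := fun s => by
    rw [hΘl φ s _ ((hΨ.isDist _).contDiff_slice hf)]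
    refine Finset.sum_congr rfl fun j _ => ?_
    have e : (fun x => Ψ (φ + s • h) fun y => f (x, y)) = fun x => ∑ k ∈ Finset.range M,
        (s : ℂ) ^ k * Ξ k φ fun y => f (x, y) := by
      ext x
      exact hΞl φ s _ (by fun_prop)
    rw [e, (dΘ j).map_sum _ _ fun k _ => contDiff_const.mul ((dΞ k).contDiff_slice hf),
      Finset.mul_sum]
    refine Finset.sum_congr rfl fun k _ => ?_
    rw [(dΘ j).map_smul _ _ ((dΞ k).contDiff_slice hf)]
  simp only [hs]
  have dpow : ∀ j : ℕ, HasDerivAt (fun s : ℝ => (s : ℂ) ^ j) (j * (0 : ℂ) ^ (j - 1)) 0 :=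
    fun j => by simpa using ((hasDerivAt_id (0 : ℝ)).ofReal_comp.fun_pow j)
  have hder : HasDerivAt (fun s : ℝ => ∑ j ∈ Finset.range N, ∑ k ∈ Finset.range M,
        (s : ℂ) ^ j * ((s : ℂ) ^ k * Θ j φ fun x => Ξ k φ fun y => f (x, y)))
      (∑ j ∈ Finset.range N, ∑ k ∈ Finset.range M,
        ((j * (0 : ℂ) ^ (j - 1)) * ((0 : ℂ) ^ k * Θ j φ fun x => Ξ k φ fun y => f (x, y)) +
          (0 : ℂ) ^ j * ((k * (0 : ℂ) ^ (k - 1)) * Θ j φ fun x => Ξ k φ fun y => f (x, y)))) 0 := by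
    refine HasDerivAt.fun_sum fun j _ => HasDerivAt.fun_sum fun k _ => ?_
    simpa using (dpow j).fun_mul ((dpow k).mul_const (Θ j φ fun x => Ξ k φ fun y => f (x, y)))
  convert! hder using 1
  -- identify the coefficients
  have val : ∀ {X : Type} [NormedAddCommGroup X] [NormedSpace ℝ X] {K : ℕ}
      {Υ : Config d → (X → ℂ) → ℂ} {T : ℕ → Config d → (X → ℂ) → ℂ}
      (_ : ∀ (φ : Config d) (s : ℝ) (f : X → ℂ), ContDiff ℝ ∞ f →
        Υ (φ + s • h) f = ∑ j ∈ Finset.range K, (s : ℂ) ^ j * T j φ f)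
      (g : X → ℂ) (_ : ContDiff ℝ ∞ g),
      Υ φ g = ∑ j ∈ Finset.range K, (0 : ℂ) ^ j * T j φ g := by
    intro X _ _ K Υ T hl g hg
    simpa using hl φ 0 g hg
  have der : ∀ {X : Type} [NormedAddCommGroup X] [NormedSpace ℝ X] {K : ℕ}
      {Υ : Config d → (X → ℂ) → ℂ} {Υ' : Config d → (Spc d × X → ℂ) → ℂ}
      {T : ℕ → Config d → (X → ℂ) → ℂ} (_ : IsDeriv Υ Υ')
      (_ : ∀ (φ : Config d) (s : ℝ) (f : X → ℂ), ContDiff ℝ ∞ f →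
        Υ (φ + s • h) f = ∑ j ∈ Finset.range K, (s : ℂ) ^ j * T j φ f)
      (g : X → ℂ) (_ : ContDiff ℝ ∞ g),
      Υ' φ (headTensor h g) = ∑ j ∈ Finset.range K, (j * (0 : ℂ) ^ (j - 1)) * T j φ g := by
    intro X _ _ K Υ Υ' T hd hl g hg
    refine (hd φ h g hg).unique ?_
    simp only [hl φ _ g hg]
    exact HasDerivAt.fun_sum fun j _ => (dpow j).mul_const _
  simp only [Finset.sum_add_distrib]
  congr 1
  · have e : (fun z : Spc d × E => Ψ φ fun y => headTensor h f (z.1, z.2, y)) =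
        headTensor h fun x => Ψ φ fun y => f (x, y) := by
      ext z
      exact (hΨ.isDist φ).map_smul (((h : Spc d → ℝ) z.1 : ℝ) : ℂ) (fun y => f (z.2, y)) (by fun_prop)
    rw [e, der hΦ' hΘl _ ((hΨ.isDist φ).contDiff_slice hf)]
    refine Finset.sum_congr rfl fun j _ => ?_
    have e2 : (fun x => Ψ φ fun y => f (x, y)) = fun x => ∑ k ∈ Finset.range M,
        (0 : ℂ) ^ k * Ξ k φ fun y => f (x, y) := by
      ext x
      exact val hΞl _ (by fun_prop)
    rw [e2, (dΘ j).map_sum _ _ fun k _ => contDiff_const.mul ((dΞ k).contDiff_slice hf),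
      Finset.mul_sum]
    refine Finset.sum_congr rfl fun k _ => ?_
    rw [(dΘ j).map_smul _ _ ((dΞ k).contDiff_slice hf)]
  · have e : (fun x => Ψ' φ fun z : Spc d × F => headTensor h f (z.1, x, z.2)) = fun x =>
        ∑ k ∈ Finset.range M, (k * (0 : ℂ) ^ (k - 1)) * Ξ k φ fun y => f (x, y) := by
      ext x
      exact der hΨ' hΞl (fun y => f (x, y)) (by fun_prop)
    have hsm : ∀ k ∈ Finset.range M, ContDiff ℝ ∞ fun x =>
        (k * (0 : ℂ) ^ (k - 1)) * Ξ k φ fun y => f (x, y) :=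
      fun k _ => contDiff_const.mul ((dΞ k).contDiff_slice hf)
    rw [e, val hΘl _ (ContDiff.sum hsm)]
    refine Finset.sum_congr rfl fun j _ => ?_
    rw [(dΘ j).map_sum _ _ hsm, Finset.mul_sum]
    refine Finset.sum_congr rfl fun k _ => ?_
    rw [(dΘ j).map_smul _ _ ((dΞ k).contDiff_slice hf)]

/-- Induction on N + M: each of the two terms of the Leibniz rule lowers the degree of one factor.
Reordering the variables brings the new point to the front. -/
theorem IsPoly.prod {N M : ℕ}
    {Φ : Config d → (E → ℂ) → ℂ} {Ψ : Config d → (F → ℂ) → ℂ}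
    (hΦ : IsPoly N Φ) (hΨ : IsPoly M Ψ) :
    IsPoly (N + M) (fun φ (f : E × F → ℂ) => Φ φ fun x => Ψ φ fun y => f (x, y)) := by
  obtain ⟨K, hK⟩ : ∃ K, N + M = K := ⟨_, rfl⟩
  induction K generalizing N M E F with
  | zero =>
    obtain rfl : N = 0 := by omega
    exact isPoly_zero _ fun φ f hf => hΦ φ _ ((hΨ.isDist φ).contDiff_slice hf)
  | succ K ih =>
    cases N with
    | zero => exact isPoly_zero _ fun φ f hf => hΦ φ _ ((hΨ.isDist φ).contDiff_slice hf)
    | succ N =>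
    cases M with
    | zero =>
      refine isPoly_zero _ fun φ f hf => ?_
      have : (fun x => Ψ φ fun y => f (x, y)) = fun _ => 0 := by
        ext x
        exact hΨ φ _ (by fun_prop)
      rw [this, (hΦ.isDist φ).map_zero]
    | succ M =>
      obtain ⟨h1, Φ', h2, h3⟩ := id hΦ
      obtain ⟨h1', Ψ', h2', h3'⟩ := id hΨ
      rw [← add_assoc]
      refine ⟨fun φ => (h1 φ).prod (h1' φ), _, ?_, IsDeriv.prod hΦ h3 hΨ h3'⟩
      refine IsPoly.add ?_ ?_
      · have := ih h2 hΨ (by omega)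
        have h4 := this.comp (ContinuousLinearEquiv.prodAssoc ℝ (Spc d) E F).toContinuousLinearMap
        rw [show N + 1 + M = N + (M + 1) by ring]
        exact h4
      · have := ih hΦ h2' (by omega)
        exact this.comp (((ContinuousLinearMap.fst ℝ (Spc d) F).comp
          (ContinuousLinearMap.snd ℝ E (Spc d × F))).prod ((ContinuousLinearMap.fst ℝ E _).prod
            ((ContinuousLinearMap.snd ℝ (Spc d) F).comp (ContinuousLinearMap.snd ℝ E _))))

end Prod

end Families

end FlowEquation
namespace FlowEquation

/-! ### Functional derivatives of observables as polynomial families. -/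

section Observables

variable {d : ℕ}

/-- Functionals that are smooth on all finite-dimensional affine subspaces. -/
def IsSmooth (G : Functional d) : Prop :=
  ∀ (n : ℕ) (φ : Config d) (h : Fin n → Config d),
    ContDiff ℝ ∞ (fun s : Fin n → ℝ => G (φ + ∑ i, s i • h i))

theorem IsSmooth.hasDerivAt {G : Functional d} (hG : IsSmooth G) {n : ℕ} (φ : Config d)
    (h : Fin n → Config d) (s : Fin n → ℝ) (i : Fin n) :
    HasDerivAt (fun t : ℝ => G (φ + ∑ j, s j • h j + t • h i))
      (fderiv ℝ (fun s : Fin n → ℝ => G (φ + ∑ i, s i • h i)) s (Pi.single i 1)) 0 := by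
  have h1 : HasFDerivAt (fun s : Fin n → ℝ => G (φ + ∑ i, s i • h i)) _ s :=
    ((hG n φ h).differentiable (by simp) s).hasFDerivAt
  have h2 : HasDerivAt (fun t : ℝ => s + t • Pi.single i (1 : ℝ)) (Pi.single i 1) 0 := by
    simpa using ((hasDerivAt_id (0 : ℝ)).smul_const (Pi.single i (1 : ℝ))).const_add s
  have h3 := h1.comp_hasDerivAt_of_eq (0 : ℝ) h2 (by simp)
  convert! h3 using 1
  ext t
  simp only [Function.comp_apply, Pi.add_apply, Pi.smul_apply, smul_eq_mul, add_smul,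
    Finset.sum_add_distrib, add_assoc]
  congr 3
  rw [Finset.sum_eq_single i (fun j _ hj => by simp [hj]) (by simp)]
  simp

theorem IsSmooth.dirDeriv_eq {G : Functional d} (hG : IsSmooth G) {n : ℕ} (φ : Config d)
    (h : Fin n → Config d) (s : Fin n → ℝ) (i : Fin n) :
    dirDeriv (h i) G (φ + ∑ j, s j • h j) =
      fderiv ℝ (fun s : Fin n → ℝ => G (φ + ∑ i, s i • h i)) s (Pi.single i 1) :=
  (hG.hasDerivAt φ h s i).deriv

theorem IsSmooth.hasDerivAt_dirDeriv {G : Functional d} (hG : IsSmooth G) (φ h : Config d) :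
    HasDerivAt (fun t : ℝ => G (φ + t • h)) (dirDeriv h G φ) 0 := by
  have h1 := hG.hasDerivAt φ (fun _ : Fin 1 => h) 0 0
  have h2 := hG.dirDeriv_eq φ (fun _ : Fin 1 => h) 0 0
  rw [← h2] at h1
  simpa using h1

/-- The direction k is added as an extra parameter, held at zero; the directional derivative is a
partial derivative of a smooth function of finitely many variables. -/
theorem IsSmooth.dirDeriv {G : Functional d} (hG : IsSmooth G) (k : Config d) :
    IsSmooth (dirDeriv k G) := by
  intro n φ h
  let h' : Fin (n + 1) → Config d := Fin.cons k h
  have e : (fun s : Fin n → ℝ => FlowEquation.dirDeriv k G (φ + ∑ i, s i • h i)) = fun s =>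
      fderiv ℝ (fun s : Fin (n + 1) → ℝ => G (φ + ∑ i, s i • h' i)) (Fin.cons 0 s)
        (Pi.single 0 1) := by
    ext s
    rw [← hG.dirDeriv_eq φ h' (Fin.cons 0 s) 0]
    simp [h', Fin.sum_univ_succ]
  rw [e]
  have h1 : ContDiff ℝ ∞ (fderiv ℝ (fun s : Fin (n + 1) → ℝ => G (φ + ∑ i, s i • h' i))) :=
    (hG (n + 1) φ h').fderiv_right (by simp)
  have h2 : ContDiff ℝ ∞ fun s : Fin n → ℝ => (Fin.cons 0 s : Fin (n + 1) → ℝ) := by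
    rw [contDiff_pi]
    intro i
    refine Fin.cases ?_ (fun i => ?_) i
    · simpa using contDiff_const
    · simpa using contDiff_apply ℝ ℝ i
  exact (h1.comp h2).clm_apply contDiff_const

/-- Both sides are mixed second partial derivatives at the origin of the same smooth function of two
parameters. -/
theorem IsSmooth.dirDeriv_comm {G : Functional d} (hG : IsSmooth G) (h k : Config d) :
    FlowEquation.dirDeriv h (FlowEquation.dirDeriv k G) =
      FlowEquation.dirDeriv k (FlowEquation.dirDeriv h G) := by
  ext φ
  let h' : Fin 2 → Config d := ![h, k]
  let Γ : (Fin 2 → ℝ) → ℂ := fun s => G (φ + ∑ i, s i • h' i)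
  have hΓ : ContDiff ℝ ∞ Γ := hG 2 φ h'
  have key : ∀ i j, FlowEquation.dirDeriv (h' i) (FlowEquation.dirDeriv (h' j) G) φ =
      fderiv ℝ (fderiv ℝ Γ) 0 (Pi.single i 1) (Pi.single j 1) := fun i j => by
    have h1 := (hG.dirDeriv (h' j)).dirDeriv_eq φ h' 0 i
    have h2 : (fun s : Fin 2 → ℝ => FlowEquation.dirDeriv (h' j) G (φ + ∑ i, s i • h' i)) =
        fun s => fderiv ℝ Γ s (Pi.single j 1) := by
      ext s
      exact hG.dirDeriv_eq φ h' s j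
    have hd : DifferentiableAt ℝ (fderiv ℝ Γ) 0 :=
      (hΓ.fderiv_right (m := ∞) (by simp)).differentiable (by simp) 0
    rw [h2, fderiv_clm_apply hd (by fun_prop)] at h1
    simpa using h1
  have hs : IsSymmSndFDerivAt ℝ Γ 0 := hΓ.contDiffAt.isSymmSndFDerivAt (by
    rw [minSmoothness_of_isRCLikeNormedField]
    exact (WithTop.coe_le_coe.2 le_top : ((2 : ℕ∞) : WithTop ℕ∞) ≤ ∞))
  have h01 := key 0 1
  have h10 := key 1 0
  rw [hs.eq, ← h10] at h01
  simpa [h'] using h01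

theorem IsSmooth.iterDirDeriv {G : Functional d} (hG : IsSmooth G) (n : ℕ)
    (h : Fin n → Config d) : IsSmooth (iterDirDeriv n h G) := by
  induction n with
  | zero => exact hG
  | succ n ih => exact (ih _).dirDeriv _

theorem IsSmooth.iterDirDeriv_dirDeriv {G : Functional d} (hG : IsSmooth G) (n : ℕ)
    (h : Fin n → Config d) (k : Config d) :
    FlowEquation.iterDirDeriv n h (FlowEquation.dirDeriv k G) =
      FlowEquation.dirDeriv k (FlowEquation.iterDirDeriv n h G) := by
  induction n with
  | zero => rfl
  | succ n ih =>
    change FlowEquation.dirDeriv (h 0) (FlowEquation.iterDirDeriv n (Fin.tail h) _) = _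
    rw [ih, (hG.iterDirDeriv n _).dirDeriv_comm]
    rfl

theorem IsObservable.isSmooth {F : Functional d} (hF : IsObservable F) : IsSmooth F := hF.smooth

/-- The pairing of the `n`-th functional derivative of `F` with a function. -/
noncomputable def fd (n : ℕ) (F : Functional d) (φ : Config d) : ((Fin n → Spc d) → ℂ) → ℂ :=
  (funcDeriv n F φ).pair

theorem isDist_fd (n : ℕ) (F : Functional d) (φ : Config d) : IsDist (fd n F φ) :=
  CDist.isDist_pair _

theorem IsObservable.fd_tensor {F : Functional d} (hF : IsObservable F) (n : ℕ) (φ : Config d)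
    (h : Fin n → Config d) : fd n F φ (tensor h) = FlowEquation.iterDirDeriv n h F φ := by
  have hex := hF.distributional n φ
  have : funcDeriv n F φ = hex.choose := by
    unfold funcDeriv
    rw [dif_pos hex]
  rw [fd, this]
  exact (hex.choose_spec h).symm

/-- `funcDeriv` is a choice; this is the way to compute it, from any distribution with the right
values on tensor products. -/
theorem IsObservable.fd_eq {F : Functional d} (hF : IsObservable F) {n : ℕ} {φ : Config d}
    {u : ((Fin n → Spc d) → ℂ) → ℂ} (hu : IsDist u)
    (h : ∀ h : Fin n → Config d, FlowEquation.iterDirDeriv n h F φ = u (tensor h))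
    {g : (Fin n → Spc d) → ℂ} (hg : ContDiff ℝ ∞ g) : fd n F φ g = u g :=
  (isDist_fd n F φ).ext_tensor hu (fun k => by rw [hF.fd_tensor, h]) hg

/-- The splitting of the first point. -/
noncomputable def splitHead (d n : ℕ) : (Fin (n + 1) → Spc d) →L[ℝ] Spc d × (Fin n → Spc d) :=
  (ContinuousLinearMap.proj 0).prod (ContinuousLinearMap.pi fun i : Fin n =>
    ContinuousLinearMap.proj i.succ)

@[simp]
theorem splitHead_apply (n : ℕ) (x : Fin (n + 1) → Spc d) :
    splitHead d n x = (x 0, Fin.tail x) := rfl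

/-- The addition of a first point. -/
noncomputable def joinHead (d n : ℕ) : Spc d × (Fin n → Spc d) →L[ℝ] (Fin (n + 1) → Spc d) :=
  ContinuousLinearMap.pi (Fin.cases (ContinuousLinearMap.fst ℝ _ _) fun i =>
    (ContinuousLinearMap.proj i).comp (ContinuousLinearMap.snd ℝ _ _))

@[simp]
theorem joinHead_apply {n : ℕ} (z : Spc d × (Fin n → Spc d)) :
    joinHead d n z = Fin.cons z.1 z.2 := by
  ext i : 1
  refine Fin.cases ?_ (fun i => ?_) i <;> simp [joinHead]

theorem tensor_succ {n : ℕ} (h : Fin (n + 1) → Config d) (x : Fin (n + 1) → Spc d) :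
    tensor h x = (((h 0 : Spc d → ℝ) (x 0) : ℝ) : ℂ) * tensor (Fin.tail h) (Fin.tail x) := by
  simp [tensor, Fin.prod_univ_succ, Fin.tail]

@[simp]
theorem tensor_zero (h : Fin 0 → Config d) (x : Fin 0 → Spc d) : tensor h x = 1 := by
  simp [tensor]

/-- Downward induction on the order n, starting above the degree N where everything vanishes. If the
derivative of order n + 1 is a polynomial family, it is a polynomial on lines. Integration gives the
derivative of order n on tensor products, and density extends this to all smooth functions, where it
can be differentiated in the field. -/
theorem IsObservable.isPoly_fd_aux {F : Functional d} (hF : IsObservable F) {N : ℕ}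
    (hN : ∀ n > N, ∀ (φ : Config d) (h : Fin n → Config d),
      FlowEquation.iterDirDeriv n h F φ = 0) (M n : ℕ) (hM : N < n + M) :
    IsPoly M (fd n F) ∧ IsDeriv (fd n F) (fun φ g => fd (n + 1) F φ fun x => g (splitHead d n x)) := by
  induction M generalizing n with
  | zero =>
    have h0 : ∀ n > N, ∀ φ f, ContDiff ℝ ∞ f → fd n F φ f = 0 := fun n hn φ f hf =>
      (isDist_fd n F φ).eq_zero_of_tensor (fun h => by rw [hF.fd_tensor, hN n hn]) hf
    refine ⟨h0 n (by omega), fun φ h f hf => ?_⟩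
    have hs : ContDiff ℝ ∞ fun x => headTensor h f (splitHead d n x) :=
      (contDiff_headTensor h hf).comp (splitHead d n).contDiff
    simp only [h0 n (by omega) _ f hf, h0 (n + 1) (by omega) φ _ hs]
    exact hasDerivAt_const 0 0
  | succ M ih =>
    have hΨ : IsPoly M fun φ (g : Spc d × (Fin n → Spc d) → ℂ) =>
        fd (n + 1) F φ fun x => g (splitHead d n x) :=
      (ih (n + 1) (by omega)).1.comp (splitHead d n)
    suffices hD : IsDeriv (fd n F) (fun φ g => fd (n + 1) F φ fun x => g (splitHead d n x)) from
      ⟨⟨isDist_fd n F, _, hΨ, hD⟩, hD⟩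
    intro φ h f hf
    obtain ⟨Θ, hΘ, hline⟩ := hΨ.exists_line h
    have dΘ : ∀ j, IsDist (Θ j φ) := fun j => (hΘ j).choose_spec.isDist φ
    have hten : ∀ (φ : Config d) (k : Fin n → Config d),
        (fd (n + 1) F φ fun x => headTensor h (tensor k) (splitHead d n x)) =
          FlowEquation.dirDeriv h (FlowEquation.iterDirDeriv n k F) φ := fun φ k => by
      have h1 := hF.fd_tensor (n + 1) φ (Fin.cons h k : Fin (n + 1) → Config d)
      have h2 : tensor (Fin.cons h k : Fin (n + 1) → Config d) =
          fun x => headTensor h (tensor k) (splitHead d n x) := by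
        ext x
        rw [tensor_succ]
        simp [headTensor]
      rw [← h2, h1]
      simp [FlowEquation.iterDirDeriv]
    -- Both sides are distributions in f for fixed s, so it suffices to integrate along the line for
    -- tensor products.
    have hexp : ∀ (s : ℝ) (f : (Fin n → Spc d) → ℂ), ContDiff ℝ ∞ f →
        fd n F (φ + s • h) f = fd n F φ f + ∑ j ∈ Finset.range M, (s : ℂ) ^ (j + 1) *
          (((j : ℂ) + 1)⁻¹ * Θ j φ (headTensor h f)) := by
      intro s f hf
      have hdist : IsDist fun f => fd n F φ f + ∑ j ∈ Finset.range M, (s : ℂ) ^ (j + 1) *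
          (((j : ℂ) + 1)⁻¹ * Θ j φ (headTensor h f)) := by
        refine (isDist_fd n F φ).add (IsDist.sum _ fun j _ =>
          ((IsDist.const_mul ?_ _).const_mul _))
        exact (dΘ j).comp_weight ((contDiff_config_complex h).comp contDiff_fst)
          (ContinuousLinearMap.snd ℝ (Spc d) (Fin n → Spc d))
      refine (isDist_fd n F (φ + s • h)).ext_tensor hdist (fun k => ?_) hf
      have hd : ∀ s : ℝ, HasDerivAt (fun s : ℝ => fd n F (φ + s • h) (tensor k))
          (∑ j ∈ Finset.range M, (s : ℂ) ^ j * Θ j φ (headTensor h (tensor k))) s := fun s => by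
        rw [← hline φ s _ (contDiff_headTensor h (contDiff_tensor k)), hten]
        simp only [hF.fd_tensor]
        exact HasDerivAt.translate_line (fun φ =>
          (hF.isSmooth.iterDirDeriv n k).hasDerivAt_dirDeriv φ h) φ s
      simpa using eq_of_hasDerivAt_sum_pow hd s
    have h1 := hasDerivAt_sum_pow_succ M (fun j => Θ j φ (headTensor h f)) (fd n F φ f) 0
    have h2 := hline φ 0 _ (contDiff_headTensor h hf)
    rw [zero_smul, add_zero] at h2
    change HasDerivAt _ (fd (n + 1) F φ fun x => headTensor h f (splitHead d n x)) 0
    rw [h2]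
    simp only [hexp _ f hf]
    exact h1

theorem IsObservable.isDeriv_fd {F : Functional d} (hF : IsObservable F) (n : ℕ) :
    IsDeriv (fd n F) (fun φ g => fd (n + 1) F φ fun x => g (splitHead d n x)) := by
  obtain ⟨N, hN⟩ := hF.polynomial
  exact (hF.isPoly_fd_aux hN (N + 1) n (by omega)).2

theorem IsObservable.exists_isPoly_fd {F : Functional d} (hF : IsObservable F) (n : ℕ) :
    ∃ M, IsPoly M (fd n F) := by
  obtain ⟨N, hN⟩ := hF.polynomial
  exact ⟨_, (hF.isPoly_fd_aux hN (N + 1) n (by omega)).1⟩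

variable {E : Type} [NormedAddCommGroup E] [NormedSpace ℝ E]

theorem IsPoly.exists_isDeriv {N : ℕ} {Φ : Config d → (E → ℂ) → ℂ} (hΦ : IsPoly N Φ) :
    ∃ Ψ, IsPoly (N - 1) Ψ ∧ IsDeriv Φ Ψ := by
  cases N with
  | zero =>
    refine ⟨fun _ _ => 0, fun _ _ _ => rfl, fun φ h f hf => ?_⟩
    have : ∀ φ, Φ φ f = 0 := fun φ => hΦ φ f hf
    simp only [this]
    exact hasDerivAt_const 0 0
  | succ N =>
    obtain ⟨-, Ψ, h2, h3⟩ := hΦ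
    exact ⟨Ψ, h2, h3⟩

theorem IsDeriv.dirDeriv {Φ : Config d → (E → ℂ) → ℂ} {Ψ : Config d → (Spc d × E → ℂ) → ℂ}
    (h : IsDeriv Φ Ψ) (k : Config d) {f : E → ℂ} (hf : ContDiff ℝ ∞ f) :
    FlowEquation.dirDeriv k (fun φ => Φ φ f) = fun φ => Ψ φ (headTensor k f) := by
  ext φ
  exact (h φ k f hf).deriv

/-- The iterated functional derivatives of a polynomial family of distributions. -/
theorem IsPoly.exists_iterDirDeriv {N : ℕ} {Φ : Config d → (E → ℂ) → ℂ} (hΦ : IsPoly N Φ)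
    (n : ℕ) :
    ∃ Φn : Config d → ((Fin n → Spc d) × E → ℂ) → ℂ, IsPoly (N - n) Φn ∧
      ∀ (h : Fin n → Config d) (f : E → ℂ), ContDiff ℝ ∞ f →
        iterDirDeriv n h (fun φ => Φ φ f) = fun φ => Φn φ fun z => tensor h z.1 * f z.2 := by
  induction n with
  | zero =>
    refine ⟨_, hΦ.comp (ContinuousLinearMap.inr ℝ (Fin 0 → Spc d) E), fun h f hf => ?_⟩
    simp [iterDirDeriv]
  | succ n ih =>
    obtain ⟨Φn, hΦn, hit⟩ := ih
    obtain ⟨Ψ, hΨ, hder⟩ := hΦn.exists_isDeriv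
    refine ⟨fun φ g => Ψ φ fun z => g (joinHead d n (z.1, z.2.1), z.2.2), ?_, fun h f hf => ?_⟩
    · have := hΨ.comp (((joinHead d n).prodMap (ContinuousLinearMap.id ℝ E)).comp
        (ContinuousLinearEquiv.prodAssoc ℝ (Spc d) (Fin n → Spc d) E).symm.toContinuousLinearMap)
      rw [Nat.sub_sub] at this
      exact this
    · change FlowEquation.dirDeriv (h 0) (iterDirDeriv n (Fin.tail h) _) = _
      rw [hit _ f hf, hder.dirDeriv]
      · ext φ
        congr 1
        ext z
        simp [headTensor, tensor_succ, mul_assoc]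
      · exact ((contDiff_tensor _).comp contDiff_fst).mul (hf.comp contDiff_snd)

/-- The source of observables below: sums, products, contractions and second order operators are all
polynomial families paired with a fixed function. -/
theorem IsPoly.isObservable {N : ℕ} {Φ : Config d → (E → ℂ) → ℂ} (hΦ : IsPoly N Φ) {f : E → ℂ}
    (hf : ContDiff ℝ ∞ f) : IsObservable fun φ => Φ φ f := by
  refine ⟨fun n φ h => hΦ.contDiff hf φ h, fun n φ => ?_, N, fun n hn φ h => ?_⟩
  · obtain ⟨Φn, hΦn, hit⟩ := hΦ.exists_iterDirDeriv n
    have hd : IsDist fun g : (Fin n → Spc d) → ℂ => Φn φ fun z => f z.2 * g z.1 :=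
      (hΦn.isDist φ).comp_weight (hf.comp contDiff_snd)
        (ContinuousLinearMap.fst ℝ (Fin n → Spc d) E)
    obtain ⟨w, hw⟩ := hd.exists_cDist
    refine ⟨w, fun h => ?_⟩
    rw [hit h f hf, hw _ (contDiff_tensor h)]
    simp only [mul_comm]
  · obtain ⟨Φn, hΦn, hit⟩ := hΦ.exists_iterDirDeriv n
    rw [hit h f hf]
    rw [Nat.sub_eq_zero_of_le hn.le] at hΦn
    exact hΦn φ _ (((contDiff_tensor _).comp contDiff_fst).mul (hf.comp contDiff_snd))

/-- `Fin 0 → Spc d` is a single point, so every test function is a constant. In this way plain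
observables become special pairings. -/
theorem fd_zero {F : Functional d} (hF : IsObservable F) (φ : Config d)
    (g : (Fin 0 → Spc d) → ℂ) : fd 0 F φ g = F φ * g 0 := by
  have hg : g = fun x => g 0 * tensor (Fin.elim0 : Fin 0 → Config d) x := by
    ext x
    rw [tensor_zero, mul_one, Subsingleton.elim x 0]
  conv_lhs => rw [hg]
  rw [(isDist_fd 0 F φ).map_smul _ _ (contDiff_tensor _), hF.fd_tensor, mul_comm]
  rfl

theorem isObservable_const (c : ℂ) : IsObservable (fun _ : Config d => c) := by
  have h : IsPoly 1 fun (_ : Config d) (f : (Fin 0 → Spc d) → ℂ) => f 0 := by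
    refine ⟨fun φ => ⟨fun _ _ _ _ => rfl, fun _ _ _ => rfl, {0}, 0, 1, isCompact_singleton,
      zero_le_one, fun f M _ _ hb => ?_⟩, fun _ _ => 0, fun _ _ _ => rfl,
      fun φ h f hf => hasDerivAt_const 0 _⟩
    have := hb 0 le_rfl 0 rfl
    rwa [norm_iteratedFDeriv_zero, ← one_mul M] at this
  exact h.isObservable (f := fun _ => c) contDiff_const

theorem IsObservable.add {F G : Functional d} (hF : IsObservable F) (hG : IsObservable G) :
    IsObservable (F + G) := by
  obtain ⟨N, hN⟩ := hF.exists_isPoly_fd 0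
  obtain ⟨M, hM⟩ := hG.exists_isPoly_fd 0
  have h := ((hN.mono (le_max_left N M)).add (hM.mono (le_max_right N M))).isObservable
    (f := fun _ => 1) contDiff_const
  simp only [fd_zero hF, fd_zero hG, mul_one] at h
  exact h

theorem IsObservable.mul {F G : Functional d} (hF : IsObservable F) (hG : IsObservable G) :
    IsObservable (F * G) := by
  obtain ⟨N, hN⟩ := hF.exists_isPoly_fd 0
  obtain ⟨M, hM⟩ := hG.exists_isPoly_fd 0
  have h := (hN.prod hM).isObservable (f := fun _ => 1) contDiff_const
  simp only [fd_zero hF, fd_zero hG, mul_one] at h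
  exact h

variable (d) in
/-- The algebra of observables with the pointwise product. -/
def observables : Subalgebra ℂ (Functional d) where
  carrier := {F | IsObservable F}
  mul_mem' := IsObservable.mul
  add_mem' := IsObservable.add
  algebraMap_mem' c := isObservable_const c

end Observables

end FlowEquation
namespace FlowEquation

/-! ### Second order operators and contractions of observables. -/

section Contractions

variable {d : ℕ}

theorem IsSmooth.dirDeriv_add {F G : Functional d} (hF : IsSmooth F) (hG : IsSmooth G)
    (h : Config d) : FlowEquation.dirDeriv h (F + G) =
      FlowEquation.dirDeriv h F + FlowEquation.dirDeriv h G := by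
  ext φ
  exact ((hF.hasDerivAt_dirDeriv φ h).add (hG.hasDerivAt_dirDeriv φ h)).deriv

theorem IsSmooth.dirDeriv_mul {F G : Functional d} (hF : IsSmooth F) (hG : IsSmooth G)
    (h : Config d) : FlowEquation.dirDeriv h (F * G) =
      FlowEquation.dirDeriv h F * G + F * FlowEquation.dirDeriv h G := by
  ext φ
  have := ((hF.hasDerivAt_dirDeriv φ h).mul (hG.hasDerivAt_dirDeriv φ h)).deriv
  exact this.trans (by simp)

theorem IsSmooth.dirDeriv_smul {F : Functional d} (hF : IsSmooth F) (c : ℂ) (h : Config d) :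
    FlowEquation.dirDeriv h (c • F) = c • FlowEquation.dirDeriv h F := by
  ext φ
  exact ((hF.hasDerivAt_dirDeriv φ h).const_mul c).deriv

theorem IsSmooth.iterDirDeriv_add {F G : Functional d} (hF : IsSmooth F) (hG : IsSmooth G)
    (n : ℕ) (h : Fin n → Config d) : FlowEquation.iterDirDeriv n h (F + G) =
      FlowEquation.iterDirDeriv n h F + FlowEquation.iterDirDeriv n h G := by
  induction n with
  | zero => rfl
  | succ n ih =>
    simp only [FlowEquation.iterDirDeriv]
    rw [ih, (hF.iterDirDeriv n _).dirDeriv_add (hG.iterDirDeriv n _)]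

theorem IsSmooth.iterDirDeriv_smul {F : Functional d} (hF : IsSmooth F) (c : ℂ)
    (n : ℕ) (h : Fin n → Config d) : FlowEquation.iterDirDeriv n h (c • F) =
      c • FlowEquation.iterDirDeriv n h F := by
  induction n with
  | zero => rfl
  | succ n ih =>
    simp only [FlowEquation.iterDirDeriv]
    rw [ih, (hF.iterDirDeriv n _).dirDeriv_smul]

theorem IsObservable.smul {F : Functional d} (hF : IsObservable F) (c : ℂ) :
    IsObservable (c • F) := (observables d).smul_mem hF c

section Fd

variable {F G : Functional d} {n : ℕ} {g : (Fin n → Spc d) → ℂ}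

theorem fd_add (hF : IsObservable F) (hG : IsObservable G) (φ : Config d)
    (hg : ContDiff ℝ ∞ g) : fd n (F + G) φ g = fd n F φ g + fd n G φ g :=
  (hF.add hG).fd_eq ((isDist_fd n F φ).add (isDist_fd n G φ)) (fun h => by
    rw [hF.isSmooth.iterDirDeriv_add hG.isSmooth, hF.fd_tensor, hG.fd_tensor]
    rfl) hg

theorem fd_smul (hF : IsObservable F) (c : ℂ) (φ : Config d)
    (hg : ContDiff ℝ ∞ g) : fd n (c • F) φ g = c * fd n F φ g :=
  (hF.smul c).fd_eq ((isDist_fd n F φ).const_mul c) (fun h => by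
    rw [hF.isSmooth.iterDirDeriv_smul, hF.fd_tensor]
    rfl) hg

theorem fd_one_mul (hF : IsObservable F) (hG : IsObservable G) (φ : Config d)
    {g : (Fin 1 → Spc d) → ℂ} (hg : ContDiff ℝ ∞ g) :
    fd 1 (F * G) φ g = F φ * fd 1 G φ g + G φ * fd 1 F φ g :=
  (hF.mul hG).fd_eq (((isDist_fd 1 G φ).const_mul _).add ((isDist_fd 1 F φ).const_mul _))
    (fun h => by
      rw [hF.fd_tensor, hG.fd_tensor]
      simp only [iterDirDeriv]
      rw [hF.isSmooth.dirDeriv_mul hG.isSmooth]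
      simp only [Pi.add_apply, Pi.mul_apply]
      ring) hg

theorem fd_const (c : ℂ) (φ : Config d) {g : (Fin (n + 1) → Spc d) → ℂ}
    (hg : ContDiff ℝ ∞ g) : fd (n + 1) (fun _ => c) φ g = 0 := by
  have h0 : ∀ (n : ℕ) (h : Fin (n + 1) → Config d),
      iterDirDeriv (n + 1) h (fun _ => c) = fun _ => 0 := by
    intro n
    induction n with
    | zero => intro h; ext φ; simp [iterDirDeriv, dirDeriv]
    | succ n ih =>
      intro h
      change dirDeriv (h 0) (iterDirDeriv (n + 1) (Fin.tail h) _) = _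
      rw [ih]
      ext φ
      simp [dirDeriv]
  exact (isObservable_const c).fd_eq IsDist.zero (fun h => by rw [h0]) hg

end Fd

/-- The second order differential operator `∫ dx dy k(x, y) δ²F/δφ(x)δφ(y)`. -/
noncomputable def lap (k : (Fin 2 → Spc d) → ℂ) (F : Functional d) : Functional d :=
  fun φ => fd 2 F φ k

theorem IsObservable.lap {F : Functional d} (hF : IsObservable F) {k : (Fin 2 → Spc d) → ℂ}
    (hk : ContDiff ℝ ∞ k) : IsObservable (lap k F) := by
  obtain ⟨N, hN⟩ := hF.exists_isPoly_fd 2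
  exact hN.isObservable hk

theorem IsObservable.dirDeriv {F : Functional d} (hF : IsObservable F) (h : Config d) :
    IsObservable (dirDeriv h F) := by
  obtain ⟨N, hN⟩ := hF.exists_isPoly_fd 1
  have h1 := hN.isObservable (contDiff_tensor fun _ => h)
  simp only [hF.fd_tensor] at h1
  exact h1

theorem IsObservable.iterDirDeriv {F : Functional d} (hF : IsObservable F) (n : ℕ)
    (h : Fin n → Config d) : IsObservable (iterDirDeriv n h F) := by
  induction n with
  | zero => exact hF
  | succ n ih => exact (ih _).dirDeriv _

/-- Makes the kernel k the test function: identities for `lap k` need only be checked on tensor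
kernels, where `lap` is a product of two directional derivatives. -/
theorem isDist_iterDirDeriv_lap {F : Functional d} (hF : IsObservable F) (n : ℕ)
    (h : Fin n → Config d) (φ : Config d) :
    ∃ u : ((Fin 2 → Spc d) → ℂ) → ℂ, IsDist u ∧
      ∀ k, ContDiff ℝ ∞ k → iterDirDeriv n h (lap k F) φ = u k := by
  obtain ⟨N, hN⟩ := hF.exists_isPoly_fd 2
  obtain ⟨Φn, hΦn, hit⟩ := hN.exists_iterDirDeriv n
  refine ⟨fun k => Φn φ fun z => tensor h z.1 * k z.2, ?_, fun k hk => ?_⟩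
  · exact (hΦn.isDist φ).comp_weight ((contDiff_tensor h).comp contDiff_fst)
      (ContinuousLinearMap.snd ℝ (Fin n → Spc d) (Fin 2 → Spc d))
  · exact congrFun (hit h k hk) φ

theorem lap_tensor {F : Functional d} (hF : IsObservable F) (κ : Fin 2 → Config d) :
    lap (tensor κ) F = dirDeriv (κ 0) (dirDeriv (κ 1) F) := by
  ext φ
  exact hF.fd_tensor 2 φ κ

/-- For tensor kernels this is the commutativity of directional derivatives; both sides are
distributions in k. -/
theorem iterDirDeriv_lap {F : Functional d} (hF : IsObservable F) (n : ℕ)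
    (h : Fin n → Config d) {k : (Fin 2 → Spc d) → ℂ} (hk : ContDiff ℝ ∞ k) :
    iterDirDeriv n h (lap k F) = lap k (iterDirDeriv n h F) := by
  ext φ
  obtain ⟨u, hu, hu'⟩ := isDist_iterDirDeriv_lap hF n h φ
  rw [hu' k hk]
  refine hu.ext_tensor (isDist_fd 2 _ φ) (fun κ => ?_) hk
  rw [← hu' _ (contDiff_tensor κ), lap_tensor hF,
    (hF.isSmooth.dirDeriv _).iterDirDeriv_dirDeriv, hF.isSmooth.iterDirDeriv_dirDeriv]
  exact ((hF.iterDirDeriv n h).fd_tensor 2 φ κ).symm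

/-- The first two points. -/
noncomputable def headPair (d n : ℕ) : (Fin (n + 2) → Spc d) →L[ℝ] (Fin 2 → Spc d) :=
  ContinuousLinearMap.pi ![ContinuousLinearMap.proj 0, ContinuousLinearMap.proj 1]

@[simp]
theorem headPair_apply {n : ℕ} (x : Fin (n + 2) → Spc d) : headPair d n x = ![x 0, x 1] := by
  ext i : 1
  fin_cases i <;> simp [headPair]

/-- All but the first point. -/
noncomputable def tailMap (d n : ℕ) : (Fin (n + 1) → Spc d) →L[ℝ] (Fin n → Spc d) :=
  ContinuousLinearMap.pi fun i => ContinuousLinearMap.proj i.succ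

@[simp]
theorem tailMap_apply {n : ℕ} (x : Fin (n + 1) → Spc d) : tailMap d n x = Fin.tail x := rfl

theorem contDiff_tail {n : ℕ} : ContDiff ℝ ∞ fun x : Fin (n + 1) → Spc d => Fin.tail x :=
  (tailMap d n).contDiff

/-- Density is used twice, first in g and then in k; on tensor products both sides are the same
iterated directional derivative of order n + 2. -/
theorem fd_lap {F : Functional d} (hF : IsObservable F) {n : ℕ} {k : (Fin 2 → Spc d) → ℂ}
    (hk : ContDiff ℝ ∞ k) (φ : Config d) {g : (Fin n → Spc d) → ℂ} (hg : ContDiff ℝ ∞ g) :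
    fd n (lap k F) φ g = fd (n + 2) F φ fun x => k ![x 0, x 1] * g (Fin.tail (Fin.tail x)) := by
  have hd : IsDist fun g : (Fin n → Spc d) → ℂ =>
      fd (n + 2) F φ fun x => k ![x 0, x 1] * g (Fin.tail (Fin.tail x)) := by
    simpa using (isDist_fd (n + 2) F φ).comp_weight (hk.comp (headPair d n).contDiff)
      ((tailMap d n).comp (tailMap d (n + 1)))
  refine (hF.lap hk).fd_eq hd (fun h => ?_) hg
  obtain ⟨u, hu, hu'⟩ := isDist_iterDirDeriv_lap hF n h φ
  have hv : IsDist fun k : (Fin 2 → Spc d) → ℂ =>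
      fd (n + 2) F φ fun x => tensor h (Fin.tail (Fin.tail x)) * k ![x 0, x 1] := by
    simpa using (isDist_fd (n + 2) F φ).comp_weight ((contDiff_tensor h).comp
      ((tailMap d n).comp (tailMap d (n + 1))).contDiff) (headPair d n)
  rw [hu' k hk]
  simp only [mul_comm (k _)]
  refine hu.ext_tensor hv (fun κ => ?_) hk
  rw [← hu' _ (contDiff_tensor κ), lap_tensor hF,
    (hF.isSmooth.dirDeriv _).iterDirDeriv_dirDeriv, hF.isSmooth.iterDirDeriv_dirDeriv]
  have h2 := hF.fd_tensor (n + 2) φ (Fin.cons (κ 0) (Fin.cons (κ 1) h : Fin (n + 1) → Config d))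
  have e : tensor (Fin.cons (κ 0) (Fin.cons (κ 1) h : Fin (n + 1) → Config d) :
      Fin (n + 2) → Config d) =
      fun x => tensor h (Fin.tail (Fin.tail x)) * tensor κ ![x 0, x 1] := by
    ext x
    simp only [tensor_succ, tensor_zero, Fin.tail_cons, Fin.cons_zero]
    simp only [Fin.tail, Matrix.cons_val_zero, Matrix.cons_val_one, Fin.succ_zero_eq_one]
    ring
  rw [← e, h2]
  simp [iterDirDeriv]

/-- For a tensor kernel k the claim says that `lap l` commutes with two directional derivatives;
both sides are distributions in k. -/
theorem lap_comm {F : Functional d} (hF : IsObservable F) {k l : (Fin 2 → Spc d) → ℂ}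
    (hk : ContDiff ℝ ∞ k) (hl : ContDiff ℝ ∞ l) : lap k (lap l F) = lap l (lap k F) := by
  ext φ
  have hd : IsDist fun k : (Fin 2 → Spc d) → ℂ =>
      fd 4 F φ fun x => l (Fin.tail (Fin.tail x)) * k ![x 0, x 1] := by
    simpa using (isDist_fd 4 F φ).comp_weight (hl.comp
      ((tailMap d 2).comp (tailMap d 3)).contDiff) (headPair d 2)
  have h1 : ∀ k, ContDiff ℝ ∞ k → lap l (lap k F) φ =
      fd 4 F φ fun x => l (Fin.tail (Fin.tail x)) * k ![x 0, x 1] := fun k hk => by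
    simp only [mul_comm (l _)]
    exact fd_lap hF hk φ hl
  rw [h1 k hk]
  refine (isDist_fd 2 (lap l F) φ).ext_tensor hd (fun κ => ?_) hk
  rw [← h1 _ (contDiff_tensor κ), (hF.lap hl).fd_tensor, iterDirDeriv_lap hF 2 κ hl, lap_tensor hF]
  rfl

theorem lap_add {F G : Functional d} (hF : IsObservable F) (hG : IsObservable G)
    {k : (Fin 2 → Spc d) → ℂ} (hk : ContDiff ℝ ∞ k) : lap k (F + G) = lap k F + lap k G := by
  ext φ
  exact fd_add hF hG φ hk

theorem lap_smul {F : Functional d} (hF : IsObservable F) (c : ℂ)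
    {k : (Fin 2 → Spc d) → ℂ} (hk : ContDiff ℝ ∞ k) : lap k (c • F) = c • lap k F := by
  ext φ
  exact fd_smul hF c φ hk

/-- The pairing of `δᵐF/δφᵐ ⊗ δⁿG/δφⁿ` with a function. -/
noncomputable def bi (m n : ℕ) (F G : Functional d) (φ : Config d)
    (f : (Fin m → Spc d) × (Fin n → Spc d) → ℂ) : ℂ :=
  fd m F φ fun x => fd n G φ fun y => f (x, y)

theorem isDist_bi (m n : ℕ) (F G : Functional d) (φ : Config d) : IsDist (bi m n F G φ) :=
  (isDist_fd m F φ).prod (isDist_fd n G φ)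

theorem exists_isPoly_bi {F G : Functional d} (hF : IsObservable F) (hG : IsObservable G)
    (m n : ℕ) : ∃ N, IsPoly N (bi m n F G) := by
  obtain ⟨N, hN⟩ := hF.exists_isPoly_fd m
  obtain ⟨M, hM⟩ := hG.exists_isPoly_fd n
  exact ⟨_, hN.prod hM⟩

theorem hasDerivAt_bi {F G : Functional d} (hF : IsObservable F) (hG : IsObservable G)
    {m n : ℕ} {f : (Fin m → Spc d) × (Fin n → Spc d) → ℂ} (hf : ContDiff ℝ ∞ f)
    (φ h : Config d) :
    HasDerivAt (fun s : ℝ => bi m n F G (φ + s • h) f)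
      (bi (m + 1) n F G φ (fun z => (((h : Spc d → ℝ) (z.1 0) : ℝ) : ℂ) * f (Fin.tail z.1, z.2)) +
        bi m (n + 1) F G φ
          (fun z => (((h : Spc d → ℝ) (z.2 0) : ℝ) : ℂ) * f (z.1, Fin.tail z.2))) 0 := by
  obtain ⟨N, hN⟩ := hF.exists_isPoly_fd m
  obtain ⟨M, hM⟩ := hG.exists_isPoly_fd n
  exact IsDeriv.prod hN (hF.isDeriv_fd m) hM (hG.isDeriv_fd n) φ h f hf

theorem IsDist.comp_weight_pair {X : Type} [NormedAddCommGroup X] [NormedSpace ℝ X]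
    [FiniteDimensional ℝ X] {u : (X → ℂ) → ℂ} (hu : IsDist u) {w : X → ℂ}
    (hw : ContDiff ℝ ∞ w) (a b : X →L[ℝ] Spc d) :
    IsDist fun k : (Fin 2 → Spc d) → ℂ => u fun x => w x * k ![a x, b x] := by
  have h := hu.comp_weight hw (ContinuousLinearMap.pi ![a, b] : X →L[ℝ] Fin 2 → Spc d)
  have e : ∀ x, (ContinuousLinearMap.pi ![a, b] : X →L[ℝ] Fin 2 → Spc d) x = ![a x, b x] := by
    intro x
    ext i : 1
    fin_cases i <;> simp
  simpa only [e] using h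

/-- A point of the first group of points. -/
noncomputable def firstProj {m n : ℕ} (i : Fin m) :
    (Fin m → Spc d) × (Fin n → Spc d) →L[ℝ] Spc d :=
  (ContinuousLinearMap.proj (R := ℝ) (φ := fun _ : Fin m => Spc d) i).comp
    (ContinuousLinearMap.fst ℝ (Fin m → Spc d) (Fin n → Spc d))

/-- A point of the second group of points. -/
noncomputable def secondProj {m n : ℕ} (i : Fin n) :
    (Fin m → Spc d) × (Fin n → Spc d) →L[ℝ] Spc d :=
  (ContinuousLinearMap.proj (R := ℝ) (φ := fun _ : Fin n => Spc d) i).comp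
    (ContinuousLinearMap.snd ℝ (Fin m → Spc d) (Fin n → Spc d))

/-- The second functional derivative of a contraction. -/
theorem fd_two_bi {F G : Functional d} (hF : IsObservable F) (hG : IsObservable G)
    {m n : ℕ} {f : (Fin m → Spc d) × (Fin n → Spc d) → ℂ} (hf : ContDiff ℝ ∞ f)
    (φ : Config d) {k : (Fin 2 → Spc d) → ℂ} (hk : ContDiff ℝ ∞ k) :
    fd 2 (fun φ => bi m n F G φ f) φ k =
      (bi (m + 2) n F G φ fun z => f (Fin.tail (Fin.tail z.1), z.2) * k ![z.1 0, z.1 1]) +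
      (bi (m + 1) (n + 1) F G φ fun z => f (Fin.tail z.1, Fin.tail z.2) * k ![z.1 0, z.2 0]) +
      (bi (m + 1) (n + 1) F G φ fun z => f (Fin.tail z.1, Fin.tail z.2) * k ![z.2 0, z.1 0]) +
      (bi m (n + 2) F G φ fun z => f (z.1, Fin.tail (Fin.tail z.2)) * k ![z.2 0, z.2 1]) := by
  obtain ⟨N, hN⟩ := exists_isPoly_bi hF hG m n
  have c1 : ContDiff ℝ ∞ fun z : (Fin (m + 2) → Spc d) × (Fin n → Spc d) =>
      f (Fin.tail (Fin.tail z.1), z.2) :=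
    hf.comp (((contDiff_tail.comp contDiff_tail).comp contDiff_fst).prodMk contDiff_snd)
  have c2 : ContDiff ℝ ∞ fun z : (Fin (m + 1) → Spc d) × (Fin (n + 1) → Spc d) =>
      f (Fin.tail z.1, Fin.tail z.2) :=
    hf.comp ((contDiff_tail.comp contDiff_fst).prodMk (contDiff_tail.comp contDiff_snd))
  have c3 : ContDiff ℝ ∞ fun z : (Fin m → Spc d) × (Fin (n + 2) → Spc d) =>
      f (z.1, Fin.tail (Fin.tail z.2)) :=
    hf.comp (contDiff_fst.prodMk ((contDiff_tail.comp contDiff_tail).comp contDiff_snd))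
  have hd : IsDist fun k : (Fin 2 → Spc d) → ℂ =>
      (bi (m + 2) n F G φ fun z => f (Fin.tail (Fin.tail z.1), z.2) * k ![z.1 0, z.1 1]) +
      (bi (m + 1) (n + 1) F G φ fun z => f (Fin.tail z.1, Fin.tail z.2) * k ![z.1 0, z.2 0]) +
      (bi (m + 1) (n + 1) F G φ fun z => f (Fin.tail z.1, Fin.tail z.2) * k ![z.2 0, z.1 0]) +
      (bi m (n + 2) F G φ fun z => f (z.1, Fin.tail (Fin.tail z.2)) * k ![z.2 0, z.2 1]) := by
    exact ((((isDist_bi (m + 2) n F G φ).comp_weight_pair c1 (firstProj 0) (firstProj 1)).add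
      ((isDist_bi (m + 1) (n + 1) F G φ).comp_weight_pair c2 (firstProj 0) (secondProj 0))).add
      ((isDist_bi (m + 1) (n + 1) F G φ).comp_weight_pair c2 (secondProj 0) (firstProj 0))).add
      ((isDist_bi m (n + 2) F G φ).comp_weight_pair c3 (secondProj 0) (secondProj 1))
  refine (hN.isObservable hf).fd_eq hd (fun h => ?_) hk
  have cl : ContDiff ℝ ∞ fun z : (Fin (m + 1) → Spc d) × (Fin n → Spc d) =>
      (((h 1 : Spc d → ℝ) (z.1 0) : ℝ) : ℂ) * f (Fin.tail z.1, z.2) :=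
    ((contDiff_config_complex (h 1)).comp ((contDiff_apply ℝ (Spc d) 0).comp contDiff_fst)).mul
      (hf.comp ((contDiff_tail.comp contDiff_fst).prodMk contDiff_snd))
  have cr : ContDiff ℝ ∞ fun z : (Fin m → Spc d) × (Fin (n + 1) → Spc d) =>
      (((h 1 : Spc d → ℝ) (z.2 0) : ℝ) : ℂ) * f (z.1, Fin.tail z.2) :=
    ((contDiff_config_complex (h 1)).comp ((contDiff_apply ℝ (Spc d) 0).comp contDiff_snd)).mul
      (hf.comp (contDiff_fst.prodMk (contDiff_tail.comp contDiff_snd)))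
  have e1 : dirDeriv (h 1) (fun φ => bi m n F G φ f) = fun φ =>
      bi (m + 1) n F G φ (fun z => (((h 1 : Spc d → ℝ) (z.1 0) : ℝ) : ℂ) *
          f (Fin.tail z.1, z.2)) +
        bi m (n + 1) F G φ (fun z => (((h 1 : Spc d → ℝ) (z.2 0) : ℝ) : ℂ) *
          f (z.1, Fin.tail z.2)) := by
    ext φ
    exact (hasDerivAt_bi hF hG hf φ (h 1)).deriv
  -- Each of the two differentiations hits F or G, which gives the four terms.
  change dirDeriv (h 0) (dirDeriv (h 1) fun φ => bi m n F G φ f) φ = _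
  rw [e1]
  refine ((hasDerivAt_bi hF hG cl φ (h 0)).add (hasDerivAt_bi hF hG cr φ (h 0))).deriv.trans ?_
  have ht : ∀ a b : Spc d, tensor h ![a, b] =
      (((h 0 : Spc d → ℝ) a : ℝ) : ℂ) * (((h 1 : Spc d → ℝ) b : ℝ) : ℂ) := fun a b => by
    simp [tensor, Fin.prod_univ_succ]
  simp only [ht]
  have r1 : ∀ a b c : ℂ, a * (b * c) = c * (a * b) := fun a b c => by ring
  have r2 : ∀ a b c e : ℂ, a + b + (c + e) = a + c + b + e := fun a b c e => by ring
  rw [r2]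
  refine congrArg₂ _ (congrArg₂ _ (congrArg₂ _ ?_ ?_) ?_) ?_
  · exact congrArg _ (funext fun z => r1 _ _ _)
  · exact congrArg _ (funext fun z => r1 _ _ _)
  · exact congrArg _ (funext fun z => r1 _ _ _)
  · exact congrArg _ (funext fun z => r1 _ _ _)

end Contractions

end FlowEquation
namespace FlowEquation

/-! ### The operator D acting on contractions. -/

section Identities

variable {d : ℕ}

/-- The kernel of the product of propagators in a contraction. -/
noncomputable def contractKer {n : ℕ} (q : Fin n → 𝓢(Spc d, ℂ)) :
    (Fin n → Spc d) × (Fin n → Spc d) → ℂ := fun z => ∏ i, q i (z.1 i - z.2 i)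

theorem contDiff_contractKer {n : ℕ} (q : Fin n → 𝓢(Spc d, ℂ)) :
    ContDiff ℝ ∞ (contractKer q) :=
  contDiff_prod fun i _ => ((q i).smooth ⊤).comp
    ((firstProj (m := n) (n := n) i - secondProj i).contDiff)

theorem contract_eq_bi {n : ℕ} (q : Fin n → 𝓢(Spc d, ℂ)) (F G : Functional d) :
    contract q F G = fun φ => bi n n F G φ (contractKer q) := rfl

/-- The kernel `q(x - y) / 2`. -/
noncomputable def halfKer (q : 𝓢(Spc d, ℂ)) : (Fin 2 → Spc d) → ℂ :=
  fun x => (1 / 2 : ℂ) * q (x 0 - x 1)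

theorem contDiff_halfKer (q : 𝓢(Spc d, ℂ)) : ContDiff ℝ ∞ (halfKer q) :=
  contDiff_const.mul ((q.smooth ⊤).comp
    ((contDiff_apply ℝ (Spc d) (0 : Fin 2)).sub (contDiff_apply ℝ (Spc d) (1 : Fin 2))))

variable {F G H : Functional d}

theorem IsObservable.contract (hF : IsObservable F) (hG : IsObservable G) {n : ℕ}
    (q : Fin n → 𝓢(Spc d, ℂ)) : IsObservable (contract q F G) := by
  obtain ⟨N, hN⟩ := exists_isPoly_bi hF hG n n
  exact hN.isObservable (contDiff_contractKer q)

theorem contDiff_fd_slice {m n : ℕ} (G : Functional d) (φ : Config d)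
    {f : (Fin m → Spc d) × (Fin n → Spc d) → ℂ} (hf : ContDiff ℝ ∞ f) :
    ContDiff ℝ ∞ fun x => fd n G φ fun y => f (x, y) :=
  (isDist_fd n G φ).contDiff_slice hf

theorem bi_add_left (hF : IsObservable F) (hG : IsObservable G) (H : Functional d) {m n : ℕ}
    (φ : Config d) {f : (Fin m → Spc d) × (Fin n → Spc d) → ℂ} (hf : ContDiff ℝ ∞ f) :
    bi m n (F + G) H φ f = bi m n F H φ f + bi m n G H φ f :=
  fd_add hF hG φ (contDiff_fd_slice H φ hf)

theorem bi_smul_left (hF : IsObservable F) (c : ℂ) (H : Functional d) {m n : ℕ}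
    (φ : Config d) {f : (Fin m → Spc d) × (Fin n → Spc d) → ℂ} (hf : ContDiff ℝ ∞ f) :
    bi m n (c • F) H φ f = c * bi m n F H φ f :=
  fd_smul hF c φ (contDiff_fd_slice H φ hf)

theorem contDiff_slice_right {m n : ℕ} {f : (Fin m → Spc d) × (Fin n → Spc d) → ℂ}
    (hf : ContDiff ℝ ∞ f) (x : Fin m → Spc d) : ContDiff ℝ ∞ fun y => f (x, y) :=
  hf.comp (contDiff_const.prodMk contDiff_id)

theorem bi_add_right (H : Functional d) (hF : IsObservable F) (hG : IsObservable G) {m n : ℕ}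
    (φ : Config d) {f : (Fin m → Spc d) × (Fin n → Spc d) → ℂ} (hf : ContDiff ℝ ∞ f) :
    bi m n H (F + G) φ f = bi m n H F φ f + bi m n H G φ f := by
  rw [bi, bi, bi, ← (isDist_fd m H φ).map_add _ _ (contDiff_fd_slice F φ hf)
    (contDiff_fd_slice G φ hf)]
  exact congrArg _ (funext fun x => fd_add hF hG φ (contDiff_slice_right hf x))

theorem bi_smul_right (H : Functional d) (hF : IsObservable F) (c : ℂ) {m n : ℕ}
    (φ : Config d) {f : (Fin m → Spc d) × (Fin n → Spc d) → ℂ} (hf : ContDiff ℝ ∞ f) :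
    bi m n H (c • F) φ f = c * bi m n H F φ f := by
  rw [bi, bi, ← (isDist_fd m H φ).map_smul c _ (contDiff_fd_slice F φ hf)]
  exact congrArg _ (funext fun x => fd_smul hF c φ (contDiff_slice_right hf x))

theorem contract_zero (hF : IsObservable F) (hG : IsObservable G) (q : Fin 0 → 𝓢(Spc d, ℂ)) :
    contract q F G = F * G := by
  ext φ
  rw [contract_eq_bi]
  simp only [bi, contractKer, fd_zero hF, fd_zero hG]
  simp

theorem contract_one_mul (hF : IsObservable F) (hG : IsObservable G)
    (q : Fin 1 → 𝓢(Spc d, ℂ)) (H : Functional d) :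
    contract q (F * G) H = F * contract q G H + G * contract q F H := by
  ext φ
  exact fd_one_mul hF hG φ (contDiff_fd_slice H φ (contDiff_contractKer q))

theorem lap_const (c : ℂ) {k : (Fin 2 → Spc d) → ℂ} (hk : ContDiff ℝ ∞ k) :
    lap k (fun _ : Config d => c) = 0 := by
  ext φ
  exact fd_const c φ hk

/-- The two derivatives of the operator fall on F, on G, or one on each. The mixed term arises
twice, which cancels the ½ of `halfKer` and joins F and G by one further propagator r. -/
theorem lap_contract (hF : IsObservable F) (hG : IsObservable G) {n : ℕ}
    (q : Fin n → 𝓢(Spc d, ℂ)) {r : 𝓢(Spc d, ℂ)} (hr : ∀ z, r (-z) = r z) :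
    lap (halfKer r) (contract q F G) =
      contract q (lap (halfKer r) F) G + contract q F (lap (halfKer r) G) +
        contract (Fin.cons r q : Fin (n + 1) → 𝓢(Spc d, ℂ)) F G := by
  ext φ
  have hk := contDiff_halfKer r
  have hq := contDiff_contractKer q
  have h1 : contract q (lap (halfKer r) F) G φ = bi (n + 2) n F G φ fun z =>
      contractKer q (Fin.tail (Fin.tail z.1), z.2) * halfKer r ![z.1 0, z.1 1] := by
    refine (fd_lap hF hk φ (contDiff_fd_slice G φ hq)).trans (congrArg _ (funext fun x => ?_))
    rw [← (isDist_fd n G φ).map_smul _ _ (contDiff_slice_right hq _)]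
    simp only [mul_comm]
  have h2 : contract q F (lap (halfKer r) G) φ = bi n (n + 2) F G φ fun z =>
      contractKer q (z.1, Fin.tail (Fin.tail z.2)) * halfKer r ![z.2 0, z.2 1] := by
    refine congrArg _ (funext fun x => ?_)
    refine (fd_lap hG hk φ (contDiff_slice_right hq x)).trans (congrArg _ (funext fun y => ?_))
    exact mul_comm _ _
  -- The evenness of r enters here: it identifies the two mixed terms.
  have hs : (fun z : (Fin (n + 1) → Spc d) × (Fin (n + 1) → Spc d) =>
      contractKer q (Fin.tail z.1, Fin.tail z.2) * halfKer r ![z.2 0, z.1 0]) =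
      fun z => contractKer q (Fin.tail z.1, Fin.tail z.2) * halfKer r ![z.1 0, z.2 0] := by
    ext z
    simp only [halfKer, Matrix.cons_val_zero, Matrix.cons_val_one]
    rw [← hr, neg_sub]
  have h3 : (2 : ℂ) * bi (n + 1) (n + 1) F G φ (fun z =>
      contractKer q (Fin.tail z.1, Fin.tail z.2) * halfKer r ![z.1 0, z.2 0]) =
      contract (Fin.cons r q : Fin (n + 1) → 𝓢(Spc d, ℂ)) F G φ := by
    have hc : ContDiff ℝ ∞ fun z : (Fin (n + 1) → Spc d) × (Fin (n + 1) → Spc d) =>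
        contractKer q (Fin.tail z.1, Fin.tail z.2) * halfKer r ![z.1 0, z.2 0] := by
      refine (hq.comp ((contDiff_tail.comp contDiff_fst).prodMk
        (contDiff_tail.comp contDiff_snd))).mul (contDiff_const.mul ((r.smooth ⊤).comp
          ((firstProj (m := n + 1) (n := n + 1) 0 - secondProj 0).contDiff)))
    rw [contract_eq_bi, ← (isDist_bi (n + 1) (n + 1) F G φ).map_smul 2 _ hc]
    refine congrArg _ (funext fun z => ?_)
    simp only [contractKer, halfKer, Fin.prod_univ_succ, Fin.cons_zero, Fin.cons_succ, Fin.tail,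
      Matrix.cons_val_zero, Matrix.cons_val_one]
    ring
  have h4 := fd_two_bi hF hG hq φ hk
  rw [hs] at h4
  rw [Pi.add_apply, Pi.add_apply, h1, h2, ← h3]
  refine h4.trans ?_
  ring

/-- Linear operators on a commutative algebra. -/
abbrev LinOp (R : Type*) [CommRing R] [Algebra ℂ R] : Type _ := R →ₗ[ℂ] R

/-- Bilinear operators on a commutative algebra. -/
abbrev BilOp (R : Type*) [CommRing R] [Algebra ℂ R] : Type _ := R →ₗ[ℂ] R →ₗ[ℂ] R

/-- The operator `½ ∫ dx dy q(x - y) δ²F/δφ(x)δφ(y)` on observables. -/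
noncomputable def obsLap (q : 𝓢(Spc d, ℂ)) : LinOp (observables d) where
  toFun F := ⟨lap (halfKer q) F.1, F.2.lap (contDiff_halfKer q)⟩
  map_add' F G := Subtype.ext (lap_add F.2 G.2 (contDiff_halfKer q))
  map_smul' c F := Subtype.ext (lap_smul F.2 c (contDiff_halfKer q))

/-- The contraction of observables. -/
noncomputable def obsContract {n : ℕ} (q : Fin n → 𝓢(Spc d, ℂ)) :
    BilOp (observables d) :=
  LinearMap.mk₂ ℂ (fun F G => ⟨contract q F.1 G.1, F.2.contract G.2 q⟩)
    (fun F F' G => Subtype.ext <| funext fun φ =>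
      bi_add_left F.2 F'.2 G.1 φ (contDiff_contractKer q))
    (fun c F G => Subtype.ext <| funext fun φ =>
      bi_smul_left F.2 c G.1 φ (contDiff_contractKer q))
    (fun F G G' => Subtype.ext <| funext fun φ =>
      bi_add_right F.1 G.2 G'.2 φ (contDiff_contractKer q))
    (fun c F G => Subtype.ext <| funext fun φ =>
      bi_smul_right F.1 G.2 c φ (contDiff_contractKer q))

theorem coe_obsContract {n : ℕ} (q : Fin n → 𝓢(Spc d, ℂ)) (F G : observables d) :
    (obsContract q F G : Functional d) = contract q F G := rfl

theorem obsLap_comm (q r : 𝓢(Spc d, ℂ)) (F : observables d) :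
    obsLap q (obsLap r F) = obsLap r (obsLap q F) :=
  Subtype.ext (lap_comm F.2 (contDiff_halfKer q) (contDiff_halfKer r))

theorem obsLap_one (q : 𝓢(Spc d, ℂ)) : obsLap q (1 : observables d) = 0 :=
  Subtype.ext (lap_const 1 (contDiff_halfKer q))

theorem obsContract_zero (q : Fin 0 → 𝓢(Spc d, ℂ)) (F G : observables d) :
    obsContract q F G = F * G := Subtype.ext (contract_zero F.2 G.2 q)

theorem obsContract_one_mul (q : Fin 1 → 𝓢(Spc d, ℂ)) (F G H : observables d) :
    obsContract q (F * G) H = F * obsContract q G H + G * obsContract q F H :=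
  Subtype.ext (contract_one_mul F.2 G.2 q H.1)

theorem obsLap_obsContract {n : ℕ} (q : Fin n → 𝓢(Spc d, ℂ)) {r : 𝓢(Spc d, ℂ)}
    (hr : ∀ z, r (-z) = r z) (F G : observables d) :
    obsLap r (obsContract q F G) = obsContract q (obsLap r F) G + obsContract q F (obsLap r G) +
      obsContract (Fin.cons r q : Fin (n + 1) → 𝓢(Spc d, ℂ)) F G :=
  Subtype.ext (lap_contract F.2 G.2 q hr)

end Identities

end FlowEquation
namespace FlowEquation

/-! ### The exponential exp(ħD) and the star product, algebraically. -/

section Algebra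

open Finset PowerSeries

section Sums

variable {M : Type*} [AddCommMonoid M]

theorem sum_antidiagonal_assoc (n : ℕ) (f : ℕ → ℕ → ℕ → M) :
    ∑ p ∈ antidiagonal n, ∑ q ∈ antidiagonal p.1, f q.1 q.2 p.2 =
      ∑ p ∈ antidiagonal n, ∑ q ∈ antidiagonal p.2, f p.1 q.1 q.2 := by
  rw [sum_sigma', sum_sigma']
  refine sum_nbij' (fun x => ⟨(x.2.1, x.2.2 + x.1.2), (x.2.2, x.1.2)⟩)
    (fun x => ⟨(x.1.1 + x.2.1, x.2.2), (x.1.1, x.2.1)⟩) ?_ ?_ ?_ ?_ ?_ <;>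
  rintro ⟨⟨a, b⟩, ⟨c, e⟩⟩ h <;> simp at h ⊢ <;> grind

theorem sum_antidiagonal_swap_fst (n : ℕ) (f : ℕ → ℕ → ℕ → M) :
    ∑ p ∈ antidiagonal n, ∑ q ∈ antidiagonal p.1, f q.1 q.2 p.2 =
      ∑ p ∈ antidiagonal n, ∑ q ∈ antidiagonal p.2, f q.1 p.1 q.2 := by
  rw [sum_sigma', sum_sigma']
  refine sum_nbij' (fun x => ⟨(x.2.2, x.2.1 + x.1.2), (x.2.1, x.1.2)⟩)
    (fun x => ⟨(x.1.1 + x.2.1, x.2.2), (x.2.1, x.1.1)⟩) ?_ ?_ ?_ ?_ ?_ <;>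
  rintro ⟨⟨a, b⟩, ⟨c, e⟩⟩ h <;> simp at h ⊢ <;> grind

/-- Two ways of distributing the power of ħ over the number of contractions, the powers of D on each
factor and the coefficients of each factor. -/
theorem sum_antidiagonal_quintuple (n : ℕ) (f : ℕ → ℕ → ℕ → ℕ → ℕ → M) :
    ∑ p ∈ antidiagonal n, ∑ q ∈ antidiagonal p.2, ∑ v ∈ antidiagonal p.1,
      ∑ w ∈ antidiagonal v.2, f v.1 w.1 w.2 q.1 q.2 =
      ∑ p ∈ antidiagonal n, ∑ q ∈ antidiagonal p.2, ∑ v ∈ antidiagonal q.1,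
        ∑ w ∈ antidiagonal q.2, f p.1 v.1 w.1 v.2 w.2 := by
  simp only [sum_sigma']
  refine sum_nbij'
    (fun x => ⟨(x.2.2.1.1, x.2.2.2.1 + x.2.1.1 + (x.2.2.2.2 + x.2.1.2)),
      (x.2.2.2.1 + x.2.1.1, x.2.2.2.2 + x.2.1.2), (x.2.2.2.1, x.2.1.1), (x.2.2.2.2, x.2.1.2)⟩)
    (fun x => ⟨(x.1.1 + (x.2.2.1.1 + x.2.2.2.1), x.2.2.1.2 + x.2.2.2.2),
      (x.2.2.1.2, x.2.2.2.2), (x.1.1, x.2.2.1.1 + x.2.2.2.1), (x.2.2.1.1, x.2.2.2.1)⟩)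
    ?_ ?_ ?_ ?_ ?_ <;>
  rintro ⟨⟨a, b⟩, ⟨c, e⟩, ⟨i, j⟩, ⟨k, l⟩⟩ h <;> simp at h ⊢ <;> grind

/-- The factor n + 1 is the sum of the three indices. In each of the resulting sums the index
serving as weight is lowered by one; the terms where it is zero drop out. -/
theorem succ_nsmul_sum_antidiagonal_triple (n : ℕ) (f : ℕ → ℕ → ℕ → M) :
    (n + 1) • ∑ p ∈ antidiagonal (n + 1), ∑ q ∈ antidiagonal p.2, f p.1 q.1 q.2 =
      ∑ p ∈ antidiagonal n, ∑ q ∈ antidiagonal p.2, ((q.1 + 1) • f p.1 (q.1 + 1) q.2 +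
        (q.2 + 1) • f p.1 q.1 (q.2 + 1) + (p.1 + 1) • f (p.1 + 1) q.1 q.2) := by
  have h2 : ∀ (n : ℕ) (g : ℕ → ℕ → M), (n + 1) • ∑ q ∈ antidiagonal (n + 1), g q.1 q.2 =
      ∑ q ∈ antidiagonal n, ((q.1 + 1) • g (q.1 + 1) q.2 + (q.2 + 1) • g q.1 (q.2 + 1)) := by
    intro n g
    rw [smul_sum, sum_add_distrib]
    have e1 := Nat.sum_antidiagonal_succ (n := n) (f := fun q => q.1 • g q.1 q.2)
    have e2 := Nat.sum_antidiagonal_succ' (n := n) (f := fun q => q.2 • g q.1 q.2)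
    simp only [zero_smul, zero_add] at e1 e2
    rw [← e1, ← e2, ← sum_add_distrib]
    refine sum_congr rfl fun q hq => ?_
    rw [← add_smul, mem_antidiagonal.1 hq]
  have h3 := h2 n fun i m => ∑ q ∈ antidiagonal m, f i q.1 q.2
  rw [h3]
  refine sum_congr rfl fun p _ => ?_
  rw [h2 p.2 (fun a b => f p.1 a b), smul_sum, add_comm, ← sum_add_distrib]

end Sums

variable {R : Type*} [CommRing R] [Algebra ℂ R]

/-- The coefficientwise action of a linear map on power series. -/
noncomputable def coeffMap (T : R →ₗ[ℂ] R) : R⟦X⟧ →ₗ[ℂ] R⟦X⟧ where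
  toFun A := mk fun n => T (coeff n A)
  map_add' A B := by ext n; simp
  map_smul' c A := by ext n; simp

@[simp]
theorem coeff_coeffMap (T : R →ₗ[ℂ] R) (n : ℕ) (A : R⟦X⟧) :
    coeff n (coeffMap T A) = T (coeff n A) := by simp [coeffMap]

/-- The exponential `exp(ħ D)` on power series in `ħ`. -/
noncomputable def expOp (D : Module.End ℂ R) : R⟦X⟧ →ₗ[ℂ] R⟦X⟧ where
  toFun a := mk fun n => ∑ p ∈ antidiagonal n, ((p.1.factorial : ℂ)⁻¹) • (D ^ p.1) (coeff p.2 a)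
  map_add' a b := by ext n; simp [sum_add_distrib]
  map_smul' c a := by ext n; simp [smul_sum, smul_comm c]

theorem coeff_expOp (D : Module.End ℂ R) (n : ℕ) (a : R⟦X⟧) : coeff n (expOp D a) =
    ∑ p ∈ antidiagonal n, ((p.1.factorial : ℂ)⁻¹) • (D ^ p.1) (coeff p.2 a) := by
  simp [expOp]

theorem expOp_zero (a : R⟦X⟧) : expOp 0 a = a := by
  ext n
  rw [coeff_expOp, sum_eq_single (0, n)]
  · simp
  · rintro ⟨i, j⟩ h hne
    have : i ≠ 0 := by
      rintro rfl
      simp at h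
      simp [h] at hne
    simp [this]
  · simp

theorem inv_factorial_smul_add_pow {D E : Module.End ℂ R} (h : Commute D E) (n : ℕ) (x : R) :
    ((n.factorial : ℂ)⁻¹) • ((D + E) ^ n) x = ∑ p ∈ antidiagonal n,
      ((p.1.factorial : ℂ)⁻¹) • (D ^ p.1) (((p.2.factorial : ℂ)⁻¹) • (E ^ p.2) x) := by
  rw [h.add_pow', LinearMap.sum_apply, smul_sum]
  refine sum_congr rfl fun p hp => ?_
  have hn := mem_antidiagonal.1 hp
  subst hn
  rw [LinearMap.map_smul, smul_smul, LinearMap.smul_apply, ← Nat.cast_smul_eq_nsmul ℂ, smul_smul,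
    Module.End.mul_apply]
  congr 1
  rw [Nat.cast_add_choose]
  have h1 : ((p.1 + p.2).factorial : ℂ) ≠ 0 := by exact_mod_cast Nat.factorial_ne_zero _
  have h2 : (p.1.factorial : ℂ) ≠ 0 := by exact_mod_cast Nat.factorial_ne_zero _
  have h3 : (p.2.factorial : ℂ) ≠ 0 := by exact_mod_cast Nat.factorial_ne_zero _
  field_simp

theorem expOp_expOp {D E : Module.End ℂ R} (h : Commute D E) (a : R⟦X⟧) :
    expOp D (expOp E a) = expOp (D + E) a := by
  ext n
  simp only [coeff_expOp, map_sum, smul_sum, inv_factorial_smul_add_pow h]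
  exact (sum_antidiagonal_assoc n fun i j l => ((i.factorial : ℂ)⁻¹) •
    (D ^ i) (((j.factorial : ℂ)⁻¹) • (E ^ j) (coeff l a))).symm

theorem expOp_neg_expOp (D : Module.End ℂ R) (a : R⟦X⟧) : expOp (-D) (expOp D a) = a := by
  rw [expOp_expOp (Commute.neg_left (Commute.refl D)), neg_add_cancel, expOp_zero]

theorem expOp_expOp_neg (D : Module.End ℂ R) (a : R⟦X⟧) : expOp D (expOp (-D) a) = a := by
  rw [expOp_expOp (Commute.neg_right (Commute.refl D)), add_neg_cancel, expOp_zero]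

theorem expOp_one {D : Module.End ℂ R} (h : D 1 = 0) : expOp D (1 : R⟦X⟧) = 1 := by
  ext n
  rw [coeff_expOp, sum_eq_single (0, n)]
  · simp
  · rintro ⟨i, j⟩ hij hne
    have hi : i ≠ 0 := by
      rintro rfl
      simp at hij
      simp [hij] at hne
    obtain ⟨i, rfl⟩ := Nat.exists_eq_succ_of_ne_zero hi
    simp only [coeff_one, Nat.succ_eq_add_one, pow_succ, Module.End.mul_apply]
    split_ifs <;> simp [h]
  · simp

theorem coeffMap_expOp {D E : Module.End ℂ R} (h : Commute D E) (a : R⟦X⟧) :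
    coeffMap D (expOp E a) = expOp E (coeffMap D a) := by
  ext n
  simp only [coeff_coeffMap, coeff_expOp, map_sum, map_smul]
  refine sum_congr rfl fun p _ => ?_
  rw [← Module.End.mul_apply, (h.pow_right p.1).eq, Module.End.mul_apply]

/-- `∑_j ħ^j / j! · c_j(a, b)`. -/
noncomputable def hbarBil (c : ℕ → R →ₗ[ℂ] R →ₗ[ℂ] R) (a b : R⟦X⟧) : R⟦X⟧ :=
  mk fun k => ∑ p ∈ antidiagonal k, ∑ q ∈ antidiagonal p.2,
    ((p.1.factorial : ℂ)⁻¹) • c p.1 (coeff q.1 a) (coeff q.2 b)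

/-- The power series `∑_n g^n ∑_{i + j = n} f(A_i, B_j)`. -/
noncomputable def conv (f : R → R → R) (A B : R⟦X⟧) : R⟦X⟧ :=
  mk fun n => ∑ p ∈ antidiagonal n, f (coeff p.1 A) (coeff p.2 B)

theorem conv_map {f : R → R → R} {T : R →ₗ[ℂ] R} (h : ∀ a b, f (T a) (T b) = T (a * b))
    (A B : R⟦X⟧) : conv f (coeffMap T A) (coeffMap T B) = coeffMap T (A * B) := by
  ext n
  simp [conv, h, coeff_mul]

section Contract

variable {c : ℕ → R →ₗ[ℂ] R →ₗ[ℂ] R} {D : Module.End ℂ R}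

/-- A trinomial Leibniz rule: every application of D acts on x, acts on y or adds a contraction, and
the order of these choices does not matter. -/
theorem inv_factorial_pow_mul (h0 : ∀ x y, c 0 x y = x * y)
    (hD : ∀ j x y, D (c j x y) = c j (D x) y + c j x (D y) + c (j + 1) x y) (n : ℕ) (x y : R) :
    ((n.factorial : ℂ)⁻¹) • (D ^ n) (x * y) = ∑ p ∈ antidiagonal n, ∑ q ∈ antidiagonal p.2,
      ((p.1.factorial : ℂ)⁻¹ * (q.1.factorial : ℂ)⁻¹ * (q.2.factorial : ℂ)⁻¹) •
        c p.1 ((D ^ q.1) x) ((D ^ q.2) y) := by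
  induction n with
  | zero => simp [h0]
  | succ n ih =>
    have hn : ((n : ℂ) + 1) ≠ 0 := by exact_mod_cast n.succ_ne_zero
    have hf : ∀ m : ℕ, (m + 1 : ℂ) * (((m + 1).factorial : ℂ)⁻¹) = (m.factorial : ℂ)⁻¹ := by
      intro m
      have hm : ((m : ℂ) + 1) ≠ 0 := by exact_mod_cast m.succ_ne_zero
      rw [Nat.factorial_succ]
      push_cast
      rw [mul_inv, mul_inv_cancel_left₀ hm]
    have key := succ_nsmul_sum_antidiagonal_triple n fun j r s =>
      ((j.factorial : ℂ)⁻¹ * (r.factorial : ℂ)⁻¹ * (s.factorial : ℂ)⁻¹) •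
        c j ((D ^ r) x) ((D ^ s) y)
    rw [← Nat.cast_smul_eq_nsmul ℂ] at key
    -- Multiplying by n + 1 turns the inverse factorial of n + 1 into that of n on the left and
    -- distributes over the three kinds of steps on the right.
    refine smul_right_injective R hn (Eq.trans ?_ (key.symm.trans (by push_cast; rfl)))
    simp only
    rw [smul_smul, hf, pow_succ', Module.End.mul_apply, ← map_smul, ih, map_sum]
    refine sum_congr rfl fun p _ => ?_
    rw [map_sum]
    refine sum_congr rfl fun q _ => ?_
    rw [map_smul, hD, smul_add, smul_add]
    simp only [← Nat.cast_smul_eq_nsmul ℂ, smul_smul, Nat.cast_add, Nat.cast_one]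
    have hp : ∀ m z, D ((D ^ m) z) = (D ^ (m + 1)) z := fun m z => by
      rw [pow_succ', Module.End.mul_apply]
    rw [hp, hp]
    refine congrArg₂ _ (congrArg₂ _ ?_ ?_) ?_
    · rw [← hf q.1]; congr 1; ring
    · rw [← hf q.2]; congr 1; ring
    · rw [← hf p.1]; congr 1; ring

/-- Generating function of the trinomial rule: exp(ħD) is multiplicative from the pointwise product
to the star product. -/
theorem hbarBil_expOp (h0 : ∀ x y, c 0 x y = x * y)
    (hD : ∀ j x y, D (c j x y) = c j (D x) y + c j x (D y) + c (j + 1) x y) (a b : R⟦X⟧) :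
    hbarBil c (expOp D a) (expOp D b) = expOp D (a * b) := by
  ext n
  simp only [hbarBil, coeff_mk, coeff_expOp, coeff_mul, map_sum, LinearMap.sum_apply, smul_sum,
    map_smul, LinearMap.smul_apply, inv_factorial_pow_mul h0 hD]
  rw [sum_antidiagonal_quintuple n fun j r s e f =>
    ((j.factorial : ℂ)⁻¹ * (r.factorial : ℂ)⁻¹ * (s.factorial : ℂ)⁻¹) •
        c j ((D ^ r) (coeff e a)) ((D ^ s) (coeff f b))]
  refine sum_congr rfl fun p _ => sum_congr rfl fun q _ => ?_
  rw [sum_comm]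
  refine sum_congr rfl fun v _ => sum_congr rfl fun w _ => ?_
  rw [smul_smul, smul_smul]
  congr 1
  ring

/-- An additional line with another propagator measures the failure of its operator D' to be a
derivation of the star product. -/
theorem hbarBil_succ {c' : ℕ → R →ₗ[ℂ] R →ₗ[ℂ] R} {D' : Module.End ℂ R}
    (hD' : ∀ j x y, D' (c j x y) = c j (D' x) y + c j x (D' y) + c' j x y) (a b : R⟦X⟧) :
    hbarBil c' a b = coeffMap D' (hbarBil c a b) - hbarBil c (coeffMap D' a) b -
      hbarBil c a (coeffMap D' b) := by
  ext n
  simp only [hbarBil, map_sub, coeff_coeffMap, coeff_mk, map_sum, map_smul, hD',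
    ← sum_sub_distrib]
  refine sum_congr rfl fun p _ => sum_congr rfl fun q _ => ?_
  rw [← smul_sub, ← smul_sub]
  congr 1
  abel

end Contract

end Algebra

end FlowEquation
namespace FlowEquation

/-! ### Exponential and logarithm of power series; second order operators. -/

section ExpLog

open Finset PowerSeries

variable {B : Type*} [CommRing B] [Algebra ℂ B]

theorem coeff_pow_eq_zero {B : Type*} [CommRing B] {Y : B⟦X⟧} (hY : coeff 0 Y = 0) {n N : ℕ} (h : N < n) :
    coeff N (Y ^ n) = 0 := by
  have h1 : X ∣ Y := X_dvd_iff.2 (by simpa using hY)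
  exact X_pow_dvd_iff.1 (pow_dvd_pow_of_dvd h1 n) N h

/-- The truncated exponential `∑_{n < M} Y^n / n!`. -/
noncomputable def expPartial (M : ℕ) (Y : B⟦X⟧) : B⟦X⟧ :=
  ∑ n ∈ range M, ((n.factorial : ℂ)⁻¹) • Y ^ n

/-- The exponential of a power series without constant coefficient. -/
noncomputable def expSeries (Y : B⟦X⟧) : B⟦X⟧ :=
  mk fun N => ∑ n ∈ range (N + 1), ((n.factorial : ℂ)⁻¹) • coeff N (Y ^ n)

/-- As Y has no constant term, Y^n starts at order n. Identities for the exponential can thus be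
checked on finite sums, with a truncation chosen for each coefficient. -/
theorem coeff_expPartial {Y : B⟦X⟧} (hY : coeff 0 Y = 0) {N M : ℕ} (h : N < M) :
    coeff N (expPartial M Y) = coeff N (expSeries Y) := by
  simp only [expPartial, expSeries, coeff_mk, map_sum, coeff_smul]
  refine (sum_subset (range_subset_range.2 h) fun n _ hn => ?_).symm
  rw [coeff_pow_eq_zero hY (by simpa using hn), smul_zero]

theorem coeff_expPartial_mul {Y : B⟦X⟧} (hY : coeff 0 Y = 0) (Z : B⟦X⟧) {N M : ℕ} (h : N < M) :
    coeff N (expPartial M Y * Z) = coeff N (expSeries Y * Z) := by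
  rw [coeff_mul, coeff_mul]
  refine sum_congr rfl fun p hp => ?_
  rw [coeff_expPartial hY]
  have := mem_antidiagonal.1 hp
  omega

theorem coeff_zero_expSeries (Y : B⟦X⟧) : coeff 0 (expSeries Y) = 1 := by
  simp [expSeries]

theorem inv_factorial_succ_mul (n : ℕ) :
    (((n + 1).factorial : ℂ)⁻¹) * ((n : ℂ) + 1) = (n.factorial : ℂ)⁻¹ := by
  have hm : ((n : ℂ) + 1) ≠ 0 := by exact_mod_cast n.succ_ne_zero
  rw [Nat.factorial_succ]
  push_cast
  field_simp

theorem sum_deriv_pow (Y z : B⟦X⟧) (M : ℕ) :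
    ∑ n ∈ range (M + 1), ((n.factorial : ℂ)⁻¹) • ((n : ℂ) • (Y ^ (n - 1) * z)) =
      expPartial M Y * z := by
  rw [sum_range_succ', expPartial, sum_mul]
  simp only [Nat.cast_zero, zero_smul, smul_zero, add_zero, Nat.add_sub_cancel, smul_smul,
    Nat.cast_add, Nat.cast_one, inv_factorial_succ_mul, smul_mul_assoc]

theorem derivative_expSeries {Y : B⟦X⟧} (hY : coeff 0 Y = 0) :
    d⁄dX B (expSeries Y) = expSeries Y * d⁄dX B Y := by
  ext N
  rw [coeff_derivative, ← coeff_expPartial hY (Nat.lt_succ_self (N + 1)), ← coeff_derivative,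
    ← coeff_expPartial_mul hY _ (Nat.lt_succ_self N), ← sum_deriv_pow]
  congr 1
  have : ∀ (c : ℂ) (W : B⟦X⟧), d⁄dX B (c • W) = c • d⁄dX B W := fun c W => by
    ext n
    simp [coeff_derivative]
  rw [expPartial, map_sum]
  refine sum_congr rfl fun n _ => ?_
  rw [this, Derivation.leibniz_pow, smul_eq_mul, ← Nat.cast_smul_eq_nsmul ℂ]

theorem derivative_ext_complex {f g : B⟦X⟧} (h : d⁄dX B f = d⁄dX B g)
    (h0 : coeff 0 f = coeff 0 g) : f = g := by
  ext n
  cases n with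
  | zero => exact h0
  | succ n =>
    have h1 := congrArg (coeff n) h
    rw [coeff_derivative, coeff_derivative] at h1
    have hn : ((n : ℂ) + 1) ≠ 0 := by exact_mod_cast n.succ_ne_zero
    refine smul_right_injective B hn ?_
    simpa [Algebra.smul_def, mul_comm] using h1

/-- The logarithm of a power series with constant coefficient `1`. -/
noncomputable def logSeries (W : B⟦X⟧) : B⟦X⟧ :=
  -- Formal integration of W'/W. In degree zero the convention 0⁻¹ = 0 makes the constant
  -- coefficient vanish.
  mk fun n => ((n : ℂ)⁻¹) • coeff (n - 1) (d⁄dX B W * invOfUnit W 1)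

theorem coeff_zero_logSeries (W : B⟦X⟧) : coeff 0 (logSeries W) = 0 := by
  simp [logSeries]

theorem derivative_logSeries (W : B⟦X⟧) :
    d⁄dX B (logSeries W) = d⁄dX B W * invOfUnit W 1 := by
  ext n
  have hn : ((n : ℂ) + 1) ≠ 0 := by exact_mod_cast n.succ_ne_zero
  rw [coeff_derivative, logSeries, coeff_mk, Nat.add_sub_cancel, smul_mul_assoc]
  have : ((n : B) + 1) = algebraMap ℂ B ((n : ℂ) + 1) := by simp
  rw [this, mul_comm, ← Algebra.smul_def, smul_smul]
  push_cast
  rw [inv_mul_cancel₀ hn, one_smul]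

theorem mul_invOfUnit_one {B : Type*} [CommRing B] {W : B⟦X⟧} (h : coeff 0 W = 1) : W * invOfUnit W 1 = 1 :=
  mul_invOfUnit W 1 (by simpa using h)

/-- Uniqueness for a linear differential equation: the quotient W/Z has zero derivative and constant
coefficient 1. -/
theorem eq_of_derivative_eq_mul {W Z A : B⟦X⟧} (hW : d⁄dX B W = W * A) (hZ : d⁄dX B Z = Z * A)
    (hW0 : coeff 0 W = 1) (hZ0 : coeff 0 Z = 1) : W = Z := by
  have h : W * invOfUnit Z 1 = 1 := by
    refine derivative_ext_complex ?_ ?_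
    · have h1 := congrArg (d⁄dX B) (mul_invOfUnit_one hZ0)
      rw [Derivation.leibniz, hZ, smul_eq_mul, smul_eq_mul] at h1
      have h2 : d⁄dX B (invOfUnit Z 1) = - (A * invOfUnit Z 1) := by
        have h3 := congrArg (invOfUnit Z 1 * ·) h1
        have h4 := mul_invOfUnit_one hZ0
        simp only [Derivation.map_one_eq_zero, mul_zero] at h3
        linear_combination h3 - (d⁄dX B (invOfUnit Z 1) + A * invOfUnit Z 1) * h4
      rw [Derivation.leibniz, hW, h2, smul_eq_mul, smul_eq_mul]
      simp
      ring
    · simp [coeff_mul, hW0]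
  calc W = W * invOfUnit Z 1 * Z := by
        rw [mul_assoc, mul_comm _ Z, mul_invOfUnit_one hZ0, mul_one]
    _ = Z := by rw [h, one_mul]

theorem expSeries_logSeries {W : B⟦X⟧} (hW : coeff 0 W = 1) : expSeries (logSeries W) = W := by
  refine eq_of_derivative_eq_mul (derivative_expSeries (coeff_zero_logSeries W)) ?_
    (coeff_zero_expSeries _) hW
  rw [derivative_logSeries, mul_left_comm, mul_invOfUnit_one hW, mul_one]

theorem expSeries_injective {Y Z : B⟦X⟧} (hY : coeff 0 Y = 0) (hZ : coeff 0 Z = 0)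
    (h : expSeries Y = expSeries Z) : Y = Z := by
  refine derivative_ext_complex ?_ (hY.trans hZ.symm)
  have h1 := derivative_expSeries hY
  rw [h, derivative_expSeries hZ] at h1
  have h2 := mul_invOfUnit_one (coeff_zero_expSeries Z)
  have h3 := congrArg (invOfUnit (expSeries Z) 1 * ·) h1
  linear_combination (d⁄dX B Z - d⁄dX B Y) * h2 - h3

/-- The deviation of a linear operator from being a derivation. -/
def carre (D : B →ₗ[ℂ] B) (a b : B) : B := D (a * b) - D a * b - a * D b

/-- Differential operators of second order without constant term. -/
structure IsSecondOrder (D : B →ₗ[ℂ] B) : Prop where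
  map_one : D 1 = 0
  carre_mul : ∀ a b c, carre D (a * b) c = a * carre D b c + b * carre D a c

theorem carre_comm (D : B →ₗ[ℂ] B) (a b : B) : carre D a b = carre D b a := by
  simp only [carre, mul_comm a b]
  ring

theorem coeff_carre_coeffMap (D : B →ₗ[ℂ] B) (W Z : B⟦X⟧) (n : ℕ) :
    coeff n (carre (coeffMap D) W Z) =
      ∑ p ∈ antidiagonal n, carre D (coeff p.1 W) (coeff p.2 Z) := by
  simp only [carre, map_sub, coeff_mul, coeff_coeffMap, map_sum, sum_sub_distrib]

theorem carre_sum_left (D : B →ₗ[ℂ] B) {ι : Type*} (s : Finset ι) (f : ι → B) (b : B) :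
    carre D (∑ i ∈ s, f i) b = ∑ i ∈ s, carre D (f i) b := by
  simp only [carre, sum_mul, map_sum, sum_sub_distrib]

theorem IsSecondOrder.coeffMap {D : B →ₗ[ℂ] B} (h : IsSecondOrder D) :
    IsSecondOrder (coeffMap D) where
  map_one := by
    ext n
    rw [coeff_coeffMap, coeff_one]
    split_ifs <;> simp [h.map_one]
  carre_mul W Z Q := by
    ext n
    rw [map_add, coeff_mul, coeff_mul, coeff_carre_coeffMap]
    simp only [coeff_carre_coeffMap, coeff_mul, carre_sum_left, h.carre_mul, sum_add_distrib,
      mul_sum]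
    rw [sum_antidiagonal_assoc n fun i j l =>
        coeff i W * carre D (coeff j Z) (coeff l Q),
      sum_antidiagonal_swap_fst n fun i j l =>
        coeff j Z * carre D (coeff i W) (coeff l Q)]

theorem IsSecondOrder.carre_one {D : B →ₗ[ℂ] B} (h : IsSecondOrder D) (a : B) :
    carre D a 1 = 0 := by
  simp [carre, h.map_one]

theorem IsSecondOrder.carre_pow {D : B →ₗ[ℂ] B} (h : IsSecondOrder D) (a b : B) (n : ℕ) :
    carre D (a ^ n) b = (n : ℂ) • (a ^ (n - 1) * carre D a b) := by
  induction n with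
  | zero =>
    rw [pow_zero, carre_comm, h.carre_one]
    simp
  | succ n ih =>
    rw [pow_succ, h.carre_mul, ih]
    cases n with
    | zero => simp
    | succ n =>
      simp only [Nat.add_sub_cancel, Algebra.smul_def]
      push_cast
      ring

/-- A second order operator acts on one factor of a^n, or on a pair of factors through `carre`. -/
theorem IsSecondOrder.apply_pow {D : B →ₗ[ℂ] B} (h : IsSecondOrder D) (a : B) (n : ℕ) :
    D (a ^ n) = (n : ℂ) • (a ^ (n - 1) * D a) +
      (n * (n - 1 : ℂ) / 2) • (a ^ (n - 2) * carre D a a) := by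
  induction n with
  | zero => simp [h.map_one]
  | succ n ih =>
    have h1 : D (a ^ (n + 1)) = carre D (a ^ n) a + D (a ^ n) * a + a ^ n * D a := by
      rw [carre, pow_succ]
      ring
    rw [h1, h.carre_pow, ih]
    -- The small exponents are separate because n - 1 and n - 2 are truncated subtractions.
    rcases n with _ | _ | n
    · simp
    · have : ((((0 : ℕ) + 1 : ℕ) + 1 : ℕ) : ℂ) * ((((0 : ℕ) + 1 : ℕ) + 1 : ℕ) - 1 : ℂ) / 2 = 1 := by
        norm_num
      simp [Algebra.smul_def]
      rw [map_ofNat]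
      ring
    · simp only [Nat.add_sub_cancel, Algebra.smul_def,
        show n + 1 + 1 - 2 = n by omega, show n + 1 + 1 + 1 - 2 = n + 1 by omega]
      have e : ((n + 1 + 1 + 1 : ℕ) : ℂ) * ((n + 1 + 1 + 1 : ℕ) - 1 : ℂ) / 2 =
          ((n + 1 + 1 : ℕ) : ℂ) * ((n + 1 + 1 : ℕ) - 1 : ℂ) / 2 + ((n : ℂ) + 2) := by
        push_cast
        ring
      rw [e]
      push_cast
      simp only [map_ofNat]
      ring

/-- Chain rule for the exponential, summed from the formula for powers; the quadratic term is the
source of the nonlinearity of the flow. -/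
theorem IsSecondOrder.apply_expSeries {D : B →ₗ[ℂ] B} (h : IsSecondOrder D) {Y : B⟦X⟧}
    (hY : coeff 0 Y = 0) :
    FlowEquation.coeffMap D (expSeries Y) = expSeries Y * (FlowEquation.coeffMap D Y +
      (1 / 2 : ℂ) • carre (FlowEquation.coeffMap D) Y Y) := by
  ext N
  -- The terms n = 0, 1 carry the factor n(n - 1) = 0. Of N + 3 terms, N + 1 survive after the shift
  -- by two, enough for the coefficient of order N.
  have hs : ∑ n ∈ range (N + 3), ((n.factorial : ℂ)⁻¹) • ((n * (n - 1 : ℂ) / 2) •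
      (Y ^ (n - 2) * carre (FlowEquation.coeffMap D) Y Y)) =
      expPartial (N + 1) Y * ((1 / 2 : ℂ) • carre (FlowEquation.coeffMap D) Y Y) := by
    rw [sum_range_succ', sum_range_succ', expPartial, sum_mul]
    simp only [smul_smul]
    have e : ∀ n : ℕ, (((n + 1 + 1).factorial : ℂ)⁻¹) *
        (((n + 1 + 1 : ℕ) : ℂ) * (((n + 1 + 1 : ℕ) : ℂ) - 1) / 2) =
        (n.factorial : ℂ)⁻¹ * (1 / 2) := fun n => by
      rw [← inv_factorial_succ_mul n, ← inv_factorial_succ_mul (n + 1)]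
      push_cast
      ring
    simp only [e]
    simp [smul_smul, mul_comm]
  rw [coeff_coeffMap, ← coeff_expPartial hY (show N < N + 3 by omega), ← coeff_coeffMap, mul_add,
    map_add, ← coeff_expPartial_mul hY _ (show N < N + 2 by omega),
    ← coeff_expPartial_mul hY _ (show N < N + 1 by omega), ← hs, ← sum_deriv_pow, ← map_add,
    ← sum_add_distrib, expPartial, map_sum]
  congr 1
  refine sum_congr rfl fun n _ => ?_
  rw [map_smul, h.coeffMap.apply_pow, smul_add]

end ExpLog

end FlowEquation
namespace FlowEquation

/-! ### Abstract derivatives of curves and the algebraic flow equation. -/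

section DerivClasses

open Finset PowerSeries

variable {B : Type*} [CommRing B] [Algebra ℂ B]

/-- A notion of differentiability at `t₀` of curves in an algebra, `P F F'` meaning that `F` has
the derivative `F'`. -/
structure IsDerivClass (t₀ : ℝ) (P : (ℝ → B) → B → Prop) : Prop where
  const : ∀ a, P (fun _ => a) 0
  add : ∀ {F F' G G'}, P F F' → P G G' → P (fun t => F t + G t) (F' + G')
  smul : ∀ (c : ℂ) {F F'}, P F F' → P (fun t => c • F t) (c • F')
  mul : ∀ {F F' G G'}, P F F' → P G G' → P (fun t => F t * G t) (F' * G t₀ + F t₀ * G')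
  unique : ∀ {F F' F''}, P F F' → P F F'' → F' = F''

/-- Coefficientwise differentiability of curves of power series. -/
def CoeffDeriv (P : (ℝ → B) → B → Prop) (F : ℝ → B⟦X⟧) (F' : B⟦X⟧) : Prop :=
  ∀ n, P (fun t => coeff n (F t)) (coeff n F')

namespace IsDerivClass

variable {t₀ : ℝ} {P : (ℝ → B) → B → Prop}

theorem sum (hP : IsDerivClass t₀ P) {ι : Type*} (s : Finset ι) {F : ι → ℝ → B} {F' : ι → B}
    (h : ∀ i ∈ s, P (F i) (F' i)) : P (fun t => ∑ i ∈ s, F i t) (∑ i ∈ s, F' i) := by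
  classical
  induction s using Finset.induction_on with
  | empty => simpa using hP.const 0
  | insert i s hi ih =>
    simp only [sum_insert hi]
    exact hP.add (h i (mem_insert_self i s)) (ih fun j hj => h j (mem_insert_of_mem hj))

theorem neg (hP : IsDerivClass t₀ P) {F : ℝ → B} {F' : B} (h : P F F') :
    P (fun t => -F t) (-F') := by
  simpa using hP.smul (-1) h

theorem pow (hP : IsDerivClass t₀ P) {F : ℝ → B} {F' : B} (h : P F F') (n : ℕ) :
    P (fun t => F t ^ n) ((n : ℂ) • (F t₀ ^ (n - 1) * F')) := by
  induction n with
  | zero => simpa using hP.const 1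
  | succ n ih =>
    have h1 := hP.mul ih h
    simp only [← pow_succ] at h1
    convert h1 using 1
    cases n with
    | zero => simp
    | succ n =>
      simp only [Nat.add_sub_cancel, Algebra.smul_def]
      push_cast
      ring

theorem coeffDeriv (hP : IsDerivClass t₀ P) : IsDerivClass t₀ (CoeffDeriv P) where
  const a n := by simpa using hP.const (coeff n a)
  add hF hG n := by simpa using hP.add (hF n) (hG n)
  smul c _ _ hF n := by simpa using hP.smul c (hF n)
  mul {F F' G G'} hF hG n := by
    have h := hP.sum (antidiagonal n) fun p _ => hP.mul (hF p.1) (hG p.2)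
    simpa only [coeff_mul, map_add, sum_add_distrib] using h
  unique hF hF' := by
    ext n
    exact hP.unique (hF n) (hF' n)

/-- The coefficients of the inverse are polynomials in those of W and in earlier coefficients. Only
existence of the derivative is needed. -/
theorem exists_invOfUnit (hP : IsDerivClass t₀ P) {W : ℝ → B⟦X⟧} {W' : B⟦X⟧}
    (hW : CoeffDeriv P W W') : ∃ Z', CoeffDeriv P (fun t => invOfUnit (W t) 1) Z' := by
  have h : ∀ n, ∃ z, P (fun t => coeff n (invOfUnit (W t) 1)) z := by
    intro n
    induction n using Nat.strong_induction_on with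
    | _ n ih =>
      rcases Nat.eq_zero_or_pos n with rfl | hn
      · have e : (fun t => coeff 0 (invOfUnit (W t) 1)) = fun _ => (1 : B) := by
          ext t
          rw [coeff_invOfUnit, if_pos rfl]
          simp
        rw [e]
        exact ⟨_, hP.const _⟩
      · choose! z hz using ih
        have e : (fun t => coeff n (invOfUnit (W t) 1)) = fun t => -∑ p ∈ antidiagonal n,
            if p.2 < n then coeff p.1 (W t) * coeff p.2 (invOfUnit (W t) 1) else 0 := by
          ext t
          rw [coeff_invOfUnit, if_neg hn.ne']
          simp
        rw [e]
        refine ⟨_, hP.neg (hP.sum _ (F' := fun p => if p.2 < n then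
          coeff p.1 W' * coeff p.2 (invOfUnit (W t₀) 1) + coeff p.1 (W t₀) * z p.2 else 0)
          fun p _ => ?_)⟩
        split_ifs with hp
        · exact hP.mul (hW p.1) (hz p.2 hp)
        · exact hP.const 0
  choose z hz using h
  exact ⟨PowerSeries.mk z, fun n => by simpa using hz n⟩

/-- The value of the derivative is recovered in `IsDerivClass.flow` from exp(log W) = W. -/
theorem exists_logSeries (hP : IsDerivClass t₀ P) {W : ℝ → B⟦X⟧} {W' : B⟦X⟧}
    (hW : CoeffDeriv P W W') : ∃ Y', CoeffDeriv P (fun t => logSeries (W t)) Y' := by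
  obtain ⟨Z', hZ⟩ := hP.exists_invOfUnit hW
  have hd : CoeffDeriv P (fun t => d⁄dX B (W t)) (d⁄dX B W') := by
    intro n
    have := hP.smul ((n : ℂ) + 1) (hW (n + 1))
    simpa [coeff_derivative, Algebra.smul_def, mul_comm] using this
  have h := hP.coeffDeriv.mul hd hZ
  refine ⟨PowerSeries.mk fun n => ((n : ℂ)⁻¹) • coeff (n - 1) (d⁄dX B W' * invOfUnit (W t₀) 1 +
    d⁄dX B (W t₀) * Z'), fun n => ?_⟩
  simpa only [logSeries, coeff_mk] using hP.smul ((n : ℂ)⁻¹) (h (n - 1))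

theorem expSeries (hP : IsDerivClass t₀ P) {Y : ℝ → B⟦X⟧} {Y' : B⟦X⟧}
    (hY : CoeffDeriv P Y Y') (h0 : ∀ t, coeff 0 (Y t) = 0) :
    CoeffDeriv P (fun t => expSeries (Y t)) (expSeries (Y t₀) * Y') := by
  intro N
  have h := hP.coeffDeriv.sum (range (N + 2)) fun n _ =>
    hP.coeffDeriv.smul ((n.factorial : ℂ)⁻¹) (hP.coeffDeriv.pow hY n)
  rw [sum_deriv_pow] at h
  have h1 := h N
  rw [coeff_expPartial_mul (h0 t₀) _ (Nat.lt_succ_self N)] at h1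
  convert h1 using 2 with t
  exact (coeff_expPartial (h0 t) (show N < N + 2 by omega)).symm

section Exp

variable {D : ℝ → Module.End ℂ B} {D' : Module.End ℂ B}

/-- Because D' commutes with D at t₀, the n terms of the product rule for D^n coincide. -/
theorem pow_apply
    (hD : ∀ {F F'}, P F F' → P (fun t => D t (F t)) (D t₀ F' + D' (F t₀)))
    (hc : Commute D' (D t₀)) {F : ℝ → B} {F' : B} (hF : P F F') (n : ℕ) :
    P (fun t => (D t ^ n) (F t))
      ((D t₀ ^ n) F' + (n : ℂ) • (D t₀ ^ (n - 1)) (D' (F t₀))) := by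
  induction n with
  | zero => simpa using hF
  | succ n ih =>
    have h := hD ih
    simp only [← Module.End.mul_apply, ← pow_succ'] at h
    convert h using 1
    have e : D' ((D t₀ ^ n) (F t₀)) = (D t₀ ^ n) (D' (F t₀)) := by
      rw [← Module.End.mul_apply, (hc.pow_right n).eq, Module.End.mul_apply]
    rw [map_add, map_smul, ← Module.End.mul_apply, ← Module.End.mul_apply, ← pow_succ',
      Module.End.mul_apply D', e, add_assoc]
    congr 1
    cases n with
    | zero => simp
    | succ n =>
      have e2 : (D t₀) ((D t₀ ^ n * D') (F t₀)) = (D t₀ ^ (n + 1)) (D' (F t₀)) := by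
        rw [Module.End.mul_apply, pow_succ', Module.End.mul_apply]
      simp only [Nat.add_sub_cancel]
      rw [e2, Module.End.mul_apply]
      push_cast
      simp only [add_smul, one_smul]

/-- The factor n from D^n cancels against n!, and the index shift by one appears as the factor X,
that is, ħ. -/
theorem expOp (hP : IsDerivClass t₀ P)
    (hD : ∀ {F F'}, P F F' → P (fun t => D t (F t)) (D t₀ F' + D' (F t₀)))
    (hc : Commute D' (D t₀)) {a : ℝ → B⟦X⟧} {a' : B⟦X⟧} (ha : CoeffDeriv P a a') :
    CoeffDeriv P (fun t => expOp (D t) (a t))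
      (expOp (D t₀) a' + X * expOp (D t₀) (coeffMap D' (a t₀))) := by
  intro n
  have h := hP.sum (antidiagonal n) fun p _ =>
    hP.smul ((p.1.factorial : ℂ)⁻¹) (pow_apply hD hc (ha p.2) p.1)
  simp only [coeff_expOp]
  convert h using 1
  simp only [map_add, smul_add, sum_add_distrib, coeff_expOp]
  congr 1
  cases n with
  | zero => simp
  | succ n =>
    rw [coeff_succ_X_mul, Nat.sum_antidiagonal_succ, coeff_expOp]
    simp only [Nat.cast_zero, zero_smul, smul_zero, zero_add, Nat.add_sub_cancel, smul_smul,
      Nat.cast_add, Nat.cast_one, inv_factorial_succ_mul, coeff_coeffMap]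

theorem coeffMap_expOp_C_X_mul (D : Module.End ℂ B) (Z : B⟦X⟧⟦X⟧) :
    coeffMap (FlowEquation.expOp D) (C (X : B⟦X⟧) * Z) =
      C (X : B⟦X⟧) * coeffMap (FlowEquation.expOp D) Z := by
  ext n k
  simp only [coeff_coeffMap, coeff_C_mul]
  cases k with
  | zero => simp [FlowEquation.coeff_expOp]
  | succ k =>
    rw [coeff_succ_X_mul, FlowEquation.coeff_expOp, Nat.sum_antidiagonal_succ',
      FlowEquation.coeff_expOp]
    simp [coeff_succ_X_mul]

theorem coeffMap_expOp (hP : IsDerivClass t₀ P)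
    (hD : ∀ {F F'}, P F F' → P (fun t => D t (F t)) (D t₀ F' + D' (F t₀)))
    (hc : Commute D' (D t₀)) {W : ℝ → B⟦X⟧⟦X⟧} {W' : B⟦X⟧⟦X⟧}
    (hW : CoeffDeriv (CoeffDeriv P) W W') :
    CoeffDeriv (CoeffDeriv P) (fun t => coeffMap (FlowEquation.expOp (D t)) (W t))
      (coeffMap (FlowEquation.expOp (D t₀)) W' + C (X : B⟦X⟧) *
        coeffMap (FlowEquation.expOp (D t₀)) (coeffMap (coeffMap D') (W t₀))) := by
  intro n
  simpa [coeff_C_mul] using hP.expOp hD hc (hW n)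

theorem coeffMap_expOp_neg_const (hP : IsDerivClass t₀ P)
    (hD : ∀ {F F'}, P F F' → P (fun t => D t (F t)) (D t₀ F' + D' (F t₀)))
    (hc : Commute D' (D t₀)) (S : B⟦X⟧⟦X⟧) :
    CoeffDeriv (CoeffDeriv P) (fun t => coeffMap (FlowEquation.expOp (-D t)) S)
      (-(C (X : B⟦X⟧) *
        coeffMap (coeffMap D') (coeffMap (FlowEquation.expOp (-D t₀)) S))) := by
  have hD2 : ∀ {F F'}, P F F' → P (fun t => (-D t) (F t)) ((-D t₀) F' + (-D') (F t₀)) := by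
    intro F F' hF
    have := hP.neg (hD hF)
    simpa [neg_add, add_comm] using this
  have h := hP.coeffMap_expOp hD2 (Commute.neg_left (Commute.neg_right hc))
    (hP.coeffDeriv.coeffDeriv.const S)
  convert h using 1
  rw [map_zero, zero_add, ← mul_neg]
  congr 1
  have e : ∀ z : B⟦X⟧, coeffMap (-D') z = -coeffMap D' z := fun z => by
    ext m
    simp
  ext n : 1
  rw [map_neg]
  simp only [coeff_coeffMap]
  rw [e, map_neg, FlowEquation.coeffMap_expOp (Commute.neg_right hc)]

/-- The derivative of `B ⋆ B` with respect to the propagator defining the product. -/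
theorem mul_flow (hP : IsDerivClass t₀ P)
    (hD : ∀ {F F'}, P F F' → P (fun t => D t (F t)) (D t₀ F' + D' (F t₀)))
    (hc : Commute D' (D t₀)) (Y : B⟦X⟧⟦X⟧) :
    CoeffDeriv (CoeffDeriv P)
      (fun t => coeffMap (FlowEquation.expOp (D t))
        (coeffMap (FlowEquation.expOp (-D t)) (coeffMap (FlowEquation.expOp (D t₀)) Y) *
          coeffMap (FlowEquation.expOp (-D t)) (coeffMap (FlowEquation.expOp (D t₀)) Y)))
      (C (X : B⟦X⟧) * coeffMap (FlowEquation.expOp (D t₀)) (carre (coeffMap (coeffMap D')) Y Y)) := by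
  have h1 := hP.coeffMap_expOp_neg_const hD hc (coeffMap (FlowEquation.expOp (D t₀)) Y)
  have h2 := hP.coeffMap_expOp hD hc (hP.coeffDeriv.coeffDeriv.mul h1 h1)
  convert h2 using 1
  have e : coeffMap (FlowEquation.expOp (-D t₀)) (coeffMap (FlowEquation.expOp (D t₀)) Y) = Y := by
    ext n : 1
    simp only [coeff_coeffMap, expOp_neg_expOp]
  -- Under exp(ħD) the two factors contribute -ħ D'(Y) Y and -ħ Y D'(Y), and the outer exponential
  -- contributes ħ D'(Y Y); together this is ħ `carre`.
  rw [e, ← coeffMap_expOp_C_X_mul, ← coeffMap_expOp_C_X_mul, ← map_add]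
  congr 1
  rw [carre]
  ring

/-- The flow equation for `V = exp(ħ D_t) log(exp(-ħ D_t) S)`. -/
theorem flow (hP : IsDerivClass t₀ P)
    (hD : ∀ {F F'}, P F F' → P (fun t => D t (F t)) (D t₀ F' + D' (F t₀)))
    (hc : Commute D' (D t₀)) (h2 : IsSecondOrder D') (h1 : ∀ t, D t 1 = 0) {S : B⟦X⟧⟦X⟧}
    (hS : coeff 0 S = 1) :
    CoeffDeriv (CoeffDeriv P)
      (fun t => coeffMap (FlowEquation.expOp (D t))
        (logSeries (coeffMap (FlowEquation.expOp (-D t)) S)))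
      (-(1 / 2 : ℂ) • (C (X : B⟦X⟧) * coeffMap (FlowEquation.expOp (D t₀))
        (carre (coeffMap (coeffMap D')) (logSeries (coeffMap (FlowEquation.expOp (-D t₀)) S))
          (logSeries (coeffMap (FlowEquation.expOp (-D t₀)) S))))) := by
  have hPP := hP.coeffDeriv.coeffDeriv
  set W : ℝ → B⟦X⟧⟦X⟧ := fun t => coeffMap (FlowEquation.expOp (-D t)) S with hW
  have hW0 : ∀ t, coeff 0 (W t) = 1 := fun t => by
    rw [hW, coeff_coeffMap, hS, expOp_one]
    simp [h1]
  have hWd : CoeffDeriv (CoeffDeriv P) W (-(C (X : B⟦X⟧) * coeffMap (coeffMap D') (W t₀))) :=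
    hP.coeffMap_expOp_neg_const hD hc S
  obtain ⟨Y', hY'⟩ := hP.coeffDeriv.exists_logSeries hWd
  set Y : ℝ → B⟦X⟧⟦X⟧ := fun t => logSeries (W t) with hY
  have hY0 : ∀ t, coeff 0 (Y t) = 0 := fun t => coeff_zero_logSeries _
  have hE : ∀ t, FlowEquation.expSeries (Y t) = W t := fun t => expSeries_logSeries (hW0 t)
  have e1 := hP.coeffDeriv.expSeries hY' hY0
  simp only [hE] at e1
  -- Two expressions for the derivative of W = exp Y: W Y' from the chain rule, and -ħ D'W from
  -- exp(-ħD). Dividing by the invertible W yields Y'.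
  have e2 := hPP.unique e1 hWd
  have e3 := h2.coeffMap.apply_expSeries (hY0 t₀)
  rw [hE] at e3
  have e4 : Y' = -(C (X : B⟦X⟧) * (coeffMap (coeffMap D') (Y t₀) +
      (1 / 2 : ℂ) • carre (coeffMap (coeffMap D')) (Y t₀) (Y t₀))) := by
    have h5 := mul_invOfUnit_one (hW0 t₀)
    rw [e3] at e2
    linear_combination invOfUnit (W t₀) 1 * e2 - (Y' + (C (X : B⟦X⟧) *
      (coeffMap (coeffMap D') (Y t₀) +
      (1 / 2 : ℂ) • carre (coeffMap (coeffMap D')) (Y t₀) (Y t₀)))) * h5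
  have h := hP.coeffMap_expOp hD hc hY'
  convert h using 1
  -- Differentiating the outer exponential gives +ħ exp(ħD) D'Y, which cancels the linear part of
  -- Y'.
  rw [e4, map_neg, coeffMap_expOp_C_X_mul, map_add, map_smul, mul_add, mul_smul_comm, neg_smul]
  abel

end Exp

end IsDerivClass

end DerivClasses

end FlowEquation
namespace FlowEquation

/-! ### Differentiable families of smooth test functions. -/

section Kernels

variable {E F : Type*} [NormedAddCommGroup E] [NormedSpace ℝ E]
  [NormedAddCommGroup F] [NormedSpace ℝ F] {l : Filter ℝ} {t₀ : ℝ}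

/-- A family of smooth functions converging to zero with all derivatives on compact sets. -/
structure IsSmall (l : Filter ℝ) (K : ℝ → E → ℂ) : Prop where
  smooth : ∀ t, ContDiff ℝ ∞ (K t)
  small : ∀ C, IsCompact C → ∀ (m : ℕ) (ε : ℝ), 0 < ε →
    ∀ᶠ t in l, ∀ i ≤ m, ∀ x ∈ C, ‖iteratedFDeriv ℝ i (K t) x‖ ≤ ε

/-- A family of smooth functions eventually bounded with all derivatives on compact sets. -/
structure IsBdd (l : Filter ℝ) (K : ℝ → E → ℂ) : Prop where
  smooth : ∀ t, ContDiff ℝ ∞ (K t)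
  bdd : ∀ C, IsCompact C → ∀ m : ℕ, ∃ M : ℝ, 0 ≤ M ∧
    ∀ᶠ t in l, ∀ i ≤ m, ∀ x ∈ C, ‖iteratedFDeriv ℝ i (K t) x‖ ≤ M

theorem IsSmall.isBdd {K : ℝ → E → ℂ} (h : IsSmall l K) : IsBdd l K :=
  ⟨h.smooth, fun C hC m => ⟨1, zero_le_one, h.small C hC m 1 one_pos⟩⟩

theorem isBdd_const {k : E → ℂ} (hk : ContDiff ℝ ∞ k) : IsBdd l fun _ => k := by
  refine ⟨fun _ => hk, fun C hC m => ?_⟩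
  obtain ⟨M, hM, h⟩ := exists_bound_iteratedFDeriv hk hC m
  exact ⟨M, hM, Filter.Eventually.of_forall fun _ => h⟩

theorem norm_iteratedFDeriv_add_le {f g : E → ℂ} (hf : ContDiff ℝ ∞ f) (hg : ContDiff ℝ ∞ g)
    (i : ℕ) (x : E) : ‖iteratedFDeriv ℝ i (fun x => f x + g x) x‖ ≤
      ‖iteratedFDeriv ℝ i f x‖ + ‖iteratedFDeriv ℝ i g x‖ := by
  rw [fun_iteratedFDeriv_add (hf.of_le (by exact_mod_cast le_top))
    (hg.of_le (by exact_mod_cast le_top))]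
  exact norm_add_le _ _

theorem IsSmall.add {K L : ℝ → E → ℂ} (hK : IsSmall l K) (hL : IsSmall l L) :
    IsSmall l fun t x => K t x + L t x := by
  refine ⟨fun t => (hK.smooth t).add (hL.smooth t), fun C hC m ε hε => ?_⟩
  filter_upwards [hK.small C hC m (ε / 2) (half_pos hε), hL.small C hC m (ε / 2) (half_pos hε)]
    with t h1 h2 i hi x hx
  refine (norm_iteratedFDeriv_add_le (hK.smooth t) (hL.smooth t) i x).trans ?_
  linarith [h1 i hi x hx, h2 i hi x hx]

theorem IsBdd.add {K L : ℝ → E → ℂ} (hK : IsBdd l K) (hL : IsBdd l L) :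
    IsBdd l fun t x => K t x + L t x := by
  refine ⟨fun t => (hK.smooth t).add (hL.smooth t), fun C hC m => ?_⟩
  obtain ⟨M, hM, h1⟩ := hK.bdd C hC m
  obtain ⟨M', hM', h2⟩ := hL.bdd C hC m
  refine ⟨M + M', add_nonneg hM hM', ?_⟩
  filter_upwards [h1, h2] with t h1 h2 i hi x hx
  refine (norm_iteratedFDeriv_add_le (hK.smooth t) (hL.smooth t) i x).trans ?_
  exact add_le_add (h1 i hi x hx) (h2 i hi x hx)

theorem IsSmall.mul {K L : ℝ → E → ℂ} (hK : IsSmall l K) (hL : IsBdd l L) :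
    IsSmall l fun t x => K t x * L t x := by
  refine ⟨fun t => (hK.smooth t).mul (hL.smooth t), fun C hC m ε hε => ?_⟩
  obtain ⟨M, hM, h2⟩ := hL.bdd C hC m
  have hp : (0 : ℝ) < 2 ^ m * (M + 1) := by positivity
  filter_upwards [hK.small C hC m (ε / (2 ^ m * (M + 1))) (div_pos hε hp), h2]
    with t h1 h2 i hi x hx
  refine (norm_iteratedFDeriv_mul_le (hK.smooth t) (hL.smooth t) x
    (by exact_mod_cast le_top)).trans ?_
  have h3 : ∀ j ∈ Finset.range (i + 1), (i.choose j : ℝ) * ‖iteratedFDeriv ℝ j (K t) x‖ *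
      ‖iteratedFDeriv ℝ (i - j) (L t) x‖ ≤
        (i.choose j : ℝ) * (ε / (2 ^ m * (M + 1)) * (M + 1)) := by
    intro j hj
    have hj' := Finset.mem_range.1 hj
    rw [mul_assoc]
    refine mul_le_mul_of_nonneg_left ?_ (Nat.cast_nonneg _)
    exact mul_le_mul (h1 j (by omega) x hx)
      ((h2 (i - j) (by omega) x hx).trans (by linarith)) (norm_nonneg _) (by positivity)
  refine (Finset.sum_le_sum h3).trans ?_
  have h4 : (∑ j ∈ Finset.range (i + 1), (i.choose j : ℝ)) = 2 ^ i := by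
    exact_mod_cast Nat.sum_range_choose i
  rw [← Finset.sum_mul, h4]
  calc (2 : ℝ) ^ i * (ε / (2 ^ m * (M + 1)) * (M + 1))
      ≤ 2 ^ m * (ε / (2 ^ m * (M + 1)) * (M + 1)) := by
        gcongr
        norm_num
    _ = ε := by field_simp

theorem isSmall_const {c : ℝ → ℂ} (hc : Filter.Tendsto c l (𝓝 0)) :
    IsSmall l fun t (_ : E) => c t := by
  refine ⟨fun t => contDiff_const, fun C hC m ε hε => ?_⟩
  filter_upwards [hc.eventually (Metric.closedBall_mem_nhds 0 hε)] with t h i hi x hx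
  cases i with
  | zero => simpa using h
  | succ i => rw [iteratedFDeriv_const_of_ne (by omega)]; simpa using hε.le

theorem IsSmall.comp {K : ℝ → F → ℂ} (hK : IsSmall l K) (A : E →L[ℝ] F) :
    IsSmall l fun t x => K t (A x) := by
  refine ⟨fun t => (hK.smooth t).comp A.contDiff, fun C hC m ε hε => ?_⟩
  have hp : 0 < (1 + ‖A‖) ^ m := by positivity
  filter_upwards [hK.small (A '' C) (hC.image A.continuous) m (ε / (1 + ‖A‖) ^ m) (by positivity)]
    with t h i hi x hx
  refine (norm_iteratedFDeriv_comp_clm_le (hK.smooth t) A i x).trans ?_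
  have h1 : ‖A‖ ^ i ≤ (1 + ‖A‖) ^ m :=
    (pow_le_pow_left₀ (norm_nonneg A) (by linarith) i).trans
      (pow_le_pow_right₀ (by linarith [norm_nonneg A]) hi)
  calc _ ≤ ε / (1 + ‖A‖) ^ m * (1 + ‖A‖) ^ m :=
        mul_le_mul (h i hi _ ⟨x, hx, rfl⟩) h1 (by positivity) (by positivity)
    _ = ε := by field_simp

/-- The family `K` of smooth functions is differentiable at `t₀` in the topology of `C^∞`. -/
structure HasKernelDeriv (t₀ : ℝ) (K : ℝ → E → ℂ) (K' : E → ℂ) : Prop where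
  smooth : ∀ t, ContDiff ℝ ∞ (K t)
  smooth' : ContDiff ℝ ∞ K'
  small : IsSmall (𝓝[≠] t₀) fun t x => (((t - t₀ : ℝ) : ℂ)⁻¹) * (K t x - K t₀ x) - K' x

theorem tendsto_sub_punctured :
    Filter.Tendsto (fun t : ℝ => ((t - t₀ : ℝ) : ℂ)) (𝓝[≠] t₀) (𝓝 0) := by
  have h : Continuous fun t : ℝ => ((t - t₀ : ℝ) : ℂ) :=
    Complex.continuous_ofReal.comp (continuous_id.sub continuous_const)
  have h1 := h.tendsto t₀
  simp only [sub_self, Complex.ofReal_zero] at h1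
  exact h1.mono_left nhdsWithin_le_nhds

theorem IsSmall.congr {K L : ℝ → E → ℂ} (hK : IsSmall l K) (hL : ∀ t, ContDiff ℝ ∞ (L t))
    (h : ∀ᶠ t in l, K t = L t) : IsSmall l L := by
  refine ⟨hL, fun C hC m ε hε => ?_⟩
  filter_upwards [hK.small C hC m ε hε, h] with t h1 h2
  rwa [← h2]

namespace HasKernelDeriv

theorem const {k : E → ℂ} (hk : ContDiff ℝ ∞ k) : HasKernelDeriv t₀ (fun _ => k) fun _ => 0 := by
  refine ⟨fun _ => hk, contDiff_const, ?_⟩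
  simpa using isSmall_const (E := E) (l := 𝓝[≠] t₀) (c := fun _ => 0) tendsto_const_nhds

theorem comp {K : ℝ → F → ℂ} {K' : F → ℂ} (h : HasKernelDeriv t₀ K K') (A : E →L[ℝ] F) :
    HasKernelDeriv t₀ (fun t x => K t (A x)) fun x => K' (A x) :=
  ⟨fun t => (h.smooth t).comp A.contDiff, h.smooth'.comp A.contDiff, h.small.comp A⟩

theorem isSmall_sub {K : ℝ → E → ℂ} {K' : E → ℂ} (h : HasKernelDeriv t₀ K K') :
    IsSmall (𝓝[≠] t₀) fun t x => K t x - K t₀ x := by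
  have h1 := (isSmall_const (E := E) (tendsto_sub_punctured (t₀ := t₀))).mul
    (h.small.isBdd.add (isBdd_const h.smooth'))
  refine h1.congr (fun t => (h.smooth t).sub (h.smooth t₀)) ?_
  filter_upwards [self_mem_nhdsWithin] with t ht
  have ht' : ((t - t₀ : ℝ) : ℂ) ≠ 0 := by
    exact_mod_cast sub_ne_zero.2 ht
  ext x
  rw [sub_add_cancel, mul_inv_cancel_left₀ ht']

theorem mul {K L : ℝ → E → ℂ} {K' L' : E → ℂ} (hK : HasKernelDeriv t₀ K K')
    (hL : HasKernelDeriv t₀ L L') :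
    HasKernelDeriv t₀ (fun t x => K t x * L t x) fun x => K' x * L t₀ x + K t₀ x * L' x := by
  refine ⟨fun t => (hK.smooth t).mul (hL.smooth t), (hK.smooth'.mul (hL.smooth t₀)).add
    ((hK.smooth t₀).mul hL.smooth'), ?_⟩
  have hb : IsBdd (𝓝[≠] t₀) L := by
    simpa using hL.isSmall_sub.isBdd.add (isBdd_const (hL.smooth t₀))
  -- With r_K and r_L the remainders of the difference quotients, that of the product is r_K L_t +
  -- (L_t - L_{t₀}) K' + r_L K_{t₀}; in each term one factor is small and the other bounded.
  have h := ((hK.small.mul hb).add (hL.isSmall_sub.mul (isBdd_const hK.smooth'))).add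
    (hL.small.mul (isBdd_const (hK.smooth t₀)))
  convert h using 3
  ring

end HasKernelDeriv

/-- The remainder of the difference quotient is itself a test function; its seminorms on the compact
set of u tend to zero. -/
theorem IsDist.hasDerivAt {u : (E → ℂ) → ℂ} (hu : IsDist u) {K : ℝ → E → ℂ} {K' : E → ℂ}
    (h : HasKernelDeriv t₀ K K') : HasDerivAt (fun t => u (K t)) (u K') t₀ := by
  rw [hasDerivAt_iff_tendsto_slope, tendsto_iff_norm_sub_tendsto_zero]
  obtain ⟨C, m, B, hC, hB, hb⟩ := hu.bound
  have hs : ∀ t, slope (fun t => u (K t)) t₀ t - u K' =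
      u fun x => (((t - t₀ : ℝ) : ℂ)⁻¹) * (K t x - K t₀ x) - K' x := by
    intro t
    rw [hu.map_sub (contDiff_const.mul ((h.smooth t).sub (h.smooth t₀))) h.smooth',
      hu.map_smul _ _ ((h.smooth t).sub (h.smooth t₀)), hu.map_sub (h.smooth t) (h.smooth t₀)]
    simp [slope]
  rw [Metric.tendsto_nhds]
  intro ε hε
  filter_upwards [h.small.small C hC m (ε / (2 * (B + 1))) (by positivity)] with t ht
  rw [dist_zero_right, norm_norm, hs]
  refine (hb _ _ (h.small.smooth t) (by positivity) ht).trans_lt ?_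
  calc B * (ε / (2 * (B + 1))) ≤ (B + 1) * (ε / (2 * (B + 1))) := by
        gcongr
        linarith
    _ = ε / 2 := by field_simp
    _ < ε := by linarith

theorem isDist_eval (x : E) : IsDist fun f : E → ℂ => f x := by
  refine ⟨fun f g _ _ => rfl, fun c f _ => rfl, {x}, 0, 1, isCompact_singleton, zero_le_one,
    fun f M _ _ h => ?_⟩
  simpa using h 0 le_rfl x rfl

theorem hasKernelDeriv_schwartz {p : ℝ → 𝓢(E, ℂ)} {p' : 𝓢(E, ℂ)}
    (hp : Filter.Tendsto (slope p t₀) (𝓝[≠] t₀) (𝓝 p')) :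
    HasKernelDeriv t₀ (fun t => (p t : E → ℂ)) p' := by
  refine ⟨fun t => (p t).smooth ⊤, p'.smooth ⊤, ?_⟩
  have e : (fun t x => (((t - t₀ : ℝ) : ℂ)⁻¹) * (p t x - p t₀ x) - p' x) =
      fun t => ((slope p t₀ t - p' : 𝓢(E, ℂ)) : E → ℂ) := by
    ext t x
    simp [slope]
  rw [e]
  refine ⟨fun t => (slope p t₀ t - p').smooth ⊤, fun C hC m ε hε => ?_⟩
  have h := ((schwartz_withSeminorms ℝ E ℂ).tendsto_nhds _ _).1 hp
  have h2 : ∀ᶠ t in 𝓝[≠] t₀, ∀ i ∈ Finset.range (m + 1),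
      schwartzSeminormFamily ℝ E ℂ (0, i) (slope p t₀ t - p') < ε :=
    (Finset.eventually_all _).2 fun i _ => h (0, i) ε hε
  filter_upwards [h2] with t ht i hi x _
  exact (SchwartzMap.norm_iteratedFDeriv_le_seminorm ℝ _ i x).trans
    (ht i (Finset.mem_range.2 (by omega))).le

end Kernels

/-! ### Differentiable curves of observables. -/

section Curves

variable {d : ℕ} {t₀ : ℝ}

/-- Curves of observables that are differentiable at `t₀`: finite sums of polynomial families of
distributions applied to differentiable families of smooth functions. -/
inductive HasObsDeriv (t₀ : ℝ) : (ℝ → Functional d) → Functional d → Prop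
  | basic {E : Type} [NormedAddCommGroup E] [NormedSpace ℝ E] [FiniteDimensional ℝ E] {N : ℕ}
      {Φ : Config d → (E → ℂ) → ℂ} (hΦ : IsPoly N Φ) {K : ℝ → E → ℂ} {K' : E → ℂ}
      (hK : HasKernelDeriv t₀ K K') : HasObsDeriv t₀ (fun t φ => Φ φ (K t)) fun φ => Φ φ K'
  | add {F G : ℝ → Functional d} {F' G' : Functional d} (hF : HasObsDeriv t₀ F F')
      (hG : HasObsDeriv t₀ G G') : HasObsDeriv t₀ (fun t => F t + G t) (F' + G')

namespace HasObsDeriv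

variable {F G : ℝ → Functional d} {F' G' : Functional d}

theorem isObservable (h : HasObsDeriv t₀ F F') (t : ℝ) : IsObservable (F t) := by
  induction h with
  | basic hΦ hK => exact hΦ.isObservable (hK.smooth t)
  | add _ _ h1 h2 => exact h1.add h2

theorem isObservable_deriv (h : HasObsDeriv t₀ F F') : IsObservable F' := by
  induction h with
  | basic hΦ hK => exact hΦ.isObservable hK.smooth'
  | add _ _ h1 h2 => exact h1.add h2

theorem hasDerivAt (h : HasObsDeriv t₀ F F') (φ : Config d) :
    HasDerivAt (fun t => F t φ) (F' φ) t₀ := by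
  induction h with
  | basic hΦ hK => exact (hΦ.isDist φ).hasDerivAt hK
  | add _ _ h1 h2 => exact h1.add h2

theorem const {F : Functional d} (hF : IsObservable F) : HasObsDeriv t₀ (fun _ => F) 0 := by
  obtain ⟨N, hN⟩ := hF.exists_isPoly_fd 0
  have h := HasObsDeriv.basic (t₀ := t₀) hN (HasKernelDeriv.const contDiff_const (k := fun _ => 1))
  simp only [fd_zero hF, mul_one, mul_zero] at h
  exact h

theorem smul (c : ℂ) (h : HasObsDeriv t₀ F F') : HasObsDeriv t₀ (fun t => c • F t) (c • F') := by
  induction h with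
  | basic hΦ hK => exact HasObsDeriv.basic (hΦ.const_mul c) hK
  | add _ _ h1 h2 =>
    simp only [smul_add]
    exact h1.add h2

/-- A product of two basic curves is again basic, for the tensor product of the families and the
product of the test functions. -/
theorem mul (hF : HasObsDeriv t₀ F F') (hG : HasObsDeriv t₀ G G') :
    HasObsDeriv t₀ (fun t => F t * G t) (F' * G t₀ + F t₀ * G') := by
  induction hF with
  | @basic E _ _ _ N Φ hΦ K K' hK =>
    induction hG with
    | @basic E₂ _ _ _ M Ψ hΨ L L' hL =>
      have h := HasObsDeriv.basic (hΦ.prod hΨ)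
        ((hK.comp (ContinuousLinearMap.fst ℝ E E₂)).mul (hL.comp (ContinuousLinearMap.snd ℝ E E₂)))
      have e : ∀ φ (k : E → ℂ) (l : E₂ → ℂ), ContDiff ℝ ∞ k → ContDiff ℝ ∞ l →
          (Φ φ fun x => Ψ φ fun y => k x * l y) = Φ φ k * Ψ φ l := by
        intro φ k l hk hl
        have e1 : (fun x => Ψ φ fun y => k x * l y) = fun x => Ψ φ l * k x := by
          ext x
          rw [(hΨ.isDist φ).map_smul _ l hl, mul_comm]
        rw [e1, (hΦ.isDist φ).map_smul _ k hk, mul_comm]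
      convert h using 1
      · ext t φ
        exact (e φ _ _ (hK.smooth t) (hL.smooth t)).symm
      · ext φ
        have hd := (hΦ.isDist φ).prod (hΨ.isDist φ)
        have h1 := hd.map_add (fun z => K' z.1 * L t₀ z.2) (fun z => K t₀ z.1 * L' z.2)
          ((hK.smooth'.comp contDiff_fst).mul ((hL.smooth t₀).comp contDiff_snd))
          (((hK.smooth t₀).comp contDiff_fst).mul (hL.smooth'.comp contDiff_snd))
        refine Eq.trans ?_ h1.symm
        simp only [e φ _ _ hK.smooth' (hL.smooth t₀), e φ _ _ (hK.smooth t₀) hL.smooth']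
        rfl
    | add _ _ h1 h2 =>
      simp only [mul_add]
      convert h1.add h2 using 1
      ring
  | add _ _ h1 h2 =>
    simp only [add_mul]
    convert h1.add h2 using 1
    ring

/-- Mere differentiability at each configuration would not control functional derivatives. For a
basic curve, the kernel and the test function merge into a single test function for the second
derivative of the family. -/
theorem lap (hF : HasObsDeriv t₀ F F') {k : ℝ → (Fin 2 → Spc d) → ℂ} {k' : (Fin 2 → Spc d) → ℂ}
    (hk : HasKernelDeriv t₀ k k') :
    HasObsDeriv t₀ (fun t => lap (k t) (F t)) (lap (k t₀) F' + lap k' (F t₀)) := by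
  induction hF with
  | @basic E _ _ _ N Φ hΦ K K' hK =>
    obtain ⟨Φ₂, hΦ₂, hit⟩ := hΦ.exists_iterDirDeriv 2
    have h := HasObsDeriv.basic hΦ₂ ((hk.comp (ContinuousLinearMap.fst ℝ (Fin 2 → Spc d) E)).mul
      (hK.comp (ContinuousLinearMap.snd ℝ (Fin 2 → Spc d) E)))
    have e : ∀ φ (f : E → ℂ) (l : (Fin 2 → Spc d) → ℂ), ContDiff ℝ ∞ f → ContDiff ℝ ∞ l →
        FlowEquation.lap l (fun φ => Φ φ f) φ = Φ₂ φ fun z => l z.1 * f z.2 := by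
      intro φ f l hf hl
      have hd : IsDist fun l : (Fin 2 → Spc d) → ℂ => Φ₂ φ fun z => f z.2 * l z.1 :=
        (hΦ₂.isDist φ).comp_weight (hf.comp contDiff_snd)
          (ContinuousLinearMap.fst ℝ (Fin 2 → Spc d) E)
      simp only [mul_comm (l _)]
      refine (hΦ.isObservable hf).fd_eq hd (fun h => ?_) hl
      rw [hit h f hf]
      simp only [mul_comm]
    convert h using 1
    · ext t φ
      exact e φ _ _ (hK.smooth t) (hk.smooth t)
    · ext φ
      have h1 := (hΦ₂.isDist φ).map_add (fun z => k' z.1 * K t₀ z.2) (fun z => k t₀ z.1 * K' z.2)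
        ((hk.smooth'.comp contDiff_fst).mul ((hK.smooth t₀).comp contDiff_snd))
        (((hk.smooth t₀).comp contDiff_fst).mul (hK.smooth'.comp contDiff_snd))
      refine Eq.trans ?_ h1.symm
      rw [Pi.add_apply, e φ _ _ hK.smooth' (hk.smooth t₀), e φ _ _ (hK.smooth t₀) hk.smooth',
        add_comm]
  | @add A B A' B' hA hB h1 h2 =>
    have e := fun t => lap_add (hA.isObservable t) (hB.isObservable t) (hk.smooth t)
    simp only [e, lap_add hA.isObservable_deriv hB.isObservable_deriv (hk.smooth t₀),
      lap_add (hA.isObservable t₀) (hB.isObservable t₀) hk.smooth']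
    convert h1.add h2 using 1
    abel

end HasObsDeriv

/-- Uniqueness comes from evaluation: such a curve is differentiable at every φ, and this fixes the
derivative. -/
theorem isDerivClass_obs (t₀ : ℝ) : IsDerivClass t₀
    fun (F : ℝ → observables d) (F' : observables d) =>
      HasObsDeriv t₀ (fun t => (F t : Functional d)) F' where
  const a := HasObsDeriv.const a.2
  add hF hG := hF.add hG
  smul c _ _ hF := hF.smul c
  mul hF hG := hF.mul hG
  unique hF hF' := Subtype.ext (funext fun φ => (hF.hasDerivAt φ).unique (hF'.hasDerivAt φ))

theorem hasKernelDeriv_halfKer {p : ℝ → 𝓢(Spc d, ℂ)} {p' : 𝓢(Spc d, ℂ)}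
    (hp : Filter.Tendsto (slope p t₀) (𝓝[≠] t₀) (𝓝 p')) :
    HasKernelDeriv t₀ (fun t => halfKer (p t)) (halfKer p') := by
  have h1 := (hasKernelDeriv_schwartz hp).comp
    (ContinuousLinearMap.proj (R := ℝ) (φ := fun _ : Fin 2 => Spc d) 0 -
      ContinuousLinearMap.proj (R := ℝ) (φ := fun _ : Fin 2 => Spc d) 1)
  have h2 := (HasKernelDeriv.const (t₀ := t₀) (E := Fin 2 → Spc d)
    (contDiff_const (c := (1 / 2 : ℂ)))).mul h1
  convert h2 using 1
  · ext t x
    simp [halfKer]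
  · ext x
    simp [halfKer]

theorem hasObsDeriv_obsLap {p : ℝ → 𝓢(Spc d, ℂ)} {p' : 𝓢(Spc d, ℂ)}
    (hp : Filter.Tendsto (slope p t₀) (𝓝[≠] t₀) (𝓝 p')) {F : ℝ → observables d}
    {F' : observables d} (hF : HasObsDeriv t₀ (fun t => (F t : Functional d)) F') :
    HasObsDeriv t₀ (fun t => (obsLap (p t) (F t) : Functional d))
      (obsLap (p t₀) F' + obsLap p' (F t₀) : observables d) :=
  hF.lap (hasKernelDeriv_halfKer hp)

/-- Evaluations at -z and z are distributions, and they agree on p t for t near t₀; hence so do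
their derivatives. -/
theorem even_of_tendsto_slope {p : ℝ → 𝓢(Spc d, ℂ)} {p' : 𝓢(Spc d, ℂ)}
    (hp : Filter.Tendsto (slope p t₀) (𝓝[≠] t₀) (𝓝 p'))
    (he : ∀ᶠ t in 𝓝 t₀, ∀ z, p t (-z) = p t z) (z : Spc d) : p' (-z) = p' z := by
  have h := hasKernelDeriv_schwartz hp
  refine ((isDist_eval (-z)).hasDerivAt h).unique
    (((isDist_eval z).hasDerivAt h).congr_of_eventuallyEq ?_)
  filter_upwards [he] with t ht using ht z

end Curves

end FlowEquation
namespace FlowEquation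

/-! ### Conjugation of the star product and the S-matrix by exp(ħD). -/

section Series

open PowerSeries

variable {d : ℕ}

/-- Formal power series with observables as coefficients. -/
abbrev ObsSeries (d : ℕ) : Type := PowerSeries (PowerSeries (observables d))

/-- The inclusion of the series of observables in the series of functionals. -/
noncomputable def toSeries : ObsSeries d →+* GSeries d :=
  PowerSeries.map (PowerSeries.map (observables d).val.toRingHom)

@[simp]
theorem gcoeff_toSeries (A : ObsSeries d) (n k : ℕ) :
    gcoeff n k (toSeries A) = (coeff k (coeff n A) : observables d) := by
  simp [gcoeff, toSeries]

theorem gcoeff_ext {W Z : GSeries d} (h : ∀ n k, gcoeff n k W = gcoeff n k Z) : W = Z := by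
  ext n k : 2
  exact h n k

theorem toSeries_injective : Function.Injective (toSeries (d := d)) := by
  intro A B h
  ext n k : 2
  have := congrArg (gcoeff n k) h
  rw [gcoeff_toSeries, gcoeff_toSeries] at this
  exact Subtype.ext this

theorem isObservableSeries_toSeries (A : ObsSeries d) : IsObservableSeries (toSeries A) := by
  intro n k
  rw [gcoeff_toSeries]
  exact (coeff k (coeff n A)).2

theorem IsObservableSeries.exists_toSeries {W : GSeries d} (h : IsObservableSeries W) :
    ∃ A, toSeries A = W :=
  ⟨PowerSeries.mk fun n => PowerSeries.mk fun k => ⟨gcoeff n k W, h n k⟩,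
    gcoeff_ext fun n k => by simp⟩

theorem coeff_toSeries (A : ObsSeries d) (n : ℕ) : coeff n (toSeries A) =
    PowerSeries.map (observables d).val.toRingHom (coeff n A) := by
  simp [toSeries]

theorem map_val_injective : Function.Injective
    (PowerSeries.map (observables d).val.toRingHom) :=
  PowerSeries.map_injective _ Subtype.val_injective

theorem toSeries_mem_interactions {A : ObsSeries d} :
    toSeries A ∈ interactions d ↔ coeff 0 A = 0 := by
  refine ⟨fun h => map_val_injective ?_, fun h => ⟨isObservableSeries_toSeries A, ?_⟩⟩
  · rw [← coeff_toSeries, h.2, map_zero]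
  · rw [coeff_toSeries, h, map_zero]

theorem toSeries_mem_unitSeries {A : ObsSeries d} :
    toSeries A ∈ unitSeries d ↔ coeff 0 A = 1 := by
  refine ⟨fun h => map_val_injective ?_, fun h => ⟨isObservableSeries_toSeries A, ?_⟩⟩
  · rw [← coeff_toSeries, h.2, map_one]
  · rw [coeff_toSeries, h, map_one]

theorem toSeries_smul (c : ℂ) (A : ObsSeries d) : toSeries (c • A) = c • toSeries A := by
  refine gcoeff_ext fun n k => ?_
  rw [gcoeff_toSeries]
  simp only [gcoeff, coeff_smul]
  rw [← gcoeff, gcoeff_toSeries]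
  rfl

theorem toSeries_C_X : toSeries (C (X : PowerSeries (observables d))) = hbar := by
  simp [toSeries, hbar]

theorem hbarSum_toSeries {c : ℕ → Functional d → Functional d → Functional d}
    {c' : ℕ → BilOp (observables d)}
    (h : ∀ j F G, (c' j F G : Functional d) = c j F G) (A B : ObsSeries d) :
    hbarSum c (toSeries A) (toSeries B) = toSeries (conv (hbarBil c') A B) := by
  refine gcoeff_ext fun n k => ?_
  rw [gcoeff_toSeries]
  simp only [hbarSum, conv, hbarBil, coeff_mk, map_sum, AddSubmonoidClass.coe_finsetSum]
  simp only [gcoeff, coeff_mk]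
  refine Finset.sum_congr rfl fun a _ => Finset.sum_congr rfl fun b _ =>
    Finset.sum_congr rfl fun e _ => ?_
  rw [← gcoeff, ← gcoeff, gcoeff_toSeries, gcoeff_toSeries, ← h]
  rfl

/-- The operator `exp(ħ D)` with `D = ½ ∫ dx dy p(x - y) δ²/δφ(x)δφ(y)`. -/
noncomputable def wickExp (p : 𝓢(Spc d, ℂ)) : ObsSeries d →ₗ[ℂ] ObsSeries d :=
  coeffMap (expOp (obsLap p))

/-- The inverse of `wickExp p`. -/
noncomputable def wickLog (p : 𝓢(Spc d, ℂ)) : ObsSeries d →ₗ[ℂ] ObsSeries d :=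
  coeffMap (expOp (-obsLap p))

theorem wickExp_wickLog (p : 𝓢(Spc d, ℂ)) (A : ObsSeries d) : wickExp p (wickLog p A) = A := by
  ext n : 1
  simp only [wickExp, wickLog, coeff_coeffMap, expOp_expOp_neg]

theorem wickLog_wickExp (p : 𝓢(Spc d, ℂ)) (A : ObsSeries d) : wickLog p (wickExp p A) = A := by
  ext n : 1
  simp only [wickExp, wickLog, coeff_coeffMap, expOp_neg_expOp]

theorem coeff_zero_wickExp_eq_one (p : 𝓢(Spc d, ℂ)) {A : ObsSeries d} (h : coeff 0 A = 1) :
    coeff 0 (wickExp p A) = 1 := by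
  rw [wickExp, coeff_coeffMap, h, expOp_one (obsLap_one p)]

theorem coeff_zero_wickLog_eq_one (p : 𝓢(Spc d, ℂ)) {A : ObsSeries d} (h : coeff 0 A = 1) :
    coeff 0 (wickLog p A) = 1 := by
  rw [wickLog, coeff_coeffMap, h, expOp_one]
  rw [LinearMap.neg_apply, obsLap_one, neg_zero]

theorem coeff_zero_wickExp_eq_zero (p : 𝓢(Spc d, ℂ)) {A : ObsSeries d} (h : coeff 0 A = 0) :
    coeff 0 (wickExp p A) = 0 := by
  rw [wickExp, coeff_coeffMap, h, map_zero]

theorem coeff_zero_wickLog_eq_zero (p : 𝓢(Spc d, ℂ)) {A : ObsSeries d} (h : coeff 0 A = 0) :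
    coeff 0 (wickLog p A) = 0 := by
  rw [wickLog, coeff_coeffMap, h, map_zero]

section Even

variable {p : 𝓢(Spc d, ℂ)}

theorem cons_const_propagator (p : 𝓢(Spc d, ℂ)) (j : ℕ) :
    (Fin.cons p fun _ : Fin j => p : Fin (j + 1) → 𝓢(Spc d, ℂ)) = fun _ => p := by
  funext i
  refine Fin.cases rfl (fun _ => rfl) i

theorem hbarBil_expOp_obsLap (hp : ∀ z, p (-z) = p z) (a b : PowerSeries (observables d)) :
    hbarBil (fun j => obsContract fun _ : Fin j => p) (expOp (obsLap p) a)
      (expOp (obsLap p) b) = expOp (obsLap p) (a * b) := by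
  have h0 : ∀ x y : observables d, obsContract (fun _ : Fin 0 => p) x y = x * y :=
    obsContract_zero _
  have hD : ∀ (j : ℕ) (x y : observables d), obsLap p (obsContract (fun _ : Fin j => p) x y) =
      obsContract (fun _ : Fin j => p) (obsLap p x) y +
        obsContract (fun _ : Fin j => p) x (obsLap p y) +
          obsContract (fun _ : Fin (j + 1) => p) x y := fun j x y => by
    rw [obsLap_obsContract _ hp, cons_const_propagator]
  exact hbarBil_expOp (c := fun j => obsContract fun _ : Fin j => p) h0 hD a b

theorem star_wickExp (hp : ∀ z, p (-z) = p z) (A B : ObsSeries d) :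
    star p (toSeries (wickExp p A)) (toSeries (wickExp p B)) = toSeries (wickExp p (A * B)) := by
  rw [star, hbarSum_toSeries (c' := fun j => obsContract fun _ : Fin j => p)
    (fun j F G => coe_obsContract _ F G), wickExp, conv_map (hbarBil_expOp_obsLap hp)]

theorem commute_obsLap (p q : 𝓢(Spc d, ℂ)) :
    Commute (obsLap p : Module.End ℂ (observables d)) (obsLap q) :=
  LinearMap.ext fun F => obsLap_comm p q F

/-- By `hbarBil_succ`, the additional line q measures how far D_q is from a derivation of the star
product. Since D_q commutes with exp(ħ D_p), conjugation turns this into the same defect for the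
pointwise product. -/
theorem starDeriv_wickExp {q : 𝓢(Spc d, ℂ)} (hp : ∀ z, p (-z) = p z) (hq : ∀ z, q (-z) = q z)
    (A B : ObsSeries d) :
    starDeriv q p (toSeries (wickExp p A)) (toSeries (wickExp p B)) =
      toSeries (wickExp p (carre (coeffMap (coeffMap (obsLap q))) A B)) := by
  rw [starDeriv, hbarSum_toSeries (c' := fun j => obsContract (Fin.cons q fun _ : Fin j => p))
    (fun j F G => coe_obsContract _ F G)]
  congr 1
  ext n : 1
  rw [conv, coeff_mk, wickExp, coeff_coeffMap, coeff_carre_coeffMap, map_sum]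
  refine Finset.sum_congr rfl fun i _ => ?_
  rw [coeff_coeffMap, coeff_coeffMap,
    hbarBil_succ (c := fun j => obsContract fun _ : Fin j => p)
      (fun j x y => obsLap_obsContract _ hq x y), coeffMap_expOp (commute_obsLap q p),
    coeffMap_expOp (commute_obsLap q p), hbarBil_expOp_obsLap hp, hbarBil_expOp_obsLap hp,
    hbarBil_expOp_obsLap hp, coeffMap_expOp (commute_obsLap q p), ← map_sub, ← map_sub]
  rfl

/-- Here `carre` is the contraction with a single line q, which is a first derivative in its first
argument and so obeys the Leibniz rule. -/
theorem isSecondOrder_obsLap {q : 𝓢(Spc d, ℂ)} (hq : ∀ z, q (-z) = q z) :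
    IsSecondOrder (obsLap q) := by
  refine ⟨obsLap_one q, fun a b c => ?_⟩
  have h : ∀ a b : observables d, carre (obsLap q) a b =
      obsContract (Fin.cons q Fin.elim0 : Fin 1 → 𝓢(Spc d, ℂ)) a b := by
    intro a b
    have h1 := obsLap_obsContract (Fin.elim0 : Fin 0 → 𝓢(Spc d, ℂ)) hq a b
    simp only [obsContract_zero] at h1
    rw [carre, h1]
    ring
  rw [h, h, h, obsContract_one_mul]

theorem starPow_wickExp (hp : ∀ z, p (-z) = p z) (A : ObsSeries d) (n : ℕ) :
    starPow p (toSeries (wickExp p A)) n = toSeries (wickExp p (A ^ n)) := by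
  induction n with
  | zero =>
    have h : wickExp p (1 : ObsSeries d) = 1 := by
      ext n : 1
      rw [wickExp, coeff_coeffMap, coeff_one]
      split_ifs
      · exact expOp_one (obsLap_one p)
      · exact map_zero _
    rw [pow_zero, h, map_one, starPow]
  | succ n ih => rw [starPow, ih, star_wickExp hp, pow_succ']

theorem regS_wickExp (hp : ∀ z, p (-z) = p z) (A : ObsSeries d) :
    regS p (toSeries (wickExp p A)) = toSeries (wickExp p (expSeries A)) := by
  have h : ∀ N, coeff N (wickExp p (expSeries A)) = ∑ n ∈ Finset.range (N + 1),
      ((n.factorial : ℂ)⁻¹) • coeff N (wickExp p (A ^ n)) := fun N => by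
    simp only [wickExp, coeff_coeffMap, expSeries, coeff_mk, map_sum, map_smul]
  refine gcoeff_ext fun N k => ?_
  rw [gcoeff_toSeries, h]
  simp only [regS, gcoeff, coeff_mk, map_sum, starPow_wickExp hp, coeff_smul,
    AddSubmonoidClass.coe_finsetSum]
  refine Finset.sum_congr rfl fun n _ => ?_
  rw [← gcoeff, gcoeff_toSeries]
  rfl

theorem regS_toSeries (hp : ∀ z, p (-z) = p z) (A : ObsSeries d) :
    regS p (toSeries A) = toSeries (wickExp p (expSeries (wickLog p A))) := by
  rw [← regS_wickExp hp, wickExp_wickLog]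

/-- Conjugation reduces the claim to exp on power series; exp(±ħD) preserves the constant
coefficients 0 and 1. -/
theorem bijOn_regS (hp : ∀ z, p (-z) = p z) :
    Set.BijOn (regS p) (interactions d) (unitSeries d) := by
  refine ⟨fun W hW => ?_, fun W hW Z hZ h => ?_, fun U hU => ?_⟩
  · obtain ⟨A, rfl⟩ := hW.1.exists_toSeries
    rw [regS_toSeries hp, toSeries_mem_unitSeries]
    exact coeff_zero_wickExp_eq_one p (coeff_zero_expSeries _)
  · obtain ⟨A, rfl⟩ := hW.1.exists_toSeries
    obtain ⟨B, rfl⟩ := hZ.1.exists_toSeries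
    rw [regS_toSeries hp, regS_toSeries hp] at h
    have h1 := congrArg (wickLog p) (toSeries_injective h)
    rw [wickLog_wickExp, wickLog_wickExp] at h1
    have h2 := expSeries_injective
      (coeff_zero_wickLog_eq_zero p (toSeries_mem_interactions.1 hW))
      (coeff_zero_wickLog_eq_zero p (toSeries_mem_interactions.1 hZ)) h1
    rw [← wickExp_wickLog p A, h2, wickExp_wickLog]
  · obtain ⟨A, rfl⟩ := hU.1.exists_toSeries
    refine ⟨toSeries (wickExp p (logSeries (wickLog p A))), toSeries_mem_interactions.2
      (coeff_zero_wickExp_eq_zero p (coeff_zero_logSeries _)), ?_⟩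
    rw [regS_wickExp hp, expSeries_logSeries
      (coeff_zero_wickLog_eq_one p (toSeries_mem_unitSeries.1 hU)), wickExp_wickLog]

end Even

theorem SMatrix.eval_mem_unitSeries {D : Submodule ℂ (HSeries d)} (S : SMatrix D) (V : D) :
    S.eval V ∈ unitSeries d := by
  refine ⟨fun n k => ?_, ?_⟩
  · simp only [gcoeff, SMatrix.eval, coeff_mk, coeff_smul]
    exact (S.observable n _ k).smul _
  · simp only [SMatrix.eval, coeff_mk, S.start_zero]
    simp

theorem effPot_spec {D : Submodule ℂ (HSeries d)} (S : SMatrix D) (V : D) {p : 𝓢(Spc d, ℂ)}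
    (hp : ∀ z, p (-z) = p z) :
    effPot S p V ∈ interactions d ∧ regS p (effPot S p V) = S.eval V := by
  have h := (bijOn_regS hp).surjOn (S.eval_mem_unitSeries V)
  exact ⟨Function.invFunOn_mem h, Function.invFunOn_eq h⟩

/-- The choice in `invFunOn` is replaced by the explicit preimage, which makes the dependence on the
propagator visible. -/
theorem effPot_eq {D : Submodule ℂ (HSeries d)} (S : SMatrix D) (V : D) {p : 𝓢(Spc d, ℂ)}
    (hp : ∀ z, p (-z) = p z) {A : ObsSeries d} (hA : toSeries A = S.eval V) :
    effPot S p V = toSeries (wickExp p (logSeries (wickLog p A))) := by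
  obtain ⟨h1, h2⟩ := effPot_spec S V hp
  refine (bijOn_regS hp).injOn h1 (toSeries_mem_interactions.2
    (coeff_zero_wickExp_eq_zero p (coeff_zero_logSeries _))) ?_
  have hA1 : coeff 0 A = 1 := by
    rw [← toSeries_mem_unitSeries, hA]
    exact S.eval_mem_unitSeries V
  rw [h2, regS_wickExp hp, expSeries_logSeries (coeff_zero_wickLog_eq_one p hA1),
    wickExp_wickLog, hA]

theorem hasSeriesDerivAt_of_eventually {W : ℝ → GSeries d} {W' : GSeries d} {t₀ : ℝ}
    {A : ℝ → ObsSeries d} {A' : ObsSeries d}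
    (hA : CoeffDeriv (CoeffDeriv fun (F : ℝ → observables d) (F' : observables d) =>
      HasObsDeriv t₀ (fun t => (F t : Functional d)) F') A A')
    (hW : ∀ᶠ t in 𝓝 t₀, W t = toSeries (A t)) (hW' : W' = toSeries A') :
    HasSeriesDerivAt W W' t₀ := by
  intro n k φ
  rw [hW', gcoeff_toSeries]
  refine ((hA n k).hasDerivAt φ).congr_of_eventuallyEq ?_
  filter_upwards [hW] with t ht
  rw [ht, gcoeff_toSeries]

section Flow

variable {p : ℝ → 𝓢(Spc d, ℂ)} {p' : 𝓢(Spc d, ℂ)} {t₀ : ℝ}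
  {D : Submodule ℂ (HSeries d)} (S : SMatrix D) (V : D)

theorem hasSeriesDerivAt_effPot (he : ∀ᶠ t in 𝓝 t₀, ∀ z, p t (-z) = p t z)
    (hp : Filter.Tendsto (slope p t₀) (𝓝[≠] t₀) (𝓝 p')) :
    HasSeriesDerivAt (fun t => effPot S (p t) V) (-(1 / 2 : ℂ) • (hbar *
      starDeriv p' (p t₀) (effPot S (p t₀) V) (effPot S (p t₀) V))) t₀ := by
  -- The series S(gV) is independent of t; all dependence on t comes from the operators conjugating
  -- the logarithm.
  obtain ⟨A, hA⟩ := (S.eval_mem_unitSeries V).1.exists_toSeries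
  have hA1 : coeff 0 A = 1 := by
    rw [← toSeries_mem_unitSeries, hA]
    exact S.eval_mem_unitSeries V
  have hq := even_of_tendsto_slope hp he
  refine hasSeriesDerivAt_of_eventually ((isDerivClass_obs t₀).flow (D := fun t => obsLap (p t))
    (D' := obsLap p') (fun hF => hasObsDeriv_obsLap hp hF) (commute_obsLap _ _)
    (isSecondOrder_obsLap hq) (fun t => obsLap_one _) hA1) ?_ ?_
  · filter_upwards [he] with t ht using effPot_eq S V ht hA
  · rw [effPot_eq S V he.self_of_nhds hA, starDeriv_wickExp he.self_of_nhds hq, toSeries_smul,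
      map_mul, toSeries_C_X]
    rfl

theorem hasSeriesDerivAt_star (he : ∀ᶠ t in 𝓝 t₀, ∀ z, p t (-z) = p t z)
    (hp : Filter.Tendsto (slope p t₀) (𝓝[≠] t₀) (𝓝 p')) {W : GSeries d}
    (hW : IsObservableSeries W) :
    HasSeriesDerivAt (fun t => star (p t) W W) (hbar * starDeriv p' (p t₀) W W) t₀ := by
  obtain ⟨A, rfl⟩ := hW.exists_toSeries
  -- The fixed series is written as exp(ħD) Y with the propagator at t₀, the form required by
  -- `IsDerivClass.mul_flow`.
  obtain ⟨Y, rfl⟩ : ∃ Y, wickExp (p t₀) Y = A := ⟨_, wickExp_wickLog (p t₀) A⟩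
  have hq := even_of_tendsto_slope hp he
  refine hasSeriesDerivAt_of_eventually ((isDerivClass_obs t₀).mul_flow
    (D := fun t => obsLap (p t)) (D' := obsLap p') (fun hF => hasObsDeriv_obsLap hp hF)
    (commute_obsLap _ _) Y) ?_ ?_
  · filter_upwards [he] with t ht
    have h := star_wickExp ht (wickLog (p t) (wickExp (p t₀) Y)) (wickLog (p t) (wickExp (p t₀) Y))
    rw [wickExp_wickLog] at h
    exact h
  · rw [starDeriv_wickExp he.self_of_nhds hq, map_mul, toSeries_C_X]
    rfl

end Flow

end Series

end FlowEquation
-- The flow equation.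
theorem mainTheorem1 {d : ℕ}
    (p p' : ℝ → 𝓢(FlowEquation.Spc d, ℂ))
    (hp_even : ∀ Λ > 0, ∀ z, p Λ (-z) = p Λ z)
    (hp_deriv : ∀ Λ > 0, Filter.Tendsto (slope p Λ) (𝓝[≠] Λ) (𝓝 (p' Λ)))
    (Floc : Submodule ℂ (FlowEquation.HSeries d))
    (hFloc : ∀ V ∈ Floc, ∀ k, FlowEquation.IsLocal (PowerSeries.coeff k V))
    (S : FlowEquation.SMatrix Floc) (V : Floc) :
    (∀ Λ > 0, Set.BijOn (FlowEquation.regS (p Λ))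
        (FlowEquation.interactions d) (FlowEquation.unitSeries d)) ∧
      (∀ Λ > 0, FlowEquation.effPot S (p Λ) V ∈ FlowEquation.interactions d ∧
        FlowEquation.regS (p Λ) (FlowEquation.effPot S (p Λ) V) = S.eval V) ∧
      (∀ Λ > 0, FlowEquation.HasSeriesDerivAt (fun l => FlowEquation.effPot S (p l) V)
        (-(1 / 2 : ℂ) • (FlowEquation.hbar *
          FlowEquation.starDeriv (p' Λ) (p Λ)
            (FlowEquation.effPot S (p Λ) V) (FlowEquation.effPot S (p Λ) V))) Λ) ∧
      (∀ Λ > 0, ∃ D : FlowEquation.GSeries d,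
        FlowEquation.HasSeriesDerivAt (fun l => FlowEquation.star (p l)
          (FlowEquation.effPot S (p Λ) V) (FlowEquation.effPot S (p Λ) V)) D Λ ∧
        FlowEquation.HasSeriesDerivAt (fun l => FlowEquation.effPot S (p l) V)
          (-(1 / 2 : ℂ) • D) Λ) := by
  -- Evenness is assumed only for positive parameters, hence holds in a neighbourhood of each Λ > 0,
  -- which suffices for derivatives.
  have he : ∀ Λ > 0, ∀ᶠ t in 𝓝 Λ, ∀ z, p t (-z) = p t z := fun Λ hΛ => by
    filter_upwards [lt_mem_nhds hΛ] with t ht using hp_even t ht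
  have hV : ∀ Λ > 0, FlowEquation.effPot S (p Λ) V ∈ FlowEquation.interactions d :=
    fun Λ hΛ => (FlowEquation.effPot_spec S V (hp_even Λ hΛ)).1
  have hflow := fun Λ (hΛ : Λ > 0) =>
    FlowEquation.hasSeriesDerivAt_effPot S V (he Λ hΛ) (hp_deriv Λ hΛ)
  exact ⟨fun Λ hΛ => FlowEquation.bijOn_regS (hp_even Λ hΛ),
    fun Λ hΛ => FlowEquation.effPot_spec S V (hp_even Λ hΛ), hflow,
    -- The derivative of the star square is exactly ħ times the `starDeriv` term of the flow
    -- equation, so the same derivative serves both forms.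
    fun Λ hΛ => ⟨_, FlowEquation.hasSeriesDerivAt_star (he Λ hΛ) (hp_deriv Λ hΛ) (hV Λ hΛ).1,
      hflow Λ hΛ⟩⟩
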